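/- All graphs are finite and simple. A set $S$ of initially active vertices of a graph $G$ is a zero forcing set if all vertices become active under repeated use of the rule: if all neighbours of an active vertex $u$ except one neighbour $v$ are active, then $v$ becomes active. $G$ is an iso-unique zero forcing graph if for any two zero forcing sets $A,B$ of minimum cardinality there is an automorphism $\phi$ of $G$ with $\phi(A)=B$. A path cover of a forest is a set of vertex-disjoint induced paths that cover all vertices; it is minimum if it has the fewest paths. An edge that joins two different paths of a path cover is a connector edge and its ends are connector vertices; the path cover is interior if no connector vertex is an end-vertex of its path (the only vertex of a one-vertex path is an end-vertex of it). Algorithm Iso-Unique Zero Forcing Forest. Input: a forest $T$ with $n$ vertices. (1) Let $T'$ be obtained from $T$ as follows: for every vertex that is adjacent to more than two leaves of $T$, all but two of these leaves are removed. Let $\mathcal P$ be a minimum path cover of $T'$. If $\mathcal P$ is not interior, return NO. (2) Consider $\mathcal P$ in $T$, by adding each removed vertex as a one-vertex path. (3) For every path $P: x_1,\dots,x_\ell$ of $\mathcal P$ check that the following hold. (a) If $\ell\ge 3$ is odd and $p=\frac{\ell+1}{2}$, the connected components of $T-x_p$ that contain $x_{p-1}$ and $x_{p+1}$ are isomorphic.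 (b) If $\ell$ is even and $p=\frac{\ell}{2}$, the connected components of $T-x_px_{p+1}$ that contain $x_p$ and $x_{p+1}$ are isomorphic. Moreover (for every $\ell$), some automorphism of $T$ maps $x_1$ to $x_\ell$ and $x_\ell$ to $x_1$. If this is true for all paths of $\mathcal P$, return YES, otherwise return NO. Theorem. For every forest $T$, and for every choice of the removed leaves and of the minimum path cover $\mathcal P$ of $T'$, the algorithm returns YES if and only if $T$ is an iso-unique zero forcing forest. Moreover, the algorithm can be carried out in time $O(n^2)$: there are a fixed program for a random access machine (registers and arrays of natural numbers, a write-only output tape; unit cost for assignment, array access, successor, truncated subtraction, comparison, output and tests) and a constant $C$ such that for every $n\ge 0$, every forest $T$ on $\{0,\dots,n-1\}$ and every adjacency-list representation of $T$ as input, the program halts after at most $Cn^2+C$ steps, having written the record of a run of the algorithm on $T$: the removed leaves, the path cover $\mathcal P$ of $T'$, whether $\mathcal P$ is interior, the outcome of the check in (3) for each path (if $\mathcal P$ is interior), and the answer, which is YES if and only if $T$ is an iso-unique zero forcing forest. -/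

import Mathlib

namespace ZFForest

section Graphs

variable {V : Type*}

/-- The vertices that eventually become active when the vertices of `S` are active initially: the
least family that contains `S` and is closed under the activation rule, by which an active vertex
`u` activates its neighbour `v` as soon as all other neighbours of `u` are active. -/
inductive Activated (G : SimpleGraph V) (S : Set V) : V → Prop
  | initial {v : V} : v ∈ S → Activated G S v
  | force {u v : V} : Activated G S u → G.Adj u v →
      (∀ w, G.Adj u w → w ≠ v → Activated G S w) → Activated G S v

/-- `S` is a zero forcing set of `G`. -/
def IsZeroForcingSet (G : SimpleGraph V) (S : Set V) : Prop :=
  ∀ v, Activated G S v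

/-- `S` is a zero forcing set of `G` of minimum cardinality. -/
def IsMinZeroForcingSet (G : SimpleGraph V) (S : Set V) : Prop :=
  IsZeroForcingSet G S ∧ ∀ R : Set V, IsZeroForcingSet G R → S.ncard ≤ R.ncard

/-- `G` is an iso-unique zero forcing graph: any two minimum zero forcing sets are exchanged by an
automorphism of `G`. -/
def IsIsoUniqueZeroForcing (G : SimpleGraph V) : Prop :=
  ∀ A B : Set V, IsMinZeroForcingSet G A → IsMinZeroForcingSet G B →
    ∃ φ : G ≃g G, φ '' A = B

/-- The list `p` enumerates, from one end to the other, the vertices of an induced path of `G`. -/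
structure IsInducedPath (G : SimpleGraph V) (p : List V) : Prop where
  ne_nil : p ≠ []
  nodup : p.Nodup
  adj_iff : ∀ (i j : ℕ) (hi : i < p.length) (hj : j < p.length),
    G.Adj p[i] p[j] ↔ (i + 1 = j ∨ j + 1 = i)

/-- `P` is a path cover of `G`: vertex disjoint induced paths that cover all vertices. -/
structure IsPathCover (G : SimpleGraph V) (P : List (List V)) : Prop where
  isInducedPath : ∀ p ∈ P, IsInducedPath G p
  disjoint : P.Pairwise List.Disjoint
  cover : ∀ v, ∃ p ∈ P, v ∈ p

/-- `P` is a path cover of `G` with the minimum number of paths. -/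
def IsMinPathCover (G : SimpleGraph V) (P : List (List V)) : Prop :=
  IsPathCover G P ∧ ∀ Q : List (List V), IsPathCover G Q → P.length ≤ Q.length

/-- `xy` is a connector edge: an edge of `G` joining two different paths of `P`. -/
def IsConnectorEdge (G : SimpleGraph V) (P : List (List V)) (x y : V) : Prop :=
  G.Adj x y ∧ ∃ p ∈ P, ∃ q ∈ P, p ≠ q ∧ x ∈ p ∧ y ∈ q

/-- The path cover `P` is interior: a connector vertex is never an end-vertex of its path. -/
def IsInteriorCover (G : SimpleGraph V) (P : List (List V)) : Prop :=
  ∀ x y, IsConnectorEdge G P x y →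
    ∀ p ∈ P, x ∈ p → p.head? ≠ some x ∧ p.getLast? ≠ some x

/-- The leaves (vertices of degree one) adjacent to `v`. -/
def leavesAt (G : SimpleGraph V) (v : V) : Set V :=
  {u | G.Adj v u ∧ (G.neighborSet u).ncard = 1}

/-- `removed` lists the vertices deleted in the first step: at every vertex with more than two
adjacent leaves, all but two of these leaves are deleted, and nothing else is deleted. -/
structure IsPruning (T : SimpleGraph V) (removed : List V) : Prop where
  nodup : removed.Nodup
  leaf_of_mem : ∀ u ∈ removed, ∃ v, u ∈ leavesAt T v ∧ 2 < (leavesAt T v).ncard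
  two_remain : ∀ v, 2 < (leavesAt T v).ncard →
    (leavesAt T v \ {u | u ∈ removed}).ncard = 2

/-- The forest `T'` that remains after the vertices of `removed` are deleted. -/
def pruned (T : SimpleGraph V) (removed : List V) : SimpleGraph {v // v ∉ removed} :=
  T.comap Subtype.val

/-- A path cover of `T'` considered in `T`: each deleted vertex is added as a one-vertex path. -/
def coverInT (removed : List V) (P : List (List {v // v ∉ removed})) : List (List V) :=
  P.map (fun p => p.map Subtype.val) ++ removed.map (fun v => [v])

/-- The connected components of `H` that contain `a` and `b`, respectively, are isomorphic. -/
def ComponentsIso (H : SimpleGraph V) (a b : V) : Prop :=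
  Nonempty ((H.connectedComponentMk a).toSimpleGraph ≃g (H.connectedComponentMk b).toSimpleGraph)

/-- The conditions that are checked for a path `p : x₁, …, x_ℓ` of `T`. List indices start at 0,
so `p[i]` is `x_{i+1}`. -/
structure PathCheck (T : SimpleGraph V) (p : List V) : Prop where
  /-- `ℓ = 2k + 3` is odd (nothing is asked for `ℓ = 1`): the components of `T - x_{k+2}` that
  contain `x_{k+1}` and `x_{k+3}` are isomorphic. Here `T - x_{k+2}` is represented by deleting
  all edges at `x_{k+2}`, which does not affect these two components. -/
  odd : ∀ (k : ℕ) (h : p.length = 2 * k + 3),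
    ComponentsIso (T.deleteEdges (T.incidenceSet p[k + 1])) p[k] p[k + 2]
  /-- `ℓ = 2k + 2` is even: the components of `T - x_{k+1}x_{k+2}` that contain `x_{k+1}` and
  `x_{k+2}` are isomorphic. -/
  even : ∀ (k : ℕ) (h : p.length = 2 * k + 2),
    ComponentsIso (T.deleteEdges {s(p[k], p[k + 1])}) p[k] p[k + 1]
  /-- An automorphism of `T` swaps `x₁` and `x_ℓ`. -/
  swap : ∀ h : p ≠ [], ∃ φ : T ≃g T, φ (p.head h) = p.getLast h ∧ φ (p.getLast h) = p.head h

/-- The record of a run of the algorithm: the deleted leaves, the path cover of `T'`, the outcome of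
the test whether it is interior, the outcomes of the checks of the single paths, the answer. -/
structure Run (V : Type*) where
  removed : List V
  cover : List (List {v // v ∉ removed})
  interior : Bool
  checks : List Bool
  answer : Bool

/-- `r` is a run of Algorithm Iso-Unique Zero Forcing Forest on the input `T`. The choices that the
algorithm leaves open (which two leaves stay, which minimum path cover is used) are arbitrary. -/
structure Run.IsRunOn (r : Run V) (T : SimpleGraph V) : Prop where
  prune : IsPruning T r.removed
  minCover : IsMinPathCover (pruned T r.removed) r.cover
  interior_iff : r.interior = true ↔ IsInteriorCover (pruned T r.removed) r.cover
  /-- If the path cover is not interior, then the algorithm stops and returns NO. -/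
  not_interior : r.interior = false → r.checks = [] ∧ r.answer = false
  /-- Otherwise each path is checked, and the answer is YES if and only if no check fails. -/
  when_interior : r.interior = true →
    List.Forall₂ (fun p b => b = true ↔ PathCheck T p) (coverInT r.removed r.cover) r.checks ∧
      r.answer = r.checks.all id

end Graphs

section Machine

/-! A random access machine with finitely many registers and arrays that hold natural numbers (all
zero unless they hold the input), and a write-only output tape. The only arithmetic is successor,
truncated subtraction and comparison, so that unit cost is not abused: in `t` steps
the numbers in memory grow by `t` at most. -/

structure State where
  reg : ℕ → ℕ
  arr : ℕ → ℕ → ℕ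
  out : List ℕ

inductive RamExpr where
  | lit (k : ℕ)
  | reg (x : ℕ)
  | get (a : ℕ) (index : RamExpr)
  | succ (e : RamExpr)
  | sub (e₁ e₂ : RamExpr)
  | lt (e₁ e₂ : RamExpr)
  | eq (e₁ e₂ : RamExpr)

/-- The value of an expression; truth values are 0 and 1. -/
def RamExpr.eval (s : State) : RamExpr → ℕ
  | .lit k => k
  | .reg x => s.reg x
  | .get a i => s.arr a (i.eval s)
  | .succ e => e.eval s + 1
  | .sub e₁ e₂ => e₁.eval s - e₂.eval s
  | .lt e₁ e₂ => if e₁.eval s < e₂.eval s then 1 else 0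
  | .eq e₁ e₂ => if e₁.eval s = e₂.eval s then 1 else 0

/-- The number of elementary operations needed to evaluate an expression. -/
def RamExpr.cost : RamExpr → ℕ
  | .lit _ => 1
  | .reg _ => 1
  | .get _ i => i.cost + 1
  | .succ e => e.cost + 1
  | .sub e₁ e₂ => e₁.cost + e₂.cost + 1
  | .lt e₁ e₂ => e₁.cost + e₂.cost + 1
  | .eq e₁ e₂ => e₁.cost + e₂.cost + 1

inductive Program where
  | skip
  | set (x : ℕ) (e : RamExpr)
  | store (a : ℕ) (index e : RamExpr)
  | write (e : RamExpr)
  | seq (c₁ c₂ : Program)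
  | cond (e : RamExpr) (c₁ c₂ : Program)
  | loop (e : RamExpr) (c : Program)

/-- `Exec c s t s'`: started in the state `s`, the program `c` halts after exactly `t` elementary
steps in the state `s'`. `loop e c` repeats `c` while the value of `e` is not 0. -/
inductive Exec : Program → State → ℕ → State → Prop
  | skip (s : State) : Exec .skip s 1 s
  | set (x : ℕ) (e : RamExpr) (s : State) :
      Exec (.set x e) s (e.cost + 1) { s with reg := Function.update s.reg x (e.eval s) }
  | store (a : ℕ) (i e : RamExpr) (s : State) :
      Exec (.store a i e) s (i.cost + e.cost + 1)
        { s with arr := Function.update s.arr a (Function.update (s.arr a) (i.eval s) (e.eval s)) }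
  | write (e : RamExpr) (s : State) :
      Exec (.write e) s (e.cost + 1) { s with out := s.out ++ [e.eval s] }
  | seq {c₁ c₂ : Program} {s s' s'' : State} {t₁ t₂ : ℕ} :
      Exec c₁ s t₁ s' → Exec c₂ s' t₂ s'' → Exec (.seq c₁ c₂) s (t₁ + t₂) s''
  | cond_true {e : RamExpr} {c₁ c₂ : Program} {s s' : State} {t : ℕ} :
      e.eval s ≠ 0 → Exec c₁ s t s' → Exec (.cond e c₁ c₂) s (e.cost + 1 + t) s'
  | cond_false {e : RamExpr} {c₁ c₂ : Program} {s s' : State} {t : ℕ} :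
      e.eval s = 0 → Exec c₂ s t s' → Exec (.cond e c₁ c₂) s (e.cost + 1 + t) s'
  | loop_done {e : RamExpr} {c : Program} {s : State} :
      e.eval s = 0 → Exec (.loop e c) s (e.cost + 1) s
  | loop_step {e : RamExpr} {c : Program} {s s' s'' : State} {t₁ t₂ : ℕ} :
      e.eval s ≠ 0 → Exec c s t₁ s' → Exec (.loop e c) s' t₂ s'' →
        Exec (.loop e c) s (e.cost + 1 + t₁ + t₂) s''

end Machine

section InputOutput

variable {n : ℕ}

/-- `adj` is an adjacency list representation of `G`: `adj v` lists the neighbours of `v`, in any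
order, each of them once. -/
def IsAdjacencyList (G : SimpleGraph (Fin n)) (adj : Fin n → List (Fin n)) : Prop :=
  ∀ v, (adj v).Nodup ∧ ∀ w, w ∈ adj v ↔ G.Adj v w

/-- The lists `adj 0`, …, `adj (n - 1)`, one after the other. -/
def targets (adj : Fin n → List (Fin n)) : List ℕ :=
  ((List.finRange n).flatMap adj).map Fin.val

/-- The `i`-th entry, for `i = 0, …, n`, is the position in `targets adj` where `adj i` begins
(for `i = n`: the length of `targets adj`). -/
def offsets (adj : Fin n → List (Fin n)) : List ℕ :=
  (List.range (n + 1)).map fun i => (((List.finRange n).take i).flatMap adj).length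

/-- The initial state: register 0 holds `n`, array 0 the offsets, array 1 the targets; the rest of
the memory is zero and the output tape is empty. -/
def initialState (adj : Fin n → List (Fin n)) : State where
  reg x := if x = 0 then n else 0
  arr a i := if a = 0 then (offsets adj).getD i 0 else if a = 1 then (targets adj).getD i 0 else 0
  out := []

/-- The record of a run as it is written on the output tape: the number of deleted vertices and
these vertices, the number of paths of the cover of `T'` and for each of them its number of vertices
and its vertices in order, the outcome of the interior test, the outcomes of the checks, and last
the answer (1 for YES, 0 for NO). -/
def Run.output (r : Run (Fin n)) : List ℕ :=
  r.removed.length :: r.removed.map Fin.val ++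
    r.cover.length :: r.cover.flatMap (fun p => p.length :: p.map fun v => v.val.val) ++
    r.interior.toNat :: r.checks.map Bool.toNat ++ [r.answer.toNat]

end InputOutput

end ZFForest

open ZFForest

/-! In a forest, zero forcing sets and oriented path covers are the same thing. The forcing chains
of a zero forcing set are disjoint paths that cover everything, and the set consists of their first
vertices (`exists_pathSystem_of_isZeroForcingSet`). Conversely, the first vertices of any path cover
force everything (`isZeroForcingSet_heads`): a path on which forcing is blocked points, along a
connector edge, to another blocked path, and following these edges leads into ever smaller parts of
the forest. So the minimum zero forcing sets are the sets of first vertices of oriented minimum path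
covers.

Necessity. Iso-uniqueness implies that the multiset of automorphism orbits of the first vertices is
the same for all oriented minimum path covers (`perm_orbit_head?`). Reversing one path shows that
its two ends lie in one orbit. This is all that check (3) asks: an automorphism that maps one end of
a path to the other reverses its first half and can be cut down to an involution that exchanges the
two halves and fixes the rest (`exists_flip`, `pathCheck_iff`). If an end `x` had a connector edge
to `y`, rerouting the two paths through `xy` would give further minimum covers. Comparing orbits
puts the two path neighbours of `y` into the orbit of `x`, and an extremal argument shows that `x`
is a leaf. Then `y` keeps three leaves in the pruned forest, which the pruning excludes
(`isInteriorCover_of_isoUnique`).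

Sufficiency. In an interior cover every vertex has as many path edges as any path cover can give it,
namely the minimum of 2 and its degree; and an edge set of a forest is determined by its degrees
(`eq_of_edgeDegree_le`). Hence the interior cover is the only minimum cover up to order and
orientation, and every minimum zero forcing set, after a permutation of leaves with a common
neighbour, picks exactly one end of every path. Two such choices are matched by flipping paths in
the order of decreasing halves: a flip moves only vertices inside the halves of its path, and every
path met there has smaller halves (`ncard_headHalf_lt`), so what was matched before stays matched
(`exists_agree_on_ends`). The leaves at stars are then matched by transpositions
(`exists_iso_of_agree`).

Running time. A minimum path cover is a maximum set of edges with at most two edges at each vertex.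
It is found greedily by stripping vertices that have at most one remaining neighbour, with an
exchange argument for optimality (`IsExtendable.link`). The checks ask whether the two ends of a
path lie in one orbit. Colour refinement decides this: in a forest, vertices of one component with
equal colours in an equitable colouring are related by an automorphism (`IsEquitable.exists_iso`),
and the computed colouring is invariant under automorphisms. Each colour is used for refinement only
once (`IsStableBelow`), and there are at most `n` colours. Since a forest has linearly many edges,
each pass over all adjacency lists takes linear time, and linearly many passes suffice. -/

namespace ZFForest
open SimpleGraph

/-! ### Bridges, sides of edges, and systems of disjoint paths in forests -/

section Forests

variable {V : Type*} {T : SimpleGraph V}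

theorem not_reachable_deleteEdges (hT : T.IsAcyclic) {u w : V} (h : T.Adj u w) :
    ¬ (T.deleteEdges {s(u, w)}).Reachable u w :=
  isBridge_iff.1 (isAcyclic_iff_forall_adj_isBridge.1 hT h)

/-- The vertices on the side of `w` when the edge `uw` is deleted. -/
def side (T : SimpleGraph V) (u w : V) : Set V :=
  {v | (T.deleteEdges {s(u, w)}).Reachable w v}

/-- Only the edges met by walks from `a` have to survive. In this form reachability passes between
graphs with different deleted edges that agree near `a`. -/
theorem Reachable.mono_on {H K : SimpleGraph V} {a b : V} (h : H.Reachable a b)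
    (hHK : ∀ x y, H.Reachable a x → H.Adj x y → K.Adj x y) : K.Reachable a b := by
  have h' := (reachable_iff_reflTransGen a b).1 h
  induction h' with
  | refl => exact Reachable.refl _
  | @tail x y hx hxy ih =>
    have hx' := (reachable_iff_reflTransGen a x).2 hx
    exact (ih hx').trans (hHK x y hx' hxy).reachable

theorem Reachable.mem_of_closed {H : SimpleGraph V} {a b : V} (h : H.Reachable a b) {S : Set V}
    (ha : a ∈ S) (hS : ∀ x y, x ∈ S → H.Adj x y → y ∈ S) : b ∈ S := by
  have h' := (reachable_iff_reflTransGen a b).1 h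
  induction h' with
  | refl => exact ha
  | @tail x y hx hxy ih => exact hS x y (ih ((reachable_iff_reflTransGen a x).2 hx)) hxy

theorem mem_side_self (u w : V) : w ∈ side T u w := Reachable.refl _

/-- Sides of edges are nested. -/
theorem side_ssubset (hT : T.IsAcyclic) {u w u' w' : V} (h : T.Adj u' w')
    (hne : s(u, w) ≠ s(u', w')) (hu' : u' ∈ side T u w)
    (hw : (T.deleteEdges {s(u', w')}).Reachable w u') : side T u' w' ⊂ side T u w := by
  have hw' : w ∉ side T u' w' := fun hm =>
    not_reachable_deleteEdges hT h (Reachable.symm (Reachable.trans hm hw))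
  refine ⟨fun v hv => ?_, fun hsub => hw' (hsub (mem_side_self u w))⟩
  have h1 : (T.deleteEdges {s(u, w)}).Adj u' w' := by
    simp only [deleteEdges_adj, Set.mem_singleton_iff]
    exact ⟨h, fun e => hne e.symm⟩
  refine Reachable.trans hu' (h1.reachable.trans ?_)
  refine Reachable.mono_on hv fun x y hx hxy => ?_
  simp only [deleteEdges_adj, Set.mem_singleton_iff] at hxy ⊢
  refine ⟨hxy.1, fun e => ?_⟩
  have hxs : x ∈ side T u' w' := hx
  have hys : y ∈ side T u' w' := by
    refine Reachable.trans hx (Adj.reachable ?_)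
    simp only [deleteEdges_adj, Set.mem_singleton_iff]
    exact hxy
  rcases Sym2.eq_iff.1 e with ⟨-, rfl⟩ | ⟨rfl, -⟩
  · exact hw' hys
  · exact hw' hxs

/-- Every nonempty set of vertices of a finite forest contains a vertex with at most one neighbour
in the set. -/
theorem exists_atMostOne_neighbor [Finite V] (hT : T.IsAcyclic) {U : Set V} (hU : U.Nonempty) :
    ∃ v ∈ U, ∀ a ∈ U, ∀ b ∈ U, T.Adj v a → T.Adj v b → a = b := by
  by_contra! hcon
  obtain ⟨v, hv⟩ := hU
  obtain ⟨a, ha, -, -, hva, -⟩ := hcon v hv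
  let E : Set (V × V) := {e | e.1 ∈ U ∧ e.2 ∈ U ∧ T.Adj e.1 e.2}
  -- An oriented edge inside `U` with the fewest vertices beyond it. A second neighbour of `w` in
  -- `U` would give an edge further out with still fewer.
  obtain ⟨⟨u, w⟩, ⟨hu, hw, huw⟩, hmin⟩ :=
    Set.exists_min_image E (fun e => (side T e.1 e.2).ncard) (Set.toFinite E)
      ⟨(v, a), hv, ha, hva⟩
  obtain ⟨w', hw', hwu, hne⟩ : ∃ w' ∈ U, T.Adj w w' ∧ w' ≠ u := by
    obtain ⟨a, ha, b, hb, hwa, hwb, hab⟩ := hcon w hw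
    by_cases h : a = u
    · exact ⟨b, hb, hwb, fun e => hab (h.trans e.symm)⟩
    · exact ⟨a, ha, hwa, h⟩
  have hss : side T w w' ⊂ side T u w := by
    refine side_ssubset hT hwu (fun e => ?_) (mem_side_self u w) (Reachable.refl _)
    rcases Sym2.eq_iff.1 e with ⟨h1, -⟩ | ⟨h1, -⟩
    · exact huw.ne h1
    · exact hne h1.symm
  exact absurd (hmin (w, w') ⟨hw, hw', hwu⟩) (not_le.2 (Set.ncard_lt_ncard hss (Set.toFinite _)))

theorem reachable_getElem {H : SimpleGraph V} {p : List V} {i j : ℕ} (hij : i ≤ j)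
    (hj : j < p.length)
    (h : ∀ (k : ℕ) (_ : i ≤ k) (hk : k < j), H.Adj (p[k]'(by omega)) (p[k + 1]'(by omega))) :
    H.Reachable (p[i]'(by omega)) p[j] := by
  induction j, hij using Nat.le_induction with
  | base => exact Reachable.refl _
  | succ j hij ih =>
    exact (ih (by omega) fun k h1 h2 => h k h1 (by omega)).trans (h j hij (by omega)).reachable

theorem reachable_of_isChain {H : SimpleGraph V} {p : List V} (h : p.IsChain H.Adj) {x y : V}
    (hx : x ∈ p) (hy : y ∈ p) : H.Reachable x y := by
  obtain ⟨i, hi, rfl⟩ := List.getElem_of_mem hx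
  obtain ⟨j, hj, rfl⟩ := List.getElem_of_mem hy
  rcases le_total i j with hij | hij
  · exact reachable_getElem hij hj fun k _ hk => h.getElem k (by omega)
  · exact (reachable_getElem hij hi fun k _ hk => h.getElem k (by omega)).symm

/-- A chord would not be a bridge, because the segment of the chain between its ends bypasses it. -/
theorem adj_iff_of_isChain (hT : T.IsAcyclic) {p : List V} (hn : p.Nodup)
    (hc : p.IsChain T.Adj) {i j : ℕ} (hi : i < p.length) (hj : j < p.length) :
    T.Adj p[i] p[j] ↔ (i + 1 = j ∨ j + 1 = i) := by
  have key : ∀ i j (hi : i < p.length) (hj : j < p.length), i ≤ j → T.Adj p[i] p[j] →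
      i + 1 = j := by
    intro i j hi hj hij hadj
    by_contra hne
    refine not_reachable_deleteEdges hT hadj (reachable_getElem hij hj fun k h1 h2 => ?_)
    simp only [deleteEdges_adj, Set.mem_singleton_iff]
    refine ⟨hc.getElem k (by omega), fun e => ?_⟩
    rcases Sym2.eq_iff.1 e with ⟨e1, e2⟩ | ⟨e1, e2⟩
    · rw [hn.getElem_inj_iff] at e1 e2; omega
    · rw [hn.getElem_inj_iff] at e1 e2
      subst e1; omega
  constructor
  · intro h
    rcases le_total i j with hij | hij
    · exact Or.inl (key i j hi hj hij h)
    · exact Or.inr (key j i hj hi hij h.symm)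
  · rintro (rfl | rfl)
    · exact hc.getElem i hj
    · exact (hc.getElem j hi).symm

/-- The list `p` is the vertex sequence of a path of `G` (with at least one vertex). -/
structure IsPathList (G : SimpleGraph V) (p : List V) : Prop where
  ne_nil : p ≠ []
  nodup : p.Nodup
  chain : p.IsChain G.Adj

/-- Since chords cannot occur in a forest, inducedness is dropped from here on and paths are treated
as chains. -/
theorem isInducedPath_iff (hT : T.IsAcyclic) {p : List V} :
    IsInducedPath T p ↔ IsPathList T p := by
  constructor
  · rintro ⟨h1, h2, h3⟩
    exact ⟨h1, h2, List.isChain_iff_getElem.2 fun i hi => (h3 i (i + 1) (by omega) hi).2 (Or.inl rfl)⟩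
  · rintro ⟨h1, h2, h3⟩
    exact ⟨h1, h2, fun i j hi hj => adj_iff_of_isChain hT h2 h3 hi hj⟩

theorem IsPathList.reverse {p : List V} (h : IsPathList T p) : IsPathList T p.reverse :=
  ⟨by simpa using h.ne_nil, List.nodup_reverse.2 h.nodup, by
    rw [List.isChain_reverse]
    exact h.chain.imp fun a b hab => hab.symm⟩

theorem IsPathList.map {W : Type*} {H : SimpleGraph W} {p : List V} (h : IsPathList T p)
    {f : V → W} (hf : Function.Injective f) (hadj : ∀ a b, T.Adj a b → H.Adj (f a) (f b)) :
    IsPathList H (p.map f) :=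
  ⟨by simpa using h.ne_nil, h.nodup.map hf, by
    rw [List.isChain_map]
    exact h.chain.imp fun a b hab => hadj a b hab⟩

theorem isPathList_singleton (v : V) : IsPathList T [v] := ⟨by simp, by simp, by simp⟩

/-- Vertex disjoint paths of `G`. -/
structure IsPathSystem (G : SimpleGraph V) (P : List (List V)) : Prop where
  isPathList : ∀ p ∈ P, IsPathList G p
  disjoint : P.Pairwise List.Disjoint

theorem isPathCover_iff (hT : T.IsAcyclic) {P : List (List V)} :
    IsPathCover T P ↔ IsPathSystem T P ∧ ∀ v, ∃ p ∈ P, v ∈ p := by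
  constructor
  · rintro ⟨h1, h2, h3⟩
    exact ⟨⟨fun p hp => (isInducedPath_iff hT).1 (h1 p hp), h2⟩, h3⟩
  · rintro ⟨⟨h1, h2⟩, h3⟩
    exact ⟨fun p hp => (isInducedPath_iff hT).2 (h1 p hp), h2, h3⟩

theorem pairwise_disjoint_eq {P : List (List V)} (h : P.Pairwise List.Disjoint) {p q : List V}
    (hp : p ∈ P) (hq : q ∈ P) {v : V} (hvp : v ∈ p) (hvq : v ∈ q) : p = q := by
  by_contra hne
  have hsymm : Std.Symm (List.Disjoint : List V → List V → Prop) :=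
    ⟨fun a b hab => hab.symm⟩
  exact (h.forall hp hq hne) hvp hvq

theorem IsPathSystem.eq_of_mem {P : List (List V)} (h : IsPathSystem T P) {p q : List V}
    (hp : p ∈ P) (hq : q ∈ P) {v : V} (hvp : v ∈ p) (hvq : v ∈ q) : p = q :=
  pairwise_disjoint_eq h.disjoint hp hq hvp hvq

theorem IsPathSystem.perm {P Q : List (List V)} (h : IsPathSystem T P) (hPQ : P.Perm Q) :
    IsPathSystem T Q :=
  ⟨fun p hp => h.isPathList p (hPQ.mem_iff.2 hp),
    (hPQ.pairwise_iff (fun hab => List.Disjoint.symm hab)).1 h.disjoint⟩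

theorem IsPathSystem.nodup_flatten {P : List (List V)} (h : IsPathSystem T P) :
    P.flatten.Nodup :=
  List.nodup_flatten.2 ⟨fun p hp => (h.isPathList p hp).nodup, h.disjoint⟩

theorem IsPathSystem.map {W : Type*} {H : SimpleGraph W} {P : List (List V)}
    (h : IsPathSystem T P) {f : V → W} (hf : Function.Injective f)
    (hadj : ∀ a b, T.Adj a b → H.Adj (f a) (f b)) : IsPathSystem H (P.map (List.map f)) := by
  refine ⟨fun p hp => ?_, ?_⟩
  · obtain ⟨q, hq, rfl⟩ := List.mem_map.1 hp
    exact (h.isPathList q hq).map hf hadj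
  · rw [List.pairwise_map]
    refine h.disjoint.imp fun {a b} hab => ?_
    exact (List.disjoint_map hf hab)

theorem isPathSystem_cons {P : List (List V)} {p : List V} :
    IsPathSystem T (p :: P) ↔ IsPathList T p ∧ (∀ q ∈ P, p.Disjoint q) ∧ IsPathSystem T P := by
  constructor
  · rintro ⟨h1, h2⟩
    rw [List.pairwise_cons] at h2
    exact ⟨h1 p (by simp), h2.1, ⟨fun q hq => h1 q (by simp [hq]), h2.2⟩⟩
  · rintro ⟨h1, h2, ⟨h3, h4⟩⟩
    refine ⟨fun q hq => ?_, List.pairwise_cons.2 ⟨h2, h4⟩⟩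
    rcases List.mem_cons.1 hq with rfl | hq
    · exact h1
    · exact h3 q hq

/-- The first vertices of the paths of `P`. -/
def heads (P : List (List V)) : Set V := {v | ∃ p ∈ P, p.head? = some v}

theorem heads_perm {P Q : List (List V)} (h : P.Perm Q) : heads P = heads Q := by
  ext v; simp [heads, h.mem_iff]

theorem mem_of_head? {p : List V} {v : V} (h : p.head? = some v) : v ∈ p :=
  List.mem_of_mem_head? h

theorem ncard_heads {P : List (List V)} (h : IsPathSystem T P) : (heads P).ncard = P.length := by
  classical
  induction P with
  | nil => simp [heads]
  | cons p P ih =>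
    obtain ⟨h1, h2, h3⟩ := isPathSystem_cons.1 h
    obtain ⟨a, l, rfl⟩ := List.exists_cons_of_ne_nil h1.ne_nil
    have : heads ((a :: l) :: P) = insert a (heads P) := by
      ext v
      simp only [heads, Set.mem_ofPred_eq, List.mem_cons, Set.mem_insert_iff]
      constructor
      · rintro ⟨q, rfl | hq, hv⟩
        · left; simpa using hv.symm
        · exact Or.inr ⟨q, hq, hv⟩
      · rintro (rfl | ⟨q, hq, hv⟩)
        · exact ⟨v :: l, Or.inl rfl, rfl⟩
        · exact ⟨q, Or.inr hq, hv⟩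
    have hfin : (heads P).Finite := by
      refine (List.finite_toSet (P.flatten)).subset fun v => ?_
      rintro ⟨q, hq, hv⟩
      exact List.mem_flatten.2 ⟨q, hq, mem_of_head? hv⟩
    rw [this, Set.ncard_insert_of_notMem _ hfin, ih h3, List.length_cons]
    rintro ⟨q, hq, hv⟩
    exact h2 q hq (List.mem_cons_self) (mem_of_head? hv)

end Forests


/-! ### Minimum zero forcing sets as first vertices of minimum path covers -/

section ZeroForcing

variable {V : Type*} {T : SimpleGraph V}

theorem isChain_deleteEdges {p : List V} (hp : p.IsChain T.Adj) {a b : V} (ha : a ∉ p) :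
    p.IsChain (T.deleteEdges {s(a, b)}).Adj := by
  refine List.isChain_iff_getElem.2 fun i hi => ?_
  simp only [deleteEdges_adj, Set.mem_singleton_iff]
  refine ⟨hp.getElem i hi, fun e => ?_⟩
  rcases Sym2.eq_iff.1 e with ⟨e1, -⟩ | ⟨-, e1⟩
  · exact ha (e1 ▸ List.getElem_mem _)
  · exact ha (e1 ▸ List.getElem_mem _)

/-- The first vertices of the paths of a path cover of a forest form a zero forcing set. -/
theorem isZeroForcingSet_heads [Finite V] (hT : T.IsAcyclic) {P : List (List V)}
    (hP : IsPathSystem T P) (hcov : ∀ v, ∃ p ∈ P, v ∈ p) : IsZeroForcingSet T (heads P) := by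
  by_contra hcon
  let X : Set V := {v | Activated T (heads P) v}
  -- A place where forcing along `p` is blocked: an active vertex `u` of `p` with an inactive
  -- neighbour `w` off the path.
  let Stuck : List V → V → V → Prop := fun p u w =>
    u ∈ p ∧ u ∈ X ∧ w ∉ X ∧ T.Adj u w ∧ w ∉ p
  have hstuck : ∀ p ∈ P, ∀ v ∈ p, v ∉ X → ∃ u w, Stuck p u w := by
    intro p hp v hv hvX
    have hpl := hP.isPathList p hp
    classical
    -- The first inactive vertex of `p` is not the head, so its predecessor is active. As the
    -- predecessor does not force it, there is a second inactive neighbour; this one is off the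
    -- path, because the only other path neighbour comes earlier and is active.
    have hex : ∃ i, ∃ hi : i < p.length, p[i] ∉ X := by
      obtain ⟨i, hi, rfl⟩ := List.getElem_of_mem hv
      exact ⟨i, hi, hvX⟩
    obtain ⟨hj, hjX⟩ := Nat.find_spec hex
    have hmin : ∀ i (hi : i < p.length), i < Nat.find hex → p[i] ∈ X := fun i hi h => by
      by_contra hc
      exact Nat.find_min hex h ⟨hi, hc⟩
    generalize Nat.find hex = j at hj hjX hmin
    obtain _ | j := j
    · have hhead : p[0] ∈ heads P := ⟨p, hp, by simp [List.head?_eq_getElem?, hj]⟩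
      exact absurd (Activated.initial hhead) hjX
    have hjX' := hmin j (by omega) (by omega)
    have hadj : T.Adj p[j] p[j + 1] := hpl.chain.getElem j hj
    obtain ⟨w, hw1, hw2, hw3⟩ : ∃ w, T.Adj p[j] w ∧ w ≠ p[j + 1] ∧ w ∉ X := by
      by_contra! hc
      exact hjX (Activated.force hjX' hadj hc)
    refine ⟨p[j], w, List.getElem_mem _, hjX', hw3, hw1, fun hwp => ?_⟩
    obtain ⟨k, hk, rfl⟩ := List.getElem_of_mem hwp
    rcases (adj_iff_of_isChain hT hpl.nodup hpl.chain (by omega) hk).1 hw1 with rfl | h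
    · exact hw2 rfl
    · exact hw3 (hmin k hk (by omega))
  obtain ⟨v, hv⟩ := not_forall.1 hcon
  obtain ⟨p, hp, hvp⟩ := hcov v
  obtain ⟨u, w, hs⟩ := hstuck p hp v hvp hv
  let E : Set (V × V) := {e | ∃ p ∈ P, Stuck p e.1 e.2}
  -- Among all blocked places take one with the smallest side. The path through `w` is blocked too,
  -- at an edge that lies beyond `uw` and therefore has a smaller side.
  obtain ⟨⟨u, w⟩, ⟨p, hp, hup, huX, hwX, huw, hwp⟩, hmin⟩ :=
    Set.exists_min_image E (fun e => (side T e.1 e.2).ncard) (Set.toFinite E)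
      ⟨(u, w), p, hp, hs⟩
  dsimp only at hup huX hwX huw hwp hmin
  obtain ⟨p', hp', hwp'⟩ := hcov w
  obtain ⟨u', w', hs'⟩ := hstuck p' hp' w hwp' hwX
  have hmem : (u', w') ∈ E := ⟨p', hp', hs'⟩
  obtain ⟨hup', huX', hwX', huw', hwp''⟩ := hs'
  have hup'' : u ∉ p' := fun h => hwp ((hP.eq_of_mem hp hp' hup h) ▸ hwp')
  have hc := (hP.isPathList p' hp').chain
  have hss : side T u' w' ⊂ side T u w := by
    refine side_ssubset hT huw' (fun e => ?_)
      (reachable_of_isChain (isChain_deleteEdges hc hup'') hwp' hup') ?_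
    · rcases Sym2.eq_iff.1 e with ⟨rfl, -⟩ | ⟨-, rfl⟩
      · exact hup'' hup'
      · exact hwX huX'
    · rw [Sym2.eq_swap]
      exact reachable_of_isChain (isChain_deleteEdges hc hwp'') hwp' hup'
  exact absurd (hmin (u', w') hmem) (not_le.2 (Set.ncard_lt_ncard hss (Set.toFinite _)))

/-- A zero forcing set of a forest consists of the first vertices of the paths of some path
cover. -/
theorem exists_pathSystem_of_isZeroForcingSet [Finite V] {S : Set V}
    (hS : IsZeroForcingSet T S) :
    ∃ P : List (List V), IsPathSystem T P ∧ (∀ v, ∃ p ∈ P, v ∈ p) ∧ heads P = S := by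
  classical
  -- `X` is the active set so far and `P` the forcing chains. The last clause says that a vertex
  -- with a successor on its chain has no inactive neighbour left, so only the last vertex of a
  -- chain can force.
  let Good : Set V → List (List V) → Prop := fun X P =>
    IsPathSystem T P ∧ (∀ v, v ∈ X ↔ ∃ p ∈ P, v ∈ p) ∧ heads P = S ∧
      ∀ p ∈ P, ∀ u ∈ p, p.getLast? ≠ some u → ∀ w, T.Adj u w → w ∈ X
  have step : ∀ X P, Good X P → X ≠ Set.univ → ∃ v ∉ X, ∃ P', Good (insert v X) P' := by
    rintro X P ⟨h1, h2, h3, h4⟩ hX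
    have hSX : S ⊆ X := by
      rw [← h3]
      rintro v ⟨p, hp, hv⟩
      exact (h2 v).2 ⟨p, hp, mem_of_head? hv⟩
    obtain ⟨u, v, huX, hvX, huv, hall⟩ :
        ∃ u v, u ∈ X ∧ v ∉ X ∧ T.Adj u v ∧ ∀ w, T.Adj u w → w ≠ v → w ∈ X := by
      by_contra! hc
      refine hX (Set.eq_univ_of_forall fun v => ?_)
      induction hS v with
      | initial h => exact hSX h
      | @force u v _ huv _ ih1 ih2 =>
        by_contra hv
        obtain ⟨w, hw1, hw2, hw3⟩ := hc u v ih1 hv huv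
        exact hw3 (ih2 w hw1 hw2)
    obtain ⟨p, hp, hup⟩ := (h2 u).1 huX
    have hlast : p.getLast? = some u := by
      by_contra hne
      exact hvX (h4 p hp u hup hne v huv)
    obtain ⟨l, rfl⟩ : ∃ l, p = l ++ [u] := ⟨p.dropLast, by
      rw [List.getLast?_eq_some_iff] at hlast
      obtain ⟨l, rfl⟩ := hlast
      simp⟩
    have hperm : P.Perm ((l ++ [u]) :: P.erase (l ++ [u])) := List.perm_cons_erase hp
    generalize P.erase (l ++ [u]) = R at hperm
    have h1' := isPathSystem_cons.1 (h1.perm hperm)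
    have hmem : ∀ q, q ∈ P ↔ q = l ++ [u] ∨ q ∈ R := fun q => by
      rw [hperm.mem_iff, List.mem_cons]
    have hvR : ∀ q ∈ P, v ∉ q := fun q hq hv => hvX ((h2 v).2 ⟨q, hq, hv⟩)
    -- The forced vertex `v` prolongs the chain that ends in the forcing vertex `u`.
    refine ⟨v, hvX, (l ++ [u] ++ [v]) :: R, isPathSystem_cons.2 ⟨⟨by simp, ?_, ?_⟩, ?_, h1'.2.2⟩,
      ?_, ?_, ?_⟩
    · refine List.Nodup.append h1'.1.nodup (by simp) ?_
      intro x hx hx'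
      rw [List.mem_singleton] at hx'
      exact hvR _ hp (hx' ▸ hx)
    · refine List.IsChain.append h1'.1.chain (by simp) ?_
      intro x hx y hy
      simp at hx hy
      rw [← hx, ← hy]; exact huv
    · intro q hq x hx hxq
      rcases List.mem_append.1 hx with hx | hx
      · exact h1'.2.1 q hq hx hxq
      · rw [List.mem_singleton] at hx
        exact hvR q ((hmem q).2 (Or.inr hq)) (hx ▸ hxq)
    · intro x
      rw [Set.mem_insert_iff, h2 x]
      simp only [hmem, List.mem_cons]
      constructor
      · rintro (rfl | ⟨q, rfl | hq, hx⟩)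
        · exact ⟨_, Or.inl rfl, by simp⟩
        · exact ⟨_, Or.inl rfl, by simp only [List.mem_append] at hx ⊢; exact Or.inl hx⟩
        · exact ⟨q, Or.inr hq, hx⟩
      · rintro ⟨q, rfl | hq, hx⟩
        · rcases List.mem_append.1 hx with hx | hx
          · exact Or.inr ⟨_, Or.inl rfl, hx⟩
          · exact Or.inl (List.mem_singleton.1 hx)
        · exact Or.inr ⟨q, Or.inr hq, hx⟩
    · rw [← h3, heads_perm hperm]
      ext x
      simp [heads]
    · intro q hq x hx hne w hw
      rcases List.mem_cons.1 hq with rfl | hq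
      · have hxl : x ∈ l ++ [u] := by
          rcases List.mem_append.1 hx with hx | hx
          · exact hx
          · rw [List.mem_singleton] at hx
            simp [hx] at hne
        by_cases hxu : x = u
        · subst hxu
          by_cases hwv : w = v
          · exact Or.inl hwv
          · exact Or.inr (hall w hw hwv)
        · refine Or.inr (h4 _ hp x hxl ?_ w hw)
          simpa using fun h => hxu h.symm
      · exact Or.inr (h4 q ((hmem q).2 (Or.inr hq)) x hx hne w hw)
  have main : ∀ (k : ℕ) X P, Good X P → Xᶜ.ncard = k → ∃ P', Good Set.univ P' := by
    intro k
    induction k with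
    | zero =>
      intro X P h hk
      rw [Set.ncard_eq_zero (Set.toFinite _), Set.compl_empty_iff] at hk
      exact ⟨P, hk ▸ h⟩
    | succ k ih =>
      intro X P h hk
      have hX : X ≠ Set.univ := by
        rintro rfl
        simp at hk
      obtain ⟨v, hv, P', hP'⟩ := step X P h hX
      refine ih _ P' hP' ?_
      have : (insert v X)ᶜ = Xᶜ \ {v} := by
        ext x; simp [and_comm]
      rw [this, Set.ncard_sdiff_singleton_of_mem (by simpa using hv), hk]
      rfl
  have hfin := Set.toFinite S
  let P₀ : List (List V) := hfin.toFinset.toList.map fun v => [v]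
  have hP₀ : ∀ p, p ∈ P₀ ↔ ∃ v ∈ S, p = [v] := by
    intro p; simp [P₀, eq_comm]
  suffices h : Good S P₀ by
    obtain ⟨P, hP⟩ := main _ S P₀ h rfl
    exact ⟨P, hP.1, fun v => (hP.2.1 v).1 trivial, hP.2.2.1⟩
  refine ⟨⟨fun p hp => ?_, ?_⟩, fun v => ?_, ?_, ?_⟩
  · obtain ⟨v, -, rfl⟩ := (hP₀ p).1 hp
    exact isPathList_singleton v
  · rw [List.pairwise_map]
    refine (Finset.nodup_toList _).imp fun {a b} hab => ?_
    simpa [eq_comm] using hab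
  · simp [hP₀]
  · ext v; simp [heads, hP₀]
  · intro p hp u hu hne
    obtain ⟨v, -, rfl⟩ := (hP₀ p).1 hp
    simp at hu hne
    exact absurd hu.symm hne

theorem Activated.map {W : Type*} {G : SimpleGraph V} {S : Set V}
    {H : SimpleGraph W} (φ : G ≃g H) {v : V} (h : Activated G S v) :
    Activated H (φ '' S) (φ v) := by
  induction h with
  | initial h => exact Activated.initial ⟨_, h, rfl⟩
  | @force u v _ huv _ ih1 ih2 =>
    refine Activated.force ih1 (φ.map_adj_iff.2 huv) fun w hw hne => ?_
    obtain ⟨w, rfl⟩ := φ.surjective w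
    exact ih2 w (φ.map_adj_iff.1 hw) fun e => hne (e ▸ rfl)

theorem IsZeroForcingSet.image {S : Set V} (h : IsZeroForcingSet T S) (φ : T ≃g T) :
    IsZeroForcingSet T (φ '' S) := fun v => by
  obtain ⟨v, rfl⟩ := φ.surjective v
  exact (h v).map φ

theorem IsMinZeroForcingSet.image {S : Set V} (h : IsMinZeroForcingSet T S) (φ : T ≃g T) :
    IsMinZeroForcingSet T (φ '' S) :=
  ⟨h.1.image φ, fun R hR => by
    rw [Set.ncard_image_of_injective _ φ.injective]; exact h.2 R hR⟩

/-- Both translations between path covers and zero forcing sets preserve cardinality, so minimality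
passes from one side to the other. -/
theorem isMinZeroForcingSet_heads [Finite V] (hT : T.IsAcyclic) {P : List (List V)}
    (hP : IsMinPathCover T P) : IsMinZeroForcingSet T (heads P) := by
  obtain ⟨h1, h2⟩ := (isPathCover_iff hT).1 hP.1
  refine ⟨isZeroForcingSet_heads hT h1 h2, fun R hR => ?_⟩
  obtain ⟨Q, hQ1, hQ2, rfl⟩ := exists_pathSystem_of_isZeroForcingSet hR
  rw [ncard_heads h1, ncard_heads hQ1]
  exact hP.2 Q ((isPathCover_iff hT).2 ⟨hQ1, hQ2⟩)

theorem IsMinZeroForcingSet.exists_minPathCover [Finite V] (hT : T.IsAcyclic) {A : Set V}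
    (hA : IsMinZeroForcingSet T A) : ∃ P, IsMinPathCover T P ∧ heads P = A := by
  obtain ⟨P, hP1, hP2, rfl⟩ := exists_pathSystem_of_isZeroForcingSet hA.1
  refine ⟨P, ⟨(isPathCover_iff hT).2 ⟨hP1, hP2⟩, fun Q hQ => ?_⟩, rfl⟩
  obtain ⟨h1, h2⟩ := (isPathCover_iff hT).1 hQ
  rw [← ncard_heads h1, ← ncard_heads hP1]
  exact hA.2 _ (isZeroForcingSet_heads hT h1 h2)

end ZeroForcing


/-! ### Automorphisms that reverse a path, and the halves of a path -/

section Flips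

variable {V : Type*} {T : SimpleGraph V}

/-- An automorphism can be turned into an involution that exchanges `C` with its image. -/
theorem exists_exchange (φ : T ≃g T) (C : Set V) (hdisj : ∀ v ∈ C, φ v ∉ C)
    (hb : ∀ u ∈ C, ∀ v ∉ C, T.Adj u v → φ v = v ∨ (φ u = v ∧ φ v = u)) :
    ∃ ψ : T ≃g T, (∀ v ∈ C, ψ v = φ v) ∧ (∀ v ∈ C, ψ (φ v) = v) ∧
      ∀ v, v ∉ C → v ∉ φ '' C → ψ v = v := by
  classical
  -- `φ` on `C`, its inverse on the image of `C`, and the identity elsewhere. By `hb`, an edge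
  -- leaving `C` either ends in a fixed vertex or is reversed by `φ`, so the three pieces fit
  -- together.
  let f : V → V := fun v => if v ∈ C then φ v else if φ.symm v ∈ C then φ.symm v else v
  have f1 : ∀ v ∈ C, f v = φ v := fun v hv => by simp [f, hv]
  have f2 : ∀ v ∈ C, f (φ v) = v := fun v hv => by simp [f, hdisj v hv, hv]
  have f3 : ∀ v, v ∉ C → (∀ w ∈ C, φ w ≠ v) → f v = v := fun v hv hw => by
    have : φ.symm v ∉ C := fun h => hw _ h (by simp)
    simp [f, hv, this]
  have cases : ∀ v, v ∈ C ∨ (∃ w ∈ C, φ w = v) ∨ (v ∉ C ∧ ∀ w ∈ C, φ w ≠ v) := by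
    intro v
    by_cases h1 : v ∈ C
    · exact Or.inl h1
    by_cases h2 : ∃ w ∈ C, φ w = v
    · exact Or.inr (Or.inl h2)
    · push Not at h2
      exact Or.inr (Or.inr ⟨h1, h2⟩)
  have hinv : ∀ v, f (f v) = v := by
    intro v
    rcases cases v with h | ⟨w, hw, rfl⟩ | ⟨h1, h2⟩
    · rw [f1 v h, f2 v h]
    · rw [f2 w hw, f1 w hw]
    · rw [f3 v h1 h2, f3 v h1 h2]
  have hfix : ∀ u ∈ C, ∀ v, v ∉ C → (∀ w ∈ C, φ w ≠ v) → T.Adj u v → φ v = v := by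
    intro u hu v hv hv' huv
    rcases hb u hu v hv huv with h | ⟨h, -⟩
    · exact h
    · exact absurd h (hv' u hu)
  have hadj : ∀ u v, T.Adj u v → T.Adj (f u) (f v) := by
    have key1 : ∀ u ∈ C, ∀ v, v ∉ C → (∀ w ∈ C, φ w ≠ v) → T.Adj u v →
        T.Adj (f u) (f v) := by
      intro u hu v hv hv' huv
      rw [f1 u hu, f3 v hv hv']
      have := φ.map_adj_iff.2 huv
      rwa [hfix u hu v hv hv' huv] at this
    have key2 : ∀ u ∈ C, ∀ w ∈ C, T.Adj u (φ w) → T.Adj (f u) (f (φ w)) := by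
      intro u hu w hw huw
      rw [f1 u hu, f2 w hw]
      rcases hb u hu _ (hdisj w hw) huw with h | ⟨h1, h2⟩
      · exact absurd (φ.injective h) fun e => hdisj w hw (e.symm ▸ hw)
      · have : w = u := φ.injective h1.symm
        subst this
        exact huw.symm
    have key3 : ∀ u ∈ C, ∀ v, v ∉ C → (∀ w ∈ C, φ w ≠ v) → T.Adj (φ u) v →
        T.Adj (f (φ u)) (f v) := by
      intro u hu v hv hv' huv
      rw [f2 u hu, f3 v hv hv']
      have h1 : T.Adj u (φ.symm v) := by
        rw [← φ.map_adj_iff]; simpa using huv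
      have h2 : φ.symm v ∉ C := fun h => hv' _ h (by simp)
      rcases hb u hu _ h2 h1 with h | ⟨-, h⟩
      · have h3 : v = φ.symm v := by simpa using h
        rwa [← h3] at h1
      · exact absurd (show v = u by simpa using h) fun e => hv (e ▸ hu)
    intro u v huv
    rcases cases u with hu | ⟨u, hu, rfl⟩ | ⟨hu, hu'⟩ <;>
      rcases cases v with hv | ⟨v, hv, rfl⟩ | ⟨hv, hv'⟩
    · rw [f1 u hu, f1 v hv]; exact φ.map_adj_iff.2 huv
    · exact key2 u hu v hv huv
    · exact key1 u hu v hv hv' huv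
    · exact (key2 v hv u hu huv.symm).symm
    · rw [f2 u hu, f2 v hv]; exact φ.map_adj_iff.1 huv
    · exact key3 u hu v hv hv' huv
    · exact (key1 v hv u hu hu' huv.symm).symm
    · exact (key3 v hv u hu hu' huv.symm).symm
    · rw [f3 u hu hu', f3 v hv hv']; exact huv
  refine ⟨⟨⟨f, f, hinv, hinv⟩, ?_⟩, f1, f2, ?_⟩
  · intro a b
    refine ⟨fun h => ?_, fun h => hadj a b h⟩
    have := hadj _ _ h
    simpa [hinv] using this
  · intro v h1 h2
    exact f3 v h1 fun w hw e => h2 ⟨w, hw, e⟩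

theorem image_side (φ : T ≃g T) (u w : V) : φ '' side T u w = side T (φ u) (φ w) := by
  have hiff : ∀ a b, (T.deleteEdges {s(φ u, φ w)}).Adj (φ a) (φ b) ↔
      (T.deleteEdges {s(u, w)}).Adj a b := by
    intro a b
    simp only [deleteEdges_adj, Set.mem_singleton_iff, φ.map_adj_iff, Sym2.eq_iff,
      φ.injective.eq_iff]
  let φ' : T.deleteEdges {s(u, w)} ≃g T.deleteEdges {s(φ u, φ w)} :=
    ⟨φ.toEquiv, fun {a b} => hiff a b⟩
  ext v
  constructor
  · rintro ⟨x, hx, rfl⟩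
    exact (Iso.reachable_iff (φ := φ')).2 hx
  · intro hv
    refine ⟨φ.symm v, ?_, by simp⟩
    have : (T.deleteEdges {s(φ u, φ w)}).Reachable (φ' w) (φ' (φ.symm v)) := by
      have : φ' (φ.symm v) = v := φ.apply_symm_apply v
      rw [this]; exact hv
    exact Iso.reachable_iff.1 this

/-- The part of the forest behind `p[i]`, seen from `p[i + 1]`, is mapped onto the part behind
`p[j]`, seen from `φ p[i + 1]`. If `φ p[i + 1]` were not the path neighbour of `p[j]` towards
`p[i]`, the second part would contain the path back to `p[i]` and strictly contain the first part,
although both have the same size. -/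
theorem apply_succ_eq_pred [Finite V] (hT : T.IsAcyclic) {p : List V} (hp : IsPathList T p)
    (φ : T ≃g T) {i j : ℕ} (hij : i < j) (hj : j < p.length) (h : φ p[i] = p[j]) :
    φ p[i + 1] = p[j - 1] := by
  by_contra hne
  have hadj : T.Adj p[i + 1] p[i] := (hp.chain.getElem i (by omega)).symm
  have hss : side T p[i + 1] p[i] ⊂ side T (φ p[i + 1]) p[j] := by
    refine side_ssubset hT hadj (fun e => ?_) ?_ ?_
    · rcases Sym2.eq_iff.1 e with ⟨-, e2⟩ | ⟨e1, e2⟩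
      · rw [hp.nodup.getElem_inj_iff] at e2; omega
      · rw [hp.nodup.getElem_inj_iff] at e2
        subst e2
        exact hne (by simpa using e1)
    · refine Reachable.symm (reachable_getElem (by omega) hj fun k h1 h2 => ?_)
      simp only [deleteEdges_adj, Set.mem_singleton_iff]
      refine ⟨hp.chain.getElem k (by omega), fun e => ?_⟩
      rcases Sym2.eq_iff.1 e with ⟨e1, e2⟩ | ⟨e1, e2⟩
      · rw [hp.nodup.getElem_inj_iff] at e2
        subst e2
        exact hne (by simpa using e1.symm)
      · rw [hp.nodup.getElem_inj_iff] at e1; omega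
    · refine Reachable.symm (reachable_getElem (by omega) hj fun k h1 h2 => ?_)
      simp only [deleteEdges_adj, Set.mem_singleton_iff]
      refine ⟨hp.chain.getElem k (by omega), fun e => ?_⟩
      rcases Sym2.eq_iff.1 e with ⟨e1, e2⟩ | ⟨e1, e2⟩
      · rw [hp.nodup.getElem_inj_iff] at e2; omega
      · rw [hp.nodup.getElem_inj_iff] at e1; omega
  have := Set.ncard_lt_ncard hss (Set.toFinite _)
  rw [← h, ← image_side, Set.ncard_image_of_injective _ φ.injective] at this
  exact lt_irrefl _ this

/-- An automorphism of a forest that maps one end of a path to the other end reverses the first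
half of the path. -/
theorem apply_getElem_eq [Finite V] (hT : T.IsAcyclic) {p : List V} (hp : IsPathList T p)
    (φ : T ≃g T) (h : φ (p.head hp.ne_nil) = p.getLast hp.ne_nil) (i : ℕ) (hi : i < p.length)
    (h2 : 2 * i ≤ p.length) : φ p[i] = p[p.length - 1 - i] := by
  induction i with
  | zero => simpa [List.head_eq_getElem, List.getLast_eq_getElem] using h
  | succ i ih =>
    -- This needs `i < p.length - 1 - i`, which is why only the first half of the path is treated.
    have := apply_succ_eq_pred hT hp φ (i := i) (j := p.length - 1 - i) (by omega) (by omega)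
      (ih (by omega) (by omega))
    rw [this]
    congr 1

/-- The edges at the middle vertex of a path of odd order, or the middle edge of a path of even
order. -/
def midEdges (T : SimpleGraph V) (p : List V) : Set (Sym2 V) :=
  {e | (∃ k, ∃ h : p.length = 2 * k + 3, e ∈ T.incidenceSet p[k + 1]) ∨
    ∃ k, ∃ h : p.length = 2 * k + 2, e = s(p[k], p[k + 1])}

theorem midEdges_odd {p : List V} {k : ℕ} (h : p.length = 2 * k + 3) :
    midEdges T p = T.incidenceSet p[k + 1] := by
  ext e
  constructor
  · rintro (⟨k', h', he⟩ | ⟨k', h', he⟩)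
    · obtain rfl : k = k' := by omega
      exact he
    · omega
  · exact fun he => Or.inl ⟨k, h, he⟩

theorem midEdges_even {p : List V} {k : ℕ} (h : p.length = 2 * k + 2) :
    midEdges T p = {s(p[k], p[k + 1])} := by
  ext e
  constructor
  · rintro (⟨k', h', he⟩ | ⟨k', h', he⟩)
    · omega
    · obtain rfl : k = k' := by omega
      exact he
  · exact fun he => Or.inr ⟨k, h, he⟩

theorem exists_mem_of_mem_midEdges {p : List V} {e : Sym2 V} (he : e ∈ midEdges T p) :
    ∃ v ∈ p, v ∈ e := by
  rcases he with ⟨k, h, he⟩ | ⟨k, h, rfl⟩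
  · exact ⟨_, List.getElem_mem _, he.2⟩
  · exact ⟨_, List.getElem_mem _, Sym2.mem_mk_left _ _⟩

/-- The component of the first vertex of `p` when the middle of `p` is removed. -/
def headHalf (T : SimpleGraph V) (p : List V) : Set V :=
  {v | ∃ h : p ≠ [], (T.deleteEdges (midEdges T p)).Reachable (p.head h) v}

/-- The component of the last vertex of `p` when the middle of `p` is removed. -/
def lastHalf (T : SimpleGraph V) (p : List V) : Set V :=
  {v | ∃ h : p ≠ [], (T.deleteEdges (midEdges T p)).Reachable (p.getLast h) v}

theorem reachable_head_getElem {p : List V} (hp : IsPathList T p) (i : ℕ) (hi : i < p.length)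
    (h2 : 2 * i + 2 ≤ p.length) :
    (T.deleteEdges (midEdges T p)).Reachable (p.head hp.ne_nil) p[i] := by
  rw [List.head_eq_getElem]
  refine reachable_getElem (by omega) hi fun k _ hk => ?_
  rw [deleteEdges_adj]
  refine ⟨hp.chain.getElem k (by omega), ?_⟩
  rintro (⟨k', h', -, he⟩ | ⟨k', h', he⟩)
  · rcases Sym2.mem_iff.1 he with e | e <;> rw [hp.nodup.getElem_inj_iff] at e <;> omega
  · rcases Sym2.eq_iff.1 he with ⟨e, e'⟩ | ⟨e, e'⟩ <;> rw [hp.nodup.getElem_inj_iff] at e e' <;>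
      omega

theorem reachable_last_getElem {p : List V} (hp : IsPathList T p) (i : ℕ) (hi : i < p.length)
    (h2 : p.length ≤ 2 * i) :
    (T.deleteEdges (midEdges T p)).Reachable (p.getLast hp.ne_nil) p[i] := by
  rw [List.getLast_eq_getElem]
  refine Reachable.symm (reachable_getElem (by omega) (by omega) fun k _ hk => ?_)
  rw [deleteEdges_adj]
  refine ⟨hp.chain.getElem k (by omega), ?_⟩
  rintro (⟨k', h', -, he⟩ | ⟨k', h', he⟩)
  · rcases Sym2.mem_iff.1 he with e | e <;> rw [hp.nodup.getElem_inj_iff] at e <;> omega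
  · rcases Sym2.eq_iff.1 he with ⟨e, e'⟩ | ⟨e, e'⟩ <;> rw [hp.nodup.getElem_inj_iff] at e e' <;>
      omega

/-- A single deleted path edge already separates the ends: the middle edge if the order is even, the
edge entering the middle vertex if it is odd. -/
theorem not_reachable_ends (hT : T.IsAcyclic) {p : List V} (hp : IsPathList T p)
    (h2 : 2 ≤ p.length) :
    ¬ (T.deleteEdges (midEdges T p)).Reachable (p.head hp.ne_nil) (p.getLast hp.ne_nil) := by
  intro hr
  obtain ⟨k, hk, hmem⟩ : ∃ k, ∃ hk : k + 1 < p.length, s(p[k], p[k + 1]) ∈ midEdges T p := by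
    obtain ⟨k, hk | hk⟩ : ∃ k, p.length = 2 * k + 2 ∨ p.length = 2 * k + 3 :=
      ⟨(p.length - 2) / 2, by omega⟩
    · exact ⟨k, by omega, Or.inr ⟨k, hk, rfl⟩⟩
    · refine ⟨k, by omega, Or.inl ⟨k, hk, ?_⟩⟩
      exact ⟨hp.chain.getElem k (by omega), Sym2.mem_mk_right _ _⟩
  have hle : T.deleteEdges (midEdges T p) ≤ T.deleteEdges {s(p[k], p[k + 1])} :=
    deleteEdges_anti (Set.singleton_subset_iff.2 hmem)
  refine not_reachable_deleteEdges hT (hp.chain.getElem k hk) ?_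
  rw [List.head_eq_getElem, List.getLast_eq_getElem] at hr
  have h1 : ∀ j (hj : j + 1 < p.length), j ≠ k →
      (T.deleteEdges {s(p[k], p[k + 1])}).Adj p[j] p[j + 1] := by
    intro j hj hne
    rw [deleteEdges_adj]
    refine ⟨hp.chain.getElem j hj, fun he => ?_⟩
    rcases Sym2.eq_iff.1 he with ⟨e, e'⟩ | ⟨e, e'⟩ <;> rw [hp.nodup.getElem_inj_iff] at e e' <;>
      omega
  refine (Reachable.symm ?_).trans ((hr.mono hle).trans (Reachable.symm ?_))
  · exact reachable_getElem (by omega) (by omega) fun j _ hj => h1 j (by omega) (by omega)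
  · exact reachable_getElem (by omega) (by omega) fun j _ hj => h1 j (by omega) (by omega)

/-- `φ` reverses the middle edge or fixes the middle vertex, hence it is still an automorphism after
the middle has been deleted. -/
theorem mem_midEdges_iff [Finite V] (hT : T.IsAcyclic) {p : List V} (hp : IsPathList T p)
    (φ : T ≃g T) (h : φ (p.head hp.ne_nil) = p.getLast hp.ne_nil) (a b : V) :
    s(φ a, φ b) ∈ midEdges T p ↔ s(a, b) ∈ midEdges T p := by
  by_cases h2 : p.length < 2
  · constructor <;> rintro (⟨k, hk, -⟩ | ⟨k, hk, -⟩) <;> omega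
  obtain ⟨k, hk | hk⟩ : ∃ k, p.length = 2 * k + 2 ∨ p.length = 2 * k + 3 :=
    ⟨(p.length - 2) / 2, by omega⟩
  · rw [midEdges_even hk, Set.mem_singleton_iff, Set.mem_singleton_iff]
    have h1 : φ p[k] = p[k + 1] := by
      rw [apply_getElem_eq hT hp φ h k (by omega) (by omega)]; congr 1; omega
    have h3 : φ p[k + 1] = p[k] := by
      rw [apply_getElem_eq hT hp φ h (k + 1) (by omega) (by omega)]; congr 1; omega
    have : s(φ a, φ b) = s(φ p[k + 1], φ p[k]) ↔ s(a, b) = s(p[k + 1], p[k]) := by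
      simp only [Sym2.eq_iff, φ.injective.eq_iff]
    rw [h1, h3] at this
    rw [this, Sym2.eq_swap (a := p[k + 1])]
  · rw [midEdges_odd hk]
    have h1 : φ p[k + 1] = p[k + 1] := by
      rw [apply_getElem_eq hT hp φ h (k + 1) (by omega) (by omega)]; congr 1; omega
    simp only [mk'_mem_incidenceSet_iff, φ.map_adj_iff]
    constructor
    · rintro ⟨h3, h4 | h4⟩
      · exact ⟨h3, Or.inl (φ.injective (h1.trans h4))⟩
      · exact ⟨h3, Or.inr (φ.injective (h1.trans h4))⟩
    · rintro ⟨h3, h4 | h4⟩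
      · exact ⟨h3, Or.inl (h4 ▸ h1.symm)⟩
      · exact ⟨h3, Or.inr (h4 ▸ h1.symm)⟩

/-- The automorphism of `T` minus the middle of `p` that is given by an automorphism of `T`
that maps the first vertex of `p` to the last one. -/
def isoDeleteMid [Finite V] (hT : T.IsAcyclic) {p : List V} (hp : IsPathList T p)
    (φ : T ≃g T) (h : φ (p.head hp.ne_nil) = p.getLast hp.ne_nil) :
    T.deleteEdges (midEdges T p) ≃g T.deleteEdges (midEdges T p) where
  toEquiv := φ.toEquiv
  map_rel_iff' {a b} := by
    simp only [deleteEdges_adj]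
    exact and_congr φ.map_adj_iff (not_congr (mem_midEdges_iff hT hp φ h a b))

/-- If an automorphism of a forest maps one end of a path to the other one, then the two ends are
exchanged by an automorphism that fixes all vertices outside the two halves of the path. -/
theorem exists_flip [Finite V] (hT : T.IsAcyclic) {p : List V} (hp : IsPathList T p)
    (h2 : 2 ≤ p.length) (φ : T ≃g T) (h : φ (p.head hp.ne_nil) = p.getLast hp.ne_nil) :
    ∃ ψ : T ≃g T, ψ (p.head hp.ne_nil) = p.getLast hp.ne_nil ∧
      ψ (p.getLast hp.ne_nil) = p.head hp.ne_nil ∧ ψ '' headHalf T p = lastHalf T p ∧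
      ∀ v, v ∉ headHalf T p → v ∉ lastHalf T p → ψ v = v := by
  have hne := not_reachable_ends hT hp h2
  set θ := isoDeleteMid hT hp φ h with hθ
  have hθφ : ∀ v, θ v = φ v := fun v => rfl
  have himg : φ '' headHalf T p = lastHalf T p := by
    ext v
    constructor
    · rintro ⟨w, ⟨hn, hw⟩, rfl⟩
      refine ⟨hn, ?_⟩
      have := (Iso.reachable_iff (φ := θ)).2 hw
      rwa [hθφ, h] at this
    · rintro ⟨hn, hv⟩
      refine ⟨φ.symm v, ⟨hn, ?_⟩, by simp⟩
      rw [← Iso.reachable_iff (φ := θ), hθφ, hθφ, h]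
      simpa using hv
  have hdisj : ∀ v ∈ headHalf T p, φ v ∉ headHalf T p := by
    rintro v hv ⟨hn, hv'⟩
    have : φ v ∈ lastHalf T p := himg ▸ ⟨v, hv, rfl⟩
    obtain ⟨_, hv''⟩ := this
    exact hne (hv'.trans hv''.symm)
  -- An edge leaving the half is a deleted edge. It is the middle edge, which `φ` reverses, or it
  -- ends in the middle vertex, which `φ` fixes.
  obtain ⟨ψ, h1, h3, h4⟩ := exists_exchange φ (headHalf T p) hdisj (by
    rintro u ⟨hn, hu⟩ v hv huv
    have hmem : s(u, v) ∈ midEdges T p := by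
      by_contra hc
      refine hv ⟨hn, hu.trans (Adj.reachable ?_)⟩
      rw [deleteEdges_adj]
      exact ⟨huv, hc⟩
    obtain ⟨k, hk | hk⟩ : ∃ k, p.length = 2 * k + 2 ∨ p.length = 2 * k + 3 :=
      ⟨(p.length - 2) / 2, by omega⟩
    · rw [midEdges_even hk, Set.mem_singleton_iff] at hmem
      have e1 : φ p[k] = p[k + 1] := by
        rw [apply_getElem_eq hT hp φ h k (by omega) (by omega)]; congr 1; omega
      have e3 : φ p[k + 1] = p[k] := by
        rw [apply_getElem_eq hT hp φ h (k + 1) (by omega) (by omega)]; congr 1; omega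
      rcases Sym2.eq_iff.1 hmem with ⟨rfl, rfl⟩ | ⟨rfl, rfl⟩
      · exact Or.inr ⟨e1, e3⟩
      · exact Or.inr ⟨e3, e1⟩
    · have e1 : φ p[k + 1] = p[k + 1] := by
        rw [apply_getElem_eq hT hp φ h (k + 1) (by omega) (by omega)]; congr 1; omega
      have hum : u ≠ p[k + 1] := by
        refine Reachable.mem_of_closed hu (S := {x | x ≠ p[k + 1]}) ?_ ?_
        · simp only [Set.mem_ofPred_eq, List.head_eq_getElem, ne_eq, hp.nodup.getElem_inj_iff]
          omega
        · rintro x y hx hxy rfl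
          rw [deleteEdges_adj, midEdges_odd hk] at hxy
          exact hxy.2 ⟨hxy.1, Sym2.mem_mk_right _ _⟩
      rw [midEdges_odd hk, mk'_mem_incidenceSet_iff] at hmem
      rcases hmem.2 with e | e
      · exact absurd e.symm hum
      · exact Or.inl (e ▸ e1))
  have hmem : p.head hp.ne_nil ∈ headHalf T p := ⟨hp.ne_nil, Reachable.refl _⟩
  refine ⟨ψ, by rw [h1 _ hmem, h], by rw [← h, h3 _ hmem], ?_, ?_⟩
  · rw [← himg]
    exact Set.image_congr fun v hv => h1 v hv
  · intro v hv hv'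
    exact h4 v hv (himg ▸ hv')

theorem componentsIso_of_iso {H : SimpleGraph V} (θ : H ≃g H) {a b : V}
    (h : H.Reachable (θ a) b) : ComponentsIso H a b := by
  have hmem : ∀ x, x ∈ (H.connectedComponentMk a).supp ↔
      θ x ∈ (H.connectedComponentMk b).supp := by
    intro x
    rw [ConnectedComponent.mem_supp_iff, ConnectedComponent.mem_supp_iff, ConnectedComponent.eq,
      ConnectedComponent.eq, ← Iso.reachable_iff (φ := θ)]
    exact ⟨fun hx => hx.trans h, fun hx => hx.trans h.symm⟩
  exact ⟨⟨θ.toEquiv.subtypeEquiv hmem, fun {x y} => θ.map_adj_iff⟩⟩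

/-- The conditions on a path hold if some automorphism maps its first vertex to its last one. -/
theorem pathCheck_iff [Finite V] (hT : T.IsAcyclic) {p : List V} (hp : IsPathList T p) :
    PathCheck T p ↔ ∃ φ : T ≃g T, φ (p.head hp.ne_nil) = p.getLast hp.ne_nil := by
  constructor
  · intro h
    obtain ⟨φ, h1, -⟩ := h.swap hp.ne_nil
    exact ⟨φ, h1⟩
  · rintro ⟨φ, h⟩
    have hiso : ∀ i j (hi : i < p.length) (hj : j < p.length), 2 * i + 2 ≤ p.length →
        p.length ≤ 2 * j → ComponentsIso (T.deleteEdges (midEdges T p)) p[i] p[j] := by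
      intro i j hi hj h1 h2
      refine componentsIso_of_iso (isoDeleteMid hT hp φ h) ?_
      have h3 := (Iso.reachable_iff (φ := isoDeleteMid hT hp φ h)).2
        (reachable_head_getElem hp i hi h1)
      have h4 : isoDeleteMid hT hp φ h (p.head hp.ne_nil) = p.getLast hp.ne_nil := h
      rw [h4] at h3
      exact h3.symm.trans (reachable_last_getElem hp j hj h2)
    refine ⟨fun k hk => ?_, fun k hk => ?_, fun hne => ?_⟩
    · rw [← midEdges_odd hk]
      exact hiso k (k + 2) (by omega) (by omega) (by omega) (by omega)
    · rw [← midEdges_even hk]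
      exact hiso k (k + 1) (by omega) (by omega) (by omega) (by omega)
    · by_cases h2 : 2 ≤ p.length
      · obtain ⟨ψ, h3, h4, -⟩ := exists_flip hT hp h2 φ h
        exact ⟨ψ, h3, h4⟩
      · refine ⟨Iso.refl, ?_⟩
        obtain ⟨x, rfl⟩ : ∃ x, p = [x] := List.length_eq_one_iff.1 (by
          have := List.length_pos_iff.2 hne
          omega)
        simp

end Flips


/-! ### Edge sets of path covers, their degrees, and uniqueness of interior covers -/

section PathEdges

variable {V : Type*} {T : SimpleGraph V}

/-- The edges of the path with vertex sequence `p`. -/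
def pathEdges : List V → Set (Sym2 V)
  | a :: b :: l => insert s(a, b) (pathEdges (b :: l))
  | _ => ∅

/-- The edges of the paths of `P`. -/
def systemEdges (P : List (List V)) : Set (Sym2 V) := {e | ∃ p ∈ P, e ∈ pathEdges p}

/-- The number of edges of `N` at `v`. -/
noncomputable def edgeDegree (N : Set (Sym2 V)) (v : V) : ℕ := {w | s(v, w) ∈ N}.ncard

theorem mem_pathEdges {p : List V} {e : Sym2 V} :
    e ∈ pathEdges p ↔ ∃ L R a b, p = L ++ a :: b :: R ∧ e = s(a, b) := by
  induction p with
  | nil => simp [pathEdges]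
  | cons a l ih =>
    cases l with
    | nil =>
      simp only [pathEdges, Set.mem_empty_iff_false, false_iff]
      rintro ⟨L, R, a', b', h, -⟩
      have := congrArg List.length h
      simp at this
      omega
    | cons b l =>
      simp only [pathEdges, Set.mem_insert_iff, ih]
      constructor
      · rintro (rfl | ⟨L, R, a', b', h, rfl⟩)
        · exact ⟨[], l, a, b, rfl, rfl⟩
        · exact ⟨a :: L, R, a', b', by rw [h]; rfl, rfl⟩
      · rintro ⟨L, R, a', b', h, rfl⟩
        rcases L with _ | ⟨c, L⟩
        · simp at h
          obtain ⟨rfl, rfl, rfl⟩ := h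
          exact Or.inl rfl
        · simp at h
          exact Or.inr ⟨L, R, a', b', h.2, rfl⟩

theorem mem_of_mem_pathEdges {p : List V} {e : Sym2 V} (he : e ∈ pathEdges p) {v : V}
    (hv : v ∈ e) : v ∈ p := by
  obtain ⟨L, R, a, b, rfl, rfl⟩ := mem_pathEdges.1 he
  rcases Sym2.mem_iff.1 hv with rfl | rfl <;> simp

theorem notMem_of_nodup_middle {L R : List V} {v : V} (hn : (L ++ v :: R).Nodup) :
    v ∉ L ∧ v ∉ R := by
  have := (List.nodup_cons.1 (List.nodup_middle.1 hn)).1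
  simpa using this

theorem mk_mem_pathEdges_iff {L R : List V} {v w : V} (hn : (L ++ v :: R).Nodup) :
    s(v, w) ∈ pathEdges (L ++ v :: R) ↔ L.getLast? = some w ∨ R.head? = some w := by
  have hv := notMem_of_nodup_middle hn
  rw [mem_pathEdges]
  constructor
  · rintro ⟨L', R', a, b, h, he⟩
    rcases Sym2.eq_iff.1 he with ⟨rfl, rfl⟩ | ⟨rfl, rfl⟩
    · obtain ⟨-, -, rfl⟩ := (List.append_cons_inj_of_notMem hv.1 hv.2).1 h
      exact Or.inr rfl
    · have h' : L ++ v :: R = (L' ++ [w]) ++ v :: R' := by simpa using h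
      obtain ⟨rfl, -, -⟩ := (List.append_cons_inj_of_notMem hv.1 hv.2).1 h'
      exact Or.inl (by simp)
  · rintro (h | h)
    · obtain ⟨L', rfl⟩ := List.getLast?_eq_some_iff.1 h
      exact ⟨L', R, w, v, by simp, Sym2.eq_swap⟩
    · obtain ⟨R', rfl⟩ := List.head?_eq_some_iff.1 h
      exact ⟨L, R', v, w, rfl, rfl⟩

theorem pathEdges_subset {p : List V} (hp : p.IsChain T.Adj) : pathEdges p ⊆ T.edgeSet := by
  intro e he
  obtain ⟨L, R, a, b, rfl, rfl⟩ := mem_pathEdges.1 he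
  exact (List.isChain_append_cons_cons.1 hp).2.1

theorem IsPathSystem.systemEdges_subset {P : List (List V)} (hP : IsPathSystem T P) :
    systemEdges P ⊆ T.edgeSet := by
  rintro e ⟨p, hp, he⟩
  exact pathEdges_subset (hP.isPathList p hp).chain he

theorem mk_mem_pathEdges_of_adj (hT : T.IsAcyclic) {p : List V} (hp : IsPathList T p) {v w : V}
    (hv : v ∈ p) (hw : w ∈ p) (hvw : T.Adj v w) : s(v, w) ∈ pathEdges p := by
  have key : ∀ i (hi : i + 1 < p.length), s(p[i], p[i + 1]) ∈ pathEdges p := by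
    intro i hi
    refine mem_pathEdges.2 ⟨p.take i, p.drop (i + 2), p[i], p[i + 1], ?_, rfl⟩
    rw [List.getElem_cons_drop, List.getElem_cons_drop, List.take_append_drop]
  obtain ⟨i, hi, rfl⟩ := List.getElem_of_mem hv
  obtain ⟨j, hj, rfl⟩ := List.getElem_of_mem hw
  rcases (adj_iff_of_isChain hT hp.nodup hp.chain hi hj).1 hvw with rfl | rfl
  · exact key i hj
  · rw [Sym2.eq_swap]; exact key j hi

theorem IsPathSystem.mk_mem_systemEdges {P : List (List V)} (hP : IsPathSystem T P)
    {L R : List V} {v w : V} (hp : L ++ v :: R ∈ P) :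
    s(v, w) ∈ systemEdges P ↔ L.getLast? = some w ∨ R.head? = some w := by
  rw [← mk_mem_pathEdges_iff (hP.isPathList _ hp).nodup]
  constructor
  · rintro ⟨q, hq, he⟩
    have hvq := mem_of_mem_pathEdges he (Sym2.mem_mk_left v w)
    rwa [hP.eq_of_mem hp hq (by simp) hvq]
  · exact fun he => ⟨_, hp, he⟩

/-- One path edge for each side on which the path continues beyond `v`. In this form ends of paths
can be recognised by degrees alone. -/
theorem IsPathSystem.edgeDegree_eq {P : List (List V)} (hP : IsPathSystem T P)
    {L R : List V} {v : V} (hp : L ++ v :: R ∈ P) :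
    edgeDegree (systemEdges P) v = min L.length 1 + min R.length 1 := by
  have hn := (hP.isPathList _ hp).nodup
  have h : {w | s(v, w) ∈ systemEdges P} = {w | L.getLast? = some w ∨ R.head? = some w} := by
    ext w; exact hP.mk_mem_systemEdges hp
  rw [edgeDegree, h]
  rcases List.eq_nil_or_concat L with rfl | ⟨L, a, rfl⟩ <;> rcases R with _ | ⟨b, R⟩
  · simp
  · simp
  · simp
  · have hab : a ≠ b := by
      rintro rfl
      exact (notMem_of_nodup_middle (L := L) (R := v :: a :: R) (by simpa using hn)).2 (by simp)
    have : {w | (L.concat a).getLast? = some w ∨ (b :: R).head? = some w} = {a, b} := by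
      ext w; simp [eq_comm]
    rw [this, Set.ncard_pair hab]
    simp

theorem IsPathSystem.edgeDegree_le {P : List (List V)} (hP : IsPathSystem T P) (v : V) :
    edgeDegree (systemEdges P) v ≤ 2 := by
  by_cases h : ∃ p ∈ P, v ∈ p
  · obtain ⟨p, hp, hv⟩ := h
    obtain ⟨L, R, rfl⟩ := List.append_of_mem hv
    rw [hP.edgeDegree_eq hp]
    omega
  · have : {w | s(v, w) ∈ systemEdges P} = ∅ := by
      ext w
      simp only [Set.mem_ofPred_eq, Set.mem_empty_iff_false, iff_false]
      rintro ⟨p, hp, he⟩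
      exact h ⟨p, hp, mem_of_mem_pathEdges he (Sym2.mem_mk_left v w)⟩
    simp [edgeDegree, this]

theorem pathEdges_finite (p : List V) : (pathEdges p).Finite := by
  induction p with
  | nil => exact Set.finite_empty
  | cons a l ih =>
    cases l with
    | nil => exact Set.finite_empty
    | cons b l => exact ih.insert _

theorem ncard_pathEdges {p : List V} (hne : p ≠ []) (hn : p.Nodup) :
    (pathEdges p).ncard + 1 = p.length := by
  induction p with
  | nil => exact absurd rfl hne
  | cons a l ih =>
    cases l with
    | nil => simp [pathEdges]
    | cons b l =>
      have ha : s(a, b) ∉ pathEdges (b :: l) := fun he =>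
        (List.nodup_cons.1 hn).1 (mem_of_mem_pathEdges he (Sym2.mem_mk_left a b))
      rw [pathEdges, Set.ncard_insert_of_notMem ha (pathEdges_finite _), ih (by simp) hn.of_cons]
      rfl

theorem IsPathSystem.ncard_systemEdges {P : List (List V)} (hP : IsPathSystem T P) :
    (systemEdges P).Finite ∧ (systemEdges P).ncard + P.length = P.flatten.length := by
  induction P with
  | nil => simp [systemEdges]
  | cons p P ih =>
    obtain ⟨h1, h2, h3⟩ := isPathSystem_cons.1 hP
    have : systemEdges (p :: P) = pathEdges p ∪ systemEdges P := by
      ext e; simp [systemEdges]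
    have hdisj : Disjoint (pathEdges p) (systemEdges P) := by
      rw [Set.disjoint_left]
      rintro e he ⟨q, hq, he'⟩
      induction e with
      | _ a b =>
        exact h2 q hq (mem_of_mem_pathEdges he (Sym2.mem_mk_left a b))
          (mem_of_mem_pathEdges he' (Sym2.mem_mk_left a b))
    refine ⟨this ▸ (pathEdges_finite p).union (ih h3).1, ?_⟩
    rw [this, Set.ncard_union_eq hdisj (pathEdges_finite p) (ih h3).1, List.flatten_cons,
      List.length_append, ← (ih h3).2, List.length_cons, ← ncard_pathEdges h1.ne_nil h1.nodup]
    omega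

theorem length_flatten_of_cover {P : List (List V)} (hP : IsPathSystem T P)
    (hcov : ∀ v, ∃ p ∈ P, v ∈ p) : P.flatten.length = Nat.card V := by
  classical
  have h : ∀ v, v ∈ P.flatten := fun v => List.mem_flatten.2 (hcov v)
  have : Fintype V := ⟨P.flatten.toFinset, fun v => List.mem_toFinset.2 (h v)⟩
  rw [Nat.card_eq_fintype_card, ← List.toFinset_card_of_nodup hP.nodup_flatten]
  congr 1
  ext v; simp [h v]

theorem sum_edgeDegree [Fintype V] {N : Set (Sym2 V)} (hN : N ⊆ T.edgeSet) :
    ∑ v, edgeDegree N v = 2 * N.ncard := by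
  classical
  have h1 : (fromEdgeSet N).edgeSet = N := by
    rw [edgeSet_fromEdgeSet, sdiff_eq_left, Set.disjoint_left]
    intro e he
    exact T.not_isDiag_of_mem_edgeSet (hN he)
  have h2 := (fromEdgeSet N).sum_degrees_eq_twice_card_edges
  rw [edgeFinset, ← Set.ncard_eq_toFinset_card', h1] at h2
  rw [← h2]
  refine Finset.sum_congr rfl fun v _ => ?_
  rw [← card_neighborFinset_eq_degree, neighborFinset, ← Set.ncard_eq_toFinset_card', edgeDegree]
  congr 1
  ext w
  rw [mem_neighborSet, ← mem_edgeSet, h1]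
  rfl

/-- A set of edges of a forest is determined by its degrees, even among the sets of at least the
same size with at most these degrees. -/
theorem eq_of_edgeDegree_le [Finite V] (hT : T.IsAcyclic) {N N' : Set (Sym2 V)}
    (hN : N ⊆ T.edgeSet) (hN' : N' ⊆ T.edgeSet) (hle : ∀ v, edgeDegree N' v ≤ edgeDegree N v)
    (hcard : N.ncard ≤ N'.ncard) : N' = N := by
  have := Fintype.ofFinite V
  -- The degree sums are twice the numbers of edges, and `N'` has at least as many edges, so no
  -- degree inequality can be strict.
  have hdeg : ∀ v, edgeDegree N' v = edgeDegree N v := by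
    have h := (Finset.sum_eq_sum_iff_of_le fun v (_ : v ∈ Finset.univ) => hle v).1 (by
      have := Finset.sum_le_sum fun v (_ : v ∈ Finset.univ) => hle v
      rw [sum_edgeDegree hN, sum_edgeDegree hN'] at *
      omega)
    exact fun v => h v (Finset.mem_univ v)
  by_contra hne
  have hswap : ∀ (A B : Set (Sym2 V)), (∀ v, edgeDegree A v = edgeDegree B v) → ∀ v w,
      s(v, w) ∈ A → s(v, w) ∉ B → ∃ w', s(v, w') ∈ B ∧ s(v, w') ∉ A := by
    intro A B hAB v w hA hB
    by_contra! hc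
    have : {w | s(v, w) ∈ B} = {w | s(v, w) ∈ A} :=
      Set.eq_of_subset_of_ncard_le hc (hAB v).le (Set.toFinite _)
    exact hB (this.symm ▸ hA : w ∈ {w | s(v, w) ∈ B})
  -- The vertices at which `N` and `N'` differ. Because the degrees agree, an edge of one set
  -- missing in the other is accompanied by an edge of the opposite kind at the same vertex. So
  -- every vertex of `U` has two neighbours in `U`, which is impossible in a finite forest.
  let U : Set V := {v | ∃ w, s(v, w) ∈ symmDiff N' N}
  have hU : U.Nonempty := by
    by_contra hc
    refine hne (symmDiff_eq_bot.1 (Set.eq_empty_of_forall_notMem fun e he => ?_))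
    induction e with
    | _ a b => exact hc ⟨a, b, he⟩
  obtain ⟨v, ⟨w, hw⟩, huniq⟩ := exists_atMostOne_neighbor hT hU
  obtain ⟨w', hw', hww'⟩ : ∃ w', s(v, w') ∈ symmDiff N' N ∧ w ≠ w' := by
    rcases hw with ⟨h1, h2⟩ | ⟨h1, h2⟩
    · obtain ⟨w', h3, h4⟩ := hswap N' N hdeg v w h1 h2
      exact ⟨w', Or.inr ⟨h3, h4⟩, fun e => h2 (e ▸ h3)⟩
    · obtain ⟨w', h3, h4⟩ := hswap N N' (fun v => (hdeg v).symm) v w h1 h2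
      exact ⟨w', Or.inl ⟨h3, h4⟩, fun e => h2 (e ▸ h3)⟩
  have hadj : ∀ w, s(v, w) ∈ symmDiff N' N → T.Adj v w := by
    rintro w (h | h)
    · exact hN' h.1
    · exact hN h.1
  exact hww' (huniq w ⟨v, Sym2.eq_swap ▸ hw⟩ w' ⟨v, Sym2.eq_swap ▸ hw'⟩ (hadj w hw) (hadj w' hw'))

theorem head?_append_cons {L R : List V} {v : V} (hn : (L ++ v :: R).Nodup) :
    (L ++ v :: R).head? = some v ↔ L = [] := by
  rcases L with _ | ⟨a, L⟩
  · simp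
  · simp only [List.cons_append, List.head?_cons, Option.some.injEq, reduceCtorEq, iff_false]
    rintro rfl
    exact (notMem_of_nodup_middle hn).1 (by simp)

theorem getLast?_append_cons {L R : List V} {v : V} (hn : (L ++ v :: R).Nodup) :
    (L ++ v :: R).getLast? = some v ↔ R = [] := by
  rcases List.eq_nil_or_concat R with rfl | ⟨R, a, rfl⟩
  · simp
  · simp only [List.concat_eq_append]
    have : (L ++ v :: (R ++ [a])).getLast? = some a := by
      rw [← List.cons_append, ← List.append_assoc, List.getLast?_append]
      simp
    rw [this]
    simp only [Option.some.injEq, ne_eq, List.append_eq_nil_iff, reduceCtorEq, and_false, iff_false]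
    rintro rfl
    exact (notMem_of_nodup_middle hn).2 (by simp)

theorem IsPathSystem.edgeDegree_eq_two_iff {P : List (List V)} (hP : IsPathSystem T P)
    {p : List V} (hp : p ∈ P) {v : V} (hv : v ∈ p) :
    edgeDegree (systemEdges P) v = 2 ↔ p.head? ≠ some v ∧ p.getLast? ≠ some v := by
  obtain ⟨L, R, rfl⟩ := List.append_of_mem hv
  have hn := (hP.isPathList _ hp).nodup
  rw [hP.edgeDegree_eq hp, ne_eq, ne_eq, head?_append_cons hn, getLast?_append_cons hn,
    ← List.length_eq_zero_iff, ← List.length_eq_zero_iff]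
  omega

theorem edgeDegree_le_ncard [Finite V] {N : Set (Sym2 V)} (hN : N ⊆ T.edgeSet) (v : V) :
    edgeDegree N v ≤ (T.neighborSet v).ncard :=
  Set.ncard_le_ncard (fun _ hw => hN hw) (Set.toFinite _)

/-- A vertex with fewer than two path edges is an end-vertex, so in an interior cover all its edges
are path edges. The right-hand value is an upper bound for every path system; interior covers are
those that attain it at all vertices simultaneously. -/
theorem isInteriorCover_iff [Finite V] (hT : T.IsAcyclic) {P : List (List V)}
    (hP : IsPathSystem T P) (hcov : ∀ v, ∃ p ∈ P, v ∈ p) :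
    IsInteriorCover T P ↔
      ∀ v, edgeDegree (systemEdges P) v = min 2 (T.neighborSet v).ncard := by
  constructor
  · intro h v
    by_cases h2 : edgeDegree (systemEdges P) v = 2
    · have := edgeDegree_le_ncard hP.systemEdges_subset v
      omega
    obtain ⟨p, hp, hvp⟩ := hcov v
    have hall : ∀ w, T.Adj v w → s(v, w) ∈ systemEdges P := by
      intro w hvw
      obtain ⟨q, hq, hwq⟩ := hcov w
      by_cases hpq : p = q
      · subst hpq
        exact ⟨p, hp, mk_mem_pathEdges_of_adj hT (hP.isPathList p hp) hvp hwq hvw⟩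
      · refine absurd ((hP.edgeDegree_eq_two_iff hp hvp).2 ?_) h2
        exact h v w ⟨hvw, p, hp, q, hq, hpq, hvp, hwq⟩ p hp hvp
    have heq : edgeDegree (systemEdges P) v = (T.neighborSet v).ncard := by
      rw [edgeDegree]
      congr 1
      ext w
      exact ⟨fun hw => hP.systemEdges_subset hw, hall w⟩
    have := hP.edgeDegree_le v
    omega
  · rintro h x y ⟨hxy, p, hp, q, hq, hpq, hxp, hyq⟩ p' hp' hxp'
    obtain rfl := hP.eq_of_mem hp hp' hxp hxp'
    rw [← hP.edgeDegree_eq_two_iff hp hxp]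
    have hlt : edgeDegree (systemEdges P) x < (T.neighborSet x).ncard := by
      refine Set.ncard_lt_ncard ⟨fun w hw => hP.systemEdges_subset hw, fun hsub => ?_⟩
        (Set.toFinite _)
      obtain ⟨q', hq', he⟩ := hsub hxy
      have h1 := hP.eq_of_mem hp hq' hxp (mem_of_mem_pathEdges he (Sym2.mem_mk_left x y))
      have h2 := hP.eq_of_mem hq hq' hyq (mem_of_mem_pathEdges he (Sym2.mem_mk_right x y))
      exact hpq (h1.trans h2.symm)
    have := h x
    omega

/-- An interior path cover is the only path cover with at most as many paths, up to the order and
orientation of its paths. -/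
theorem systemEdges_eq_of_isInteriorCover [Finite V] (hT : T.IsAcyclic) {P Q : List (List V)}
    (hP : IsPathSystem T P) (hcov : ∀ v, ∃ p ∈ P, v ∈ p) (hint : IsInteriorCover T P)
    (hQ : IsPathSystem T Q) (hcovQ : ∀ v, ∃ p ∈ Q, v ∈ p) (hle : Q.length ≤ P.length) :
    systemEdges Q = systemEdges P := by
  rw [isInteriorCover_iff hT hP hcov] at hint
  refine eq_of_edgeDegree_le hT hP.systemEdges_subset hQ.systemEdges_subset (fun v => ?_) ?_
  · rw [hint v]
    exact le_min (hQ.edgeDegree_le v) (edgeDegree_le_ncard hQ.systemEdges_subset v)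
  -- In a cover, edges and paths together number as many as the vertices, so not more paths means
  -- not fewer edges.
  · have h1 := hP.ncard_systemEdges.2
    have h2 := hQ.ncard_systemEdges.2
    rw [length_flatten_of_cover hP hcov] at h1
    rw [length_flatten_of_cover hQ hcovQ] at h2
    omega

end PathEdges


/-! ### Path covers of the forest and of the pruned forest -/

section Pruning

variable {V : Type*} {T : SimpleGraph V}

theorem neighbor_eq_of_leaf {u v w : V} (hu : u ∈ leavesAt T v) (hw : T.Adj u w) : w = v := by
  obtain ⟨x, hx⟩ := Set.ncard_eq_one.1 hu.2
  have h1 : w ∈ T.neighborSet u := hw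
  have h2 : v ∈ T.neighborSet u := hu.1.symm
  rw [hx, Set.mem_singleton_iff] at h1 h2
  rw [h1, h2]

/-- Two leaves with the same neighbour are exchanged by an automorphism. -/
theorem exists_swap_leaves [DecidableEq V] {u l v : V} (hu : u ∈ leavesAt T v)
    (hl : l ∈ leavesAt T v) : ∃ σ : T ≃g T, ∀ x, σ x = Equiv.swap u l x := by
  have hadj : ∀ a b, T.Adj a b → T.Adj (Equiv.swap u l a) (Equiv.swap u l b) := by
    have key : ∀ a b, (a = u ∨ a = l) → T.Adj a b →
        T.Adj (Equiv.swap u l a) (Equiv.swap u l b) := by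
      intro a b ha hab
      have hb : b = v := by
        rcases ha with rfl | rfl
        · exact neighbor_eq_of_leaf hu hab
        · exact neighbor_eq_of_leaf hl hab
      subst hb
      rw [Equiv.swap_apply_of_ne_of_ne hu.1.ne hl.1.ne]
      rcases ha with rfl | rfl
      · rw [Equiv.swap_apply_left]; exact hl.1.symm
      · rw [Equiv.swap_apply_right]; exact hu.1.symm
    intro a b hab
    by_cases ha : a = u ∨ a = l
    · exact key a b ha hab
    by_cases hb : b = u ∨ b = l
    · exact (key b a hb hab.symm).symm
    push Not at ha hb
    rwa [Equiv.swap_apply_of_ne_of_ne ha.1 ha.2, Equiv.swap_apply_of_ne_of_ne hb.1 hb.2]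
  refine ⟨⟨Equiv.swap u l, fun {a b} => ⟨fun h => ?_, hadj a b⟩⟩, fun x => rfl⟩
  simpa using hadj _ _ h

/-- `w` is one of more than two leaves with the same neighbour. -/
def StarLeaf (T : SimpleGraph V) (w : V) : Prop :=
  ∃ v, w ∈ leavesAt T v ∧ 2 < (leavesAt T v).ncard

theorem not_starLeaf_of_star [Finite V] {v : V} (h : 2 < (leavesAt T v).ncard) :
    ¬ StarLeaf T v := by
  rintro ⟨s, hs, -⟩
  have : (leavesAt T v).ncard ≤ (T.neighborSet v).ncard :=
    Set.ncard_le_ncard (fun _ hw => hw.1) (Set.toFinite _)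
  have h1 := hs.2
  omega

theorem IsPruning.starLeaf {removed : List V} (h : IsPruning T removed) {u : V}
    (hu : u ∈ removed) : StarLeaf T u := by
  obtain ⟨v, h1, h2⟩ := h.leaf_of_mem u hu
  exact ⟨v, h1, h2⟩

theorem IsPathSystem.singleton_mem {P : List (List V)} (hP : IsPathSystem T P) {p : List V}
    (hp : p ∈ P) {v : V} (hv : v ∈ p) (h : edgeDegree (systemEdges P) v = 0) : [v] ∈ P := by
  obtain ⟨L, R, rfl⟩ := List.append_of_mem hv
  rw [hP.edgeDegree_eq hp] at h
  obtain rfl : L = [] := List.length_eq_zero_iff.1 (by omega)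
  obtain rfl : R = [] := List.length_eq_zero_iff.1 (by omega)
  exact hp

theorem IsPathSystem.nodup {P : List (List V)} (hP : IsPathSystem T P) : P.Nodup := by
  refine hP.disjoint.imp_of_mem fun {a b} ha _ hab => ?_
  rintro rfl
  obtain ⟨x, hx⟩ := List.exists_mem_of_ne_nil _ (hP.isPathList a ha).ne_nil
  exact hab hx hx

theorem exists_map_val {D : V → Prop} {C : List (List V)} (h : ∀ p ∈ C, ∀ v ∈ p, D v) :
    ∃ P : List (List {v // D v}), P.map (List.map Subtype.val) = C := by
  induction C with
  | nil => exact ⟨[], rfl⟩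
  | cons p C ih =>
    obtain ⟨P, rfl⟩ := ih fun q hq => h q (List.mem_cons_of_mem _ hq)
    refine ⟨p.attachWith D (h p (by simp)) :: P, ?_⟩
    simp

theorem isPathSystem_map_val_iff {removed : List V} {P : List (List {v // v ∉ removed})} :
    IsPathSystem T (P.map (List.map Subtype.val)) ↔ IsPathSystem (pruned T removed) P := by
  constructor
  · rintro ⟨h1, h2⟩
    refine ⟨fun p hp => ?_, ?_⟩
    · obtain ⟨h3, h4, h5⟩ := h1 _ (List.mem_map_of_mem hp)
      exact ⟨fun e => h3 (by simp [e]), h4.of_map _, (List.isChain_map (R := T.Adj) Subtype.val).1 h5⟩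
    · rw [List.pairwise_map] at h2
      exact h2.imp fun {a b} hab x hxa hxb =>
        hab (List.mem_map_of_mem hxa) (List.mem_map_of_mem hxb)
  · exact fun h => h.map Subtype.val_injective fun a b hab => hab

theorem isAcyclic_pruned (hT : T.IsAcyclic) (removed : List V) : (pruned T removed).IsAcyclic :=
  IsAcyclic.of_comap (Function.Embedding.subtype _) hT

theorem isPathSystem_coverInT {removed : List V} (hn : removed.Nodup)
    {P : List (List {v // v ∉ removed})} (hP : IsPathSystem (pruned T removed) P) :
    IsPathSystem T (coverInT removed P) := by
  have h := isPathSystem_map_val_iff.2 hP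
  refine ⟨fun p hp => ?_, List.pairwise_append.2 ⟨h.disjoint, ?_, ?_⟩⟩
  · rcases List.mem_append.1 hp with hp | hp
    · exact h.isPathList p hp
    · obtain ⟨v, -, rfl⟩ := List.mem_map.1 hp
      exact isPathList_singleton v
  · rw [List.pairwise_map]
    exact hn.imp fun {a b} hab => by simpa using fun e => hab e.symm
  · intro p hp q hq x hxp hxq
    obtain ⟨p, -, rfl⟩ := List.mem_map.1 hp
    obtain ⟨v, hv, rfl⟩ := List.mem_map.1 hq
    obtain ⟨y, -, rfl⟩ := List.mem_map.1 hxp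
    exact y.2 (List.mem_singleton.1 hxq ▸ hv)

theorem cover_coverInT {removed : List V} {P : List (List {v // v ∉ removed})}
    (hcov : ∀ v, ∃ p ∈ P, v ∈ p) (v : V) : ∃ p ∈ coverInT removed P, v ∈ p := by
  by_cases hv : v ∈ removed
  · exact ⟨[v], List.mem_append.2 (Or.inr (List.mem_map.2 ⟨v, hv, rfl⟩)), by simp⟩
  · obtain ⟨p, hp, hvp⟩ := hcov ⟨v, hv⟩
    exact ⟨_, List.mem_append.2 (Or.inl (List.mem_map_of_mem hp)), List.mem_map_of_mem hvp⟩

theorem length_coverInT (removed : List V) (P : List (List {v // v ∉ removed})) :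
    (coverInT removed P).length = P.length + removed.length := by
  simp [coverInT]

/-- A path cover of a forest in which all removed leaves are one-vertex paths comes from a path
cover of the pruned forest. -/
theorem exists_perm_coverInT {removed : List V} (hn : removed.Nodup) {Q : List (List V)}
    (hQ : IsPathSystem T Q) (hcov : ∀ v, ∃ p ∈ Q, v ∈ p) (h : ∀ u ∈ removed, [u] ∈ Q) :
    ∃ Q' : List (List {v // v ∉ removed}), IsPathSystem (pruned T removed) Q' ∧
      (∀ v, ∃ p ∈ Q', v ∈ p) ∧ Q.Perm (coverInT removed Q') := by
  classical
  let f : List V → Bool := fun p => decide (∀ v ∈ p, v ∉ removed)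
  have hf : ∀ p ∈ Q.filter f, ∀ v ∈ p, v ∉ removed := by
    intro p hp v hv
    simp only [f, List.mem_filter, decide_eq_true_eq] at hp
    exact hp.2 v hv
  obtain ⟨Q', hQ'⟩ := exists_map_val hf
  have hperm : Q.Perm (coverInT removed Q') := by
    have h1 : (Q.filter fun p => !f p).Perm (removed.map fun v => [v]) := by
      rw [List.perm_ext_iff_of_nodup (hQ.nodup.filter _)
        (hn.map fun a b hab => by simpa using hab)]
      intro p
      simp only [f, List.mem_filter, List.mem_map, Bool.not_eq_true', decide_eq_false_iff_not]
      constructor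
      · rintro ⟨hp, hp'⟩
        push Not at hp'
        obtain ⟨v, hv, hv'⟩ := hp'
        exact ⟨v, hv', hQ.eq_of_mem (h v hv') hp (by simp) hv⟩
      · rintro ⟨v, hv, rfl⟩
        exact ⟨h v hv, fun hc => hc v (by simp) hv⟩
    refine (List.filter_append_perm f Q).symm.trans ?_
    rw [coverInT]
    exact List.Perm.append (List.Perm.of_eq hQ'.symm) h1
  refine ⟨Q', ?_, ?_, hperm⟩
  · rw [← isPathSystem_map_val_iff, hQ']
    exact ⟨fun p hp => hQ.isPathList p (List.mem_of_mem_filter hp), hQ.disjoint.filter _⟩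
  · rintro ⟨v, hv⟩
    obtain ⟨p, hp, hvp⟩ := hcov v
    rcases List.mem_append.1 (hperm.mem_iff.1 hp) with hp | hp
    · obtain ⟨q, hq, rfl⟩ := List.mem_map.1 hp
      obtain ⟨x, hx, rfl⟩ := List.mem_map.1 hvp
      exact ⟨q, hq, hx⟩
    · obtain ⟨w, hw, rfl⟩ := List.mem_map.1 hp
      exact absurd (List.mem_singleton.1 hvp ▸ hw) hv

/-- At most two path edges meet `v`, and one of them goes to the removed leaf `u`, so they cannot
also reach both of the leaves that are kept at `v`. -/
theorem exists_kept_leaf [Finite V] {removed : List V} (hr : IsPruning T removed)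
    {Q : List (List V)} (hQ : IsPathSystem T Q) {u v : V} (hu : u ∈ removed)
    (huv : u ∈ leavesAt T v) (hs : 2 < (leavesAt T v).ncard) (he : s(v, u) ∈ systemEdges Q) :
    ∃ l ∈ leavesAt T v, l ∉ removed ∧ s(v, l) ∉ systemEdges Q := by
  by_contra! hc
  have h2 := hr.two_remain v hs
  have hsub : insert u (leavesAt T v \ {u | u ∈ removed}) ⊆ {w | s(v, w) ∈ systemEdges Q} := by
    rintro w (rfl | hw)
    · exact he
    · exact hc w hw.1 hw.2
  have := Set.ncard_le_ncard hsub (Set.toFinite _)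
  rw [Set.ncard_insert_of_notMem (by simp [hu]) (Set.toFinite _), h2] at this
  have h3 := hQ.edgeDegree_le v
  rw [edgeDegree] at h3
  omega

theorem map_cover {Q : List (List V)} (hcov : ∀ v, ∃ p ∈ Q, v ∈ p) (σ : T ≃g T) (v : V) :
    ∃ p ∈ Q.map (List.map σ), v ∈ p := by
  obtain ⟨p, hp, hv⟩ := hcov (σ.symm v)
  exact ⟨p.map σ, List.mem_map_of_mem hp, List.mem_map.2 ⟨_, hv, by simp⟩⟩

/-- By an automorphism that fixes all vertices but the leaves at stars, every path cover of a
forest is mapped to one in which the removed leaves are one-vertex paths. -/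
theorem exists_normalize [Finite V] {removed : List V} (hr : IsPruning T removed)
    {Q : List (List V)} (hQ : IsPathSystem T Q) (hcov : ∀ v, ∃ p ∈ Q, v ∈ p) :
    ∃ σ : T ≃g T, (∀ v, ¬ StarLeaf T v → σ v = v) ∧
      ∀ u ∈ removed, [u] ∈ Q.map (List.map σ) := by
  classical
  generalize hk : {u | u ∈ removed ∧ [u] ∉ Q}.ncard = k
  induction k using Nat.strong_induction_on generalizing Q with
  | _ k ih =>
    by_cases hall : ∀ u ∈ removed, [u] ∈ Q
    · refine ⟨Iso.refl, fun v _ => rfl, fun u hu => ?_⟩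
      exact List.mem_map.2 ⟨[u], hall u hu, rfl⟩
    push Not at hall
    obtain ⟨u, hu, huQ⟩ := hall
    obtain ⟨v, huv, hs⟩ := hr.leaf_of_mem u hu
    have hisol : ∀ w ∈ leavesAt T v, s(v, w) ∉ systemEdges Q → [w] ∈ Q := by
      intro w hw hne
      obtain ⟨p, hp, hwp⟩ := hcov w
      refine hQ.singleton_mem hp hwp ?_
      rw [edgeDegree, Set.ncard_eq_zero (Set.toFinite _)]
      ext x
      simp only [Set.mem_ofPred_eq, Set.mem_empty_iff_false, iff_false]
      intro hx
      have := neighbor_eq_of_leaf hw (hQ.systemEdges_subset hx)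
      subst this
      exact hne (Sym2.eq_swap ▸ hx)
    have he : s(v, u) ∈ systemEdges Q := by
      by_contra hc
      exact huQ (hisol u huv hc)
    obtain ⟨l, hl, hlr, hle⟩ := exists_kept_leaf hr hQ hu huv hs he
    have hlQ := hisol l hl hle
    -- Exchanging `u` with the kept leaf `l`, which is a one-vertex path, makes `u` a one-vertex
    -- path and does not move any other removed leaf.
    obtain ⟨σ, hσ⟩ := exists_swap_leaves huv hl
    have hQ1 := hQ.map (f := σ) σ.injective fun a b hab => σ.map_adj_iff.2 hab
    have hlt : {w | w ∈ removed ∧ [w] ∉ Q.map (List.map σ)}.ncard < k := by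
      rw [← hk]
      refine Set.ncard_lt_ncard ⟨fun w hw => ⟨hw.1, fun hwQ => hw.2 ?_⟩, fun hsub => ?_⟩
        (Set.toFinite _)
      · refine List.mem_map.2 ⟨[w], hwQ, ?_⟩
        have h1 : w ≠ u := fun e => huQ (e ▸ hwQ)
        have h2 : w ≠ l := fun e => hlr (e ▸ hw.1)
        simp [hσ, Equiv.swap_apply_of_ne_of_ne h1 h2]
      · refine (hsub (show u ∈ {u | u ∈ removed ∧ [u] ∉ Q} from ⟨hu, huQ⟩)).2 ?_
        exact List.mem_map.2 ⟨[l], hlQ, by simp [hσ]⟩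
    obtain ⟨τ, h1, h2⟩ := ih _ hlt hQ1 (map_cover hcov σ) rfl
    refine ⟨σ.trans τ, fun w hw => ?_, fun w hw => ?_⟩
    · have h3 : w ≠ u := fun e => hw (e ▸ ⟨v, huv, hs⟩)
      have h4 : w ≠ l := fun e => hw (e ▸ ⟨v, hl, hs⟩)
      have h5 : σ w = w := by rw [hσ, Equiv.swap_apply_of_ne_of_ne h3 h4]
      change τ (σ w) = w
      rw [h5, h1 w hw]
    · have := h2 w hw
      rw [List.map_map] at this
      have h3 : (List.map (σ.trans τ) : List V → List V) = List.map τ ∘ List.map σ := by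
        rw [List.map_comp_map]; rfl
      rw [h3]
      exact this

/-- In any competing cover the removed leaves may be assumed to be one-vertex paths; deleting them
then costs both covers the same number of paths. -/
theorem isMinPathCover_coverInT [Finite V] (hT : T.IsAcyclic) {removed : List V}
    (hr : IsPruning T removed) {P : List (List {v // v ∉ removed})}
    (hP : IsMinPathCover (pruned T removed) P) : IsMinPathCover T (coverInT removed P) := by
  have hT' := isAcyclic_pruned hT removed
  obtain ⟨h1, h2⟩ := (isPathCover_iff hT').1 hP.1
  refine ⟨(isPathCover_iff hT).2 ⟨isPathSystem_coverInT hr.nodup h1, cover_coverInT h2⟩,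
    fun Q hQ => ?_⟩
  obtain ⟨h3, h4⟩ := (isPathCover_iff hT).1 hQ
  obtain ⟨σ, -, h5⟩ := exists_normalize hr h3 h4
  obtain ⟨Q', h6, h7, h8⟩ := exists_perm_coverInT hr.nodup
    (h3.map (f := σ) σ.injective fun a b hab => σ.map_adj_iff.2 hab) (map_cover h4 σ) h5
  have h9 := h8.length_eq
  rw [length_coverInT, List.length_map] at h9
  rw [length_coverInT, h9]
  have := hP.2 Q' ((isPathCover_iff hT').2 ⟨h6, h7⟩)
  omega

end Pruning


/-! ### Iso-uniqueness forces equal orbits of path ends and an interior cover -/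

section Necessity

variable {V : Type*} {T : SimpleGraph V}

/-- The orbit of `v` under the automorphisms of `T`. -/
def orbit (T : SimpleGraph V) (v : V) : Set V := {w | ∃ φ : T ≃g T, φ v = w}

theorem orbit_apply (φ : T ≃g T) (v : V) : orbit T (φ v) = orbit T v := by
  ext w
  constructor
  · rintro ⟨ψ, rfl⟩
    exact ⟨φ.trans ψ, rfl⟩
  · rintro ⟨ψ, rfl⟩
    refine ⟨φ.symm.trans ψ, ?_⟩
    change ψ (φ.symm (φ v)) = ψ v
    simp

theorem orbit_eq_iff {v w : V} : orbit T v = orbit T w ↔ ∃ φ : T ≃g T, φ v = w := by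
  constructor
  · intro h
    have : w ∈ orbit T w := ⟨Iso.refl, rfl⟩
    rwa [← h] at this
  · rintro ⟨φ, rfl⟩
    exact (orbit_apply φ v).symm

theorem ncard_neighborSet_apply (φ : T ≃g T) (v : V) :
    (T.neighborSet (φ v)).ncard = (T.neighborSet v).ncard := by
  rw [← Set.ncard_image_of_injective (T.neighborSet v) φ.injective]
  congr 1
  ext w
  constructor
  · intro hw
    refine ⟨φ.symm w, ?_, by simp⟩
    rw [mem_neighborSet, ← φ.map_adj_iff]
    simpa using hw
  · rintro ⟨x, hx, rfl⟩
    exact φ.map_adj_iff.2 hx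

theorem ncard_neighborSet_of_orbit_eq {v w : V} (h : orbit T v = orbit T w) :
    (T.neighborSet v).ncard = (T.neighborSet w).ncard := by
  obtain ⟨φ, rfl⟩ := orbit_eq_iff.1 h
  exact (ncard_neighborSet_apply φ v).symm

theorem IsPathSystem.nodup_head? {P : List (List V)} (hP : IsPathSystem T P) :
    (P.map List.head?).Nodup := by
  refine List.pairwise_map.2 (hP.disjoint.imp_of_mem fun {a b} ha _ hab => ?_)
  obtain ⟨x, l, rfl⟩ := List.exists_cons_of_ne_nil (hP.isPathList a ha).ne_nil
  intro h
  exact hab (List.mem_cons_self) (mem_of_head? h.symm)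

/-- In an iso-unique zero forcing forest the orbits of the first vertices are the same for all
minimum path covers. -/
theorem perm_orbit_head? [Finite V] (hT : T.IsAcyclic) (hiso : IsIsoUniqueZeroForcing T)
    {P Q : List (List V)} (hP : IsMinPathCover T P) (hQ : IsPathSystem T Q)
    (hcov : ∀ v, ∃ p ∈ Q, v ∈ p) (hlen : Q.length = P.length) :
    (P.map fun p => p.head?.map (orbit T)).Perm (Q.map fun p => p.head?.map (orbit T)) := by
  have hQ' : IsMinPathCover T Q :=
    ⟨(isPathCover_iff hT).2 ⟨hQ, hcov⟩, fun R hR => hlen ▸ hP.2 R hR⟩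
  obtain ⟨φ, hφ⟩ := hiso _ _ (isMinZeroForcingSet_heads hT hP) (isMinZeroForcingSet_heads hT hQ')
  have hP1 := ((isPathCover_iff hT).1 hP.1).1
  have hmem : ∀ {R : List (List V)}, IsPathSystem T R → ∀ o : Option V,
      o ∈ R.map List.head? ↔ ∃ v ∈ heads R, o = some v := by
    intro R hR o
    rw [List.mem_map]
    constructor
    · rintro ⟨p, hp, rfl⟩
      obtain ⟨x, l, rfl⟩ := List.exists_cons_of_ne_nil (hR.isPathList p hp).ne_nil
      exact ⟨x, ⟨_, hp, rfl⟩, rfl⟩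
    · rintro ⟨v, ⟨p, hp, hv⟩, rfl⟩
      exact ⟨p, hp, hv⟩
  have h1 : ((P.map List.head?).map (Option.map φ)).Perm (Q.map List.head?) := by
    rw [List.perm_ext_iff_of_nodup
      (hP1.nodup_head?.map (Option.map_injective φ.injective)) hQ.nodup_head?]
    intro o
    rw [hmem hQ, List.mem_map, ← hφ]
    constructor
    · rintro ⟨o', ho', rfl⟩
      obtain ⟨v, hv, rfl⟩ := (hmem hP1 o').1 ho'
      exact ⟨φ v, ⟨v, hv, rfl⟩, rfl⟩
    · rintro ⟨_, ⟨v, hv, rfl⟩, rfl⟩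
      exact ⟨some v, (hmem hP1 _).2 ⟨v, hv, rfl⟩, rfl⟩
  have h2 := h1.map (Option.map (orbit T))
  have h3 : (Option.map (orbit T) ∘ Option.map φ) = Option.map (orbit T) := by
    funext o
    cases o <;> simp [orbit_apply]
  rw [List.map_map (g := Option.map (orbit T)) (f := Option.map φ), h3, List.map_map,
    List.map_map] at h2
  exact h2

theorem mem_cover_perm {P Q : List (List V)} (h : P.Perm Q) (hcov : ∀ v, ∃ p ∈ P, v ∈ p) (v : V) :
    ∃ p ∈ Q, v ∈ p := by
  obtain ⟨p, hp, hv⟩ := hcov v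
  exact ⟨p, h.mem_iff.1 hp, hv⟩

theorem exists_perm_cons {α : Type*} {P : List α} {p : α} (hp : p ∈ P) :
    ∃ R, P.Perm (p :: R) := by
  obtain ⟨s, t, rfl⟩ := List.append_of_mem hp
  exact ⟨s ++ t, List.perm_middle⟩

theorem exists_perm_cons_cons {α : Type*} {P : List α} {p q : α} (hp : p ∈ P) (hq : q ∈ P)
    (hpq : p ≠ q) : ∃ R, P.Perm (p :: q :: R) := by
  obtain ⟨R, hR⟩ := exists_perm_cons hp
  have hq' : q ∈ R := by
    rcases List.mem_cons.1 (hR.mem_iff.1 hq) with h | h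
    · exact absurd h.symm hpq
    · exact h
  obtain ⟨R', hR'⟩ := exists_perm_cons hq'
  exact ⟨R', hR.trans (hR'.cons p)⟩

theorem IsMinPathCover.perm (hT : T.IsAcyclic) {P Q : List (List V)} (h : IsMinPathCover T P)
    (hPQ : P.Perm Q) : IsMinPathCover T Q := by
  obtain ⟨h1, h2⟩ := (isPathCover_iff hT).1 h.1
  exact ⟨(isPathCover_iff hT).2 ⟨h1.perm hPQ, mem_cover_perm hPQ h2⟩,
    fun R hR => hPQ.length_eq ▸ h.2 R hR⟩

theorem IsPathList.append {p q : List V} (hp : IsPathList T p) (hq : IsPathList T q)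
    (hd : p.Disjoint q) (h : ∀ x ∈ p.getLast?, ∀ y ∈ q.head?, T.Adj x y) : IsPathList T (p ++ q) :=
  ⟨by simp [hp.ne_nil], hp.nodup.append hq.nodup hd, hp.chain.append hq.chain h⟩

/-- Reversing one path changes the list of first vertices in a single place, and the remaining
orbits cancel. -/
theorem orbit_head_eq_orbit_getLast [Finite V] (hT : T.IsAcyclic)
    (hiso : IsIsoUniqueZeroForcing T) {P : List (List V)} (hP : IsMinPathCover T P)
    {p : List V} (hp : p ∈ P) :
    p.head?.map (orbit T) = p.getLast?.map (orbit T) := by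
  obtain ⟨R, hR⟩ := exists_perm_cons hp
  have hP' := hP.perm hT hR
  obtain ⟨h1, h2⟩ := (isPathCover_iff hT).1 hP'.1
  obtain ⟨h3, h4, h5⟩ := isPathSystem_cons.1 h1
  have hQ : IsPathSystem T (p.reverse :: R) :=
    isPathSystem_cons.2 ⟨h3.reverse, fun q hq x hx => h4 q hq (List.mem_reverse.1 hx), h5⟩
  have hcov : ∀ v, ∃ q ∈ p.reverse :: R, v ∈ q := by
    intro v
    obtain ⟨q, hq, hv⟩ := h2 v
    rcases List.mem_cons.1 hq with rfl | hq
    · exact ⟨q.reverse, by simp, by simpa using hv⟩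
    · exact ⟨q, by simp [hq], hv⟩
  have h := perm_orbit_head? hT hiso hP' hQ hcov (by simp)
  rw [List.map_cons, List.map_cons, ← List.singleton_append,
    ← List.singleton_append (x := Option.map _ p.reverse.head?), List.perm_append_right_iff,
    List.singleton_perm_singleton] at h
  rw [h, List.head?_reverse]

theorem perm_pair_cancel {α : Type*} {a b c : α} (h : [a, b].Perm [b, c]) : a = c := by
  have : [b, a].Perm [b, c] := (List.Perm.swap a b []).trans h
  simpa using this

/-- The exchange of edges at a connector edge, one side. -/
theorem orbit_eq_of_connector_aux [Finite V] (hT : T.IsAcyclic) (hiso : IsIsoUniqueZeroForcing T)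
    {P R : List (List V)} {X L M : List V} {x y : V} (hP : IsMinPathCover T P)
    (hperm : P.Perm ((x :: X) :: (L ++ y :: M) :: R)) (hxy : T.Adj x y) :
    ∃ z, L.getLast? = some z ∧ orbit T z = orbit T x ∧
      (L ++ y :: M).head?.map (orbit T) = some (orbit T x) := by
  have hP' := hP.perm hT hperm
  obtain ⟨h1, h2⟩ := (isPathCover_iff hT).1 hP'.1
  obtain ⟨h3, h4, h5⟩ := isPathSystem_cons.1 h1
  obtain ⟨h6, h7, h8⟩ := isPathSystem_cons.1 h5
  have hXR : ∀ q ∈ R, (x :: X).Disjoint q := fun q hq => h4 q (by simp [hq])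
  have hXL : (x :: X).Disjoint (L ++ y :: M) := h4 _ (by simp)
  have hn := List.nodup_append.1 h6.nodup
  have hchain := List.isChain_append.1 h6.chain
  have hyM : IsPathList T (y :: M) := ⟨by simp, hn.2.1, hchain.2.1⟩
  have hnew : IsPathList T ((x :: X).reverse ++ y :: M) := by
    refine h3.reverse.append hyM
      (fun a ha hb => hXL (List.mem_reverse.1 ha) (List.mem_append.2 (Or.inr hb))) ?_
    intro a ha b hb
    simp at ha hb
    rwa [← ha, ← hb]
  have hnewR : ∀ q ∈ R, ((x :: X).reverse ++ y :: M).Disjoint q := by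
    intro q hq a ha hb
    rcases List.mem_append.1 ha with ha | ha
    · exact hXR q hq (List.mem_reverse.1 ha) hb
    · exact h7 q hq (List.mem_append.2 (Or.inr ha)) hb
  rcases List.eq_nil_or_concat L with rfl | ⟨L, z, rfl⟩
  -- If `y` began its path, the edge `xy` would join the two paths into one and the cover would not
  -- be minimum.
  · exfalso
    have hQ : IsPathCover T (((x :: X).reverse ++ y :: M) :: R) := by
      refine (isPathCover_iff hT).2 ⟨isPathSystem_cons.2 ⟨hnew, hnewR, h8⟩, fun v => ?_⟩
      obtain ⟨q, hq, hv⟩ := h2 v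
      rcases List.mem_cons.1 hq with rfl | hq
      · exact ⟨_, List.mem_cons_self, List.mem_append.2 (Or.inl (List.mem_reverse.2 hv))⟩
      rcases List.mem_cons.1 hq with rfl | hq
      · exact ⟨_, List.mem_cons_self, List.mem_append.2 (Or.inr hv)⟩
      · exact ⟨q, by simp [hq], hv⟩
    have := hP'.2 _ hQ
    simp at this
  rw [List.concat_eq_append] at *
  have hL : IsPathList T (L ++ [z]) := ⟨by simp, hn.1, hchain.1⟩
  -- the two orientations of the two new paths
  have hgen : ∀ A B : List V, (A = L ++ [z] ∨ A = (L ++ [z]).reverse) →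
      (B = (x :: X).reverse ++ y :: M ∨ B = ((x :: X).reverse ++ y :: M).reverse) →
      [(x :: X).head?.map (orbit T), ((L ++ [z]) ++ y :: M).head?.map (orbit T)].Perm
        [A.head?.map (orbit T), B.head?.map (orbit T)] := by
    intro A B hA hB
    have hmA : ∀ a, a ∈ A ↔ a ∈ L ++ [z] := by
      rcases hA with rfl | rfl <;> simp [or_comm]
    have hmB : ∀ a, a ∈ B ↔ a ∈ (x :: X) ∨ a ∈ y :: M := by
      rcases hB with rfl | rfl <;> intro a <;> simp [or_assoc, or_comm, or_left_comm]
    have hpA : IsPathList T A := by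
      rcases hA with rfl | rfl
      · exact hL
      · exact hL.reverse
    have hpB : IsPathList T B := by
      rcases hB with rfl | rfl
      · exact hnew
      · exact hnew.reverse
    have hQ : IsPathSystem T (A :: B :: R) := by
      refine isPathSystem_cons.2 ⟨hpA, ?_, isPathSystem_cons.2 ⟨hpB, ?_, h8⟩⟩
      · intro q hq a ha hb
        rw [hmA] at ha
        rcases List.mem_cons.1 hq with rfl | hq
        · rcases (hmB a).1 hb with hb | hb
          · exact hXL hb (List.mem_append.2 (Or.inl ha))
          · exact hn.2.2 _ ha _ hb rfl
        · exact h7 q hq (List.mem_append.2 (Or.inl ha)) hb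
      · intro q hq a ha hb
        rcases (hmB a).1 ha with ha | ha
        · exact hXR q hq ha hb
        · exact h7 q hq (List.mem_append.2 (Or.inr ha)) hb
    have hcov : ∀ v, ∃ q ∈ A :: B :: R, v ∈ q := by
      intro v
      obtain ⟨q, hq, hv⟩ := h2 v
      rcases List.mem_cons.1 hq with rfl | hq
      · exact ⟨B, by simp, (hmB v).2 (Or.inl hv)⟩
      rcases List.mem_cons.1 hq with rfl | hq
      · rcases List.mem_append.1 hv with hv | hv
        · exact ⟨A, by simp, (hmA v).2 hv⟩
        · exact ⟨B, by simp, (hmB v).2 (Or.inr hv)⟩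
      · exact ⟨q, by simp [hq], hv⟩
    have h := perm_orbit_head? hT hiso hP' hQ hcov (by simp)
    have h' : ([(x :: X).head?.map (orbit T), ((L ++ [z]) ++ y :: M).head?.map (orbit T)] ++
        R.map fun p => p.head?.map (orbit T)).Perm
        ([A.head?.map (orbit T), B.head?.map (orbit T)] ++
        R.map fun p => p.head?.map (orbit T)) := h
    exact (List.perm_append_right_iff _).1 h'
  have hhead : ((L ++ [z]) ++ y :: M).head? = (L ++ [z]).head? := by
    rw [List.head?_append_of_ne_nil _ (by simp)]
  -- The path through `y` is cut before `y`, and the rest `y :: M` is attached to `x`. The two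
  -- orientations of the long new path show that both its ends lie in the orbit of `x`; with `f3` so
  -- does the head of the cut path. Reversing the short new path then does the same for `z`, the end
  -- created by the cut.
  have e1 := hgen _ _ (Or.inl rfl) (Or.inl rfl)
  have e2 := hgen _ _ (Or.inl rfl) (Or.inr rfl)
  have e3 := hgen _ _ (Or.inr rfl) (Or.inl rfl)
  rw [hhead] at e1 e2 e3
  have f1 := perm_pair_cancel e1
  have f2 := perm_pair_cancel e2
  have f3 := orbit_head_eq_orbit_getLast hT hiso hP' (p := (L ++ [z]) ++ y :: M) (by simp)
  have hlast : ((x :: X).reverse ++ y :: M).reverse.head? = ((L ++ [z]) ++ y :: M).getLast? := by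
    rw [List.head?_reverse, List.getLast?_append_of_ne_nil _ (by simp),
      List.getLast?_append_of_ne_nil _ (by simp)]
  rw [hlast, ← f3, hhead] at f2
  rw [← f1, ← f2, List.head?_reverse] at e3
  refine ⟨z, by simp, ?_, by rw [hhead, ← f2]; rfl⟩
  have e4 : Option.map (orbit T) (L ++ [z]).getLast? ∈
      [Option.map (orbit T) (x :: X).head?, Option.map (orbit T) (x :: X).head?] :=
    e3.symm.subset (List.mem_cons_self)
  simpa using e4

theorem orbit_eq_of_connector [Finite V] (hT : T.IsAcyclic) (hiso : IsIsoUniqueZeroForcing T)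
    {P : List (List V)} (hP : IsMinPathCover T P) {p : List V} {L M : List V} {x y : V}
    (hp : p ∈ P) (hq : L ++ y :: M ∈ P) (hpq : p ≠ L ++ y :: M)
    (hx : p.head? = some x ∨ p.getLast? = some x) (hxy : T.Adj x y) :
    (∃ z, L.getLast? = some z ∧ orbit T z = orbit T x) ∧
      (∃ z, M.head? = some z ∧ orbit T z = orbit T x) ∧
      (L ++ y :: M).head?.map (orbit T) = some (orbit T x) := by
  -- reorient the first path so that it begins with `x`
  obtain ⟨Q, X, R, hQ, hperm⟩ : ∃ (Q : List (List V)) (X : List V) (R : List (List V)),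
      IsMinPathCover T Q ∧ Q.Perm ((x :: X) :: (L ++ y :: M) :: R) := by
    obtain ⟨R, hR⟩ := exists_perm_cons_cons hp hq hpq
    rcases hx with hx | hx
    · obtain ⟨X, rfl⟩ := List.head?_eq_some_iff.1 hx
      exact ⟨P, X, R, hP, hR⟩
    · have hP' := hP.perm hT hR
      obtain ⟨h1, h2⟩ := (isPathCover_iff hT).1 hP'.1
      obtain ⟨h3, h4, h5⟩ := isPathSystem_cons.1 h1
      obtain ⟨X, hX⟩ : ∃ X, p.reverse = x :: X := by
        rw [← List.head?_reverse] at hx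
        exact List.head?_eq_some_iff.1 hx
      refine ⟨_, X, R, ⟨(isPathCover_iff hT).2 ⟨isPathSystem_cons.2 ⟨hX ▸ h3.reverse,
        fun q hq a ha => ?_, h5⟩, fun v => ?_⟩, fun W hW => ?_⟩, List.Perm.refl _⟩
      · exact h4 q hq (List.mem_reverse.1 (hX ▸ ha))
      · obtain ⟨q, hq, hv⟩ := h2 v
        rcases List.mem_cons.1 hq with rfl | hq
        · exact ⟨_, List.mem_cons_self, hX ▸ List.mem_reverse.2 hv⟩
        · exact ⟨q, List.mem_cons_of_mem _ hq, hv⟩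
      · exact hP'.2 W hW
  obtain ⟨z, hz, hz', hhead⟩ := orbit_eq_of_connector_aux hT hiso hQ hperm hxy
  have hQ' := hQ.perm hT hperm
  obtain ⟨h1, h2⟩ := (isPathCover_iff hT).1 hQ'.1
  obtain ⟨h3, h4, h5⟩ := isPathSystem_cons.1 h1
  obtain ⟨h6, h7, h8⟩ := isPathSystem_cons.1 h5
  have hrev : (L ++ y :: M).reverse = M.reverse ++ y :: L.reverse := by simp
  have hQ2 : IsMinPathCover T ((x :: X) :: (M.reverse ++ y :: L.reverse) :: R) := by
    rw [← hrev]
    refine ⟨(isPathCover_iff hT).2 ⟨isPathSystem_cons.2 ⟨h3, fun q hq a ha hb => ?_,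
      isPathSystem_cons.2 ⟨h6.reverse, fun q hq a ha => h7 q hq (List.mem_reverse.1 ha), h8⟩⟩,
      fun v => ?_⟩, fun W hW => hQ'.2 W hW⟩
    · rcases List.mem_cons.1 hq with rfl | hq
      · exact h4 _ List.mem_cons_self ha (List.mem_reverse.1 hb)
      · exact h4 q (List.mem_cons_of_mem _ hq) ha hb
    · obtain ⟨q, hq, hv⟩ := h2 v
      rcases List.mem_cons.1 hq with rfl | hq
      · exact ⟨_, List.mem_cons_self, hv⟩
      rcases List.mem_cons.1 hq with rfl | hq
      · exact ⟨_, List.mem_cons_of_mem _ List.mem_cons_self, List.mem_reverse.2 hv⟩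
      · exact ⟨q, by simp [hq], hv⟩
  obtain ⟨w, hw, hw', -⟩ := orbit_eq_of_connector_aux hT hiso hQ2 (List.Perm.refl _) hxy
  exact ⟨⟨z, hz, hz'⟩, ⟨w, by rwa [List.getLast?_reverse] at hw, hw'⟩, hhead⟩

/-- In an iso-unique zero forcing forest, the ends of the paths have at most one neighbour. -/
theorem ncard_neighborSet_of_end [Finite V] (hT : T.IsAcyclic)
    (hiso : IsIsoUniqueZeroForcing T) {P : List (List V)} (hP : IsMinPathCover T P)
    {p : List V} {x y : V} (hp : p ∈ P)
    (hx : p.head? = some x ∨ p.getLast? = some x) (hxy : T.Adj x y) :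
    (T.neighborSet x).ncard = 1 := by
  obtain ⟨h1, h2⟩ := (isPathCover_iff hT).1 hP.1
  by_contra hne
  have hpos : 0 < (T.neighborSet x).ncard := (Set.ncard_pos (Set.toFinite _)).2 ⟨y, hxy⟩
  let U : Set V := {v | ∃ p ∈ P, v ∈ p ∧ p.head?.map (orbit T) = some (orbit T x)}
  have hend : ∀ p ∈ P, ∀ v, (p.head? = some v ∨ p.getLast? = some v) →
      p.head?.map (orbit T) = some (orbit T v) := by
    rintro p hp v (hv | hv)
    · rw [hv]; rfl
    · rw [orbit_head_eq_orbit_getLast hT hiso hP hp, hv]; rfl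
  have hxp : x ∈ p := by
    rcases hx with hx | hx
    · exact mem_of_head? hx
    · exact List.mem_of_getLast? hx
  -- `U` is the union of the paths whose ends lie in the orbit of `x`. A vertex with at most one
  -- neighbour in `U` is an end of its path, so it lies in the orbit of `x` and has at least two
  -- neighbours. But all of them belong to `U`: those on its own path trivially, the others by
  -- `orbit_eq_of_connector`.
  obtain ⟨v, ⟨r, hr, hvr, hro⟩, huniq⟩ := exists_atMostOne_neighbor hT
    (U := U) ⟨x, p, hp, hxp, hend p hp x hx⟩
  obtain ⟨L, M, rfl⟩ := List.append_of_mem hvr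
  have hpl := h1.isPathList _ hr
  have hmid : ∀ a b, L.getLast? = some a → M.head? = some b → False := by
    intro a b ha hb
    obtain ⟨L', rfl⟩ := List.getLast?_eq_some_iff.1 ha
    obtain ⟨M', rfl⟩ := List.head?_eq_some_iff.1 hb
    have hab : a = b := by
      refine huniq a ⟨_, hr, by simp, hro⟩ b ⟨_, hr, by simp, hro⟩ ?_ ?_
      · have := hpl.chain
        rw [List.append_assoc] at this
        exact (List.isChain_append_cons_cons.1 this).2.1.symm
      · exact (List.isChain_append_cons_cons.1 hpl.chain).2.1
    subst hab
    have := hpl.nodup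
    rw [List.nodup_append] at this
    exact this.2.2 a (by simp) a (by simp) rfl
  have hvend : (L ++ v :: M).head? = some v ∨ (L ++ v :: M).getLast? = some v := by
    rw [head?_append_cons hpl.nodup, getLast?_append_cons hpl.nodup]
    by_contra hc
    push Not at hc
    exact hmid _ _ (List.getLast?_eq_some_getLast hc.1) (List.head?_eq_some_head hc.2)
  have hov : orbit T v = orbit T x := by
    have := hend _ hr v hvend
    rw [hro] at this
    exact (Option.some.inj this).symm
  have hcard : 1 < (T.neighborSet v).ncard := by
    rw [ncard_neighborSet_of_orbit_eq hov]
    omega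
  obtain ⟨a, b, ha, hb, hab⟩ := (Set.one_lt_ncard_iff (Set.toFinite _)).1 hcard
  have hU : ∀ w, T.Adj v w → w ∈ U := by
    intro w hvw
    obtain ⟨r', hr', hwr'⟩ := h2 w
    by_cases hrr : L ++ v :: M = r'
    · exact ⟨_, hr, hrr ▸ hwr', hro⟩
    · obtain ⟨L', M', rfl⟩ := List.append_of_mem hwr'
      have := (orbit_eq_of_connector hT hiso hP hr hr' hrr hvend hvw).2.2
      exact ⟨_, hr', hwr', by rw [this, hov]⟩
  exact hab (huniq a (hU a ha) b (hU b hb) ha hb)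

/-- In an iso-unique zero forcing forest, the path cover of the pruned forest is interior. -/
theorem isInteriorCover_of_isoUnique [Finite V] (hT : T.IsAcyclic)
    (hiso : IsIsoUniqueZeroForcing T) {removed : List V} (hr : IsPruning T removed)
    {P : List (List {v // v ∉ removed})} (hP : IsMinPathCover (pruned T removed) P) :
    IsInteriorCover (pruned T removed) P := by
  rintro x y ⟨hxy, p, hp, q, hq, hpq, hxp, hyq⟩ p' hp' hxp'
  have hT' := isAcyclic_pruned hT removed
  have hsys := ((isPathCover_iff hT').1 hP.1).1
  obtain rfl := hsys.eq_of_mem hp hp' hxp hxp'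
  by_contra hcon
  have hx : p.head? = some x ∨ p.getLast? = some x := by
    by_contra h
    exact hcon (not_or.1 h)
  have hmin := isMinPathCover_coverInT hT hr hP
  have hsysT := ((isPathCover_iff hT).1 hmin.1).1
  have hmem : ∀ p ∈ P, p.map Subtype.val ∈ coverInT removed P := fun p hp =>
    List.mem_append.2 (Or.inl (List.mem_map_of_mem hp))
  have hx' : (p.map Subtype.val).head? = some x.val ∨ (p.map Subtype.val).getLast? = some x.val := by
    rw [List.head?_map, List.getLast?_map]
    rcases hx with hx | hx
    · exact Or.inl (by rw [hx]; rfl)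
    · exact Or.inr (by rw [hx]; rfl)
  have hpq' : p.map Subtype.val ≠ q.map Subtype.val := fun e =>
    hpq (List.map_injective_iff.2 Subtype.val_injective e)
  have hxyT : T.Adj x.val y.val := hxy
  obtain ⟨L, M, rfl⟩ := List.append_of_mem hyq
  have hpl := hsysT.isPathList _ (hmem _ hq)
  rw [List.map_append, List.map_cons] at hpl hpq'
  have hqm := hmem _ hq
  rw [List.map_append, List.map_cons] at hqm
  obtain ⟨⟨z, hz, hz'⟩, ⟨w, hw, hw'⟩, -⟩ :=
    orbit_eq_of_connector hT hiso hmin (hmem p hp) hqm hpq' hx' hxyT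
  have h1 := ncard_neighborSet_of_end hT hiso hmin (hmem p hp) hx' hxyT
  have hzL := List.mem_of_getLast? hz
  have hwM := List.mem_of_mem_head? hw
  obtain ⟨⟨z, hzr⟩, hzL', rfl⟩ := List.mem_map.1 hzL
  obtain ⟨⟨w, hwr⟩, hwM', rfl⟩ := List.mem_map.1 hwM
  have hzy : T.Adj y.val z := by
    obtain ⟨L', hL'⟩ := List.getLast?_eq_some_iff.1 hz
    have := hpl.chain
    rw [hL', List.append_assoc] at this
    exact (List.isChain_append_cons_cons.1 this).2.1.symm
  have hwy : T.Adj y.val w := by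
    obtain ⟨M', hM'⟩ := List.head?_eq_some_iff.1 hw
    have := hpl.chain
    rw [hM'] at this
    exact (List.isChain_append_cons_cons.1 this).2.1
  -- The end `x` and both path neighbours of `y` are leaves, since they share the orbit of `x`; all
  -- three survive the pruning, one more than it would leave at `y`.
  have hsub : ({x.val, z, w} : Set V) ⊆ leavesAt T y.val \ {u | u ∈ removed} := by
    rintro a (rfl | rfl | rfl)
    · exact ⟨⟨hxyT.symm, h1⟩, x.2⟩
    · exact ⟨⟨hzy, by rw [ncard_neighborSet_of_orbit_eq hz']; exact h1⟩, hzr⟩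
    · exact ⟨⟨hwy, by rw [ncard_neighborSet_of_orbit_eq hw']; exact h1⟩, hwr⟩
  have hxq : x ∉ L ++ y :: M := fun h => hpq (hsys.eq_of_mem hp hq hxp h)
  have hxz : x.val ≠ z := by
    rintro rfl
    exact hxq (List.mem_append.2 (Or.inl hzL'))
  have hxw : x.val ≠ w := by
    rintro rfl
    exact hxq (List.mem_append.2 (Or.inr (List.mem_cons_of_mem _ hwM')))
  have hzw : z ≠ w := by
    rintro rfl
    exact (List.nodup_append.1 hpl.nodup).2.2 z hzL z (List.mem_cons_of_mem _ hwM) rfl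
  have h3 : ({x.val, z, w} : Set V).ncard = 3 := Set.ncard_eq_three.2 ⟨_, _, _, hxz, hxw, hzw, rfl⟩
  have h4 := Set.ncard_le_ncard hsub (Set.toFinite _)
  have h5 : (leavesAt T y.val \ {u | u ∈ removed}).ncard ≤ (leavesAt T y.val).ncard :=
    Set.ncard_le_ncard Set.sdiff_subset (Set.toFinite _)
  have h6 := hr.two_remain y.val (by omega)
  omega

theorem pathCheck_of_isoUnique [Finite V] (hT : T.IsAcyclic) (hiso : IsIsoUniqueZeroForcing T)
    {P : List (List V)} (hP : IsMinPathCover T P) {p : List V} (hp : p ∈ P) : PathCheck T p := by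
  have hpl := ((isPathCover_iff hT).1 hP.1).1.isPathList p hp
  rw [pathCheck_iff hT hpl, ← orbit_eq_iff]
  have := orbit_head_eq_orbit_getLast hT hiso hP hp
  rw [List.head?_eq_some_head hpl.ne_nil, List.getLast?_eq_some_getLast hpl.ne_nil] at this
  exact Option.some.inj this

end Necessity


/-! ### Matching two choices of path ends by flips and leaf exchanges -/

section Sufficiency

variable {V : Type*} {T : SimpleGraph V}

/-- `v` is an end-vertex of the path `p`. -/
def IsEnd (p : List V) (v : V) : Prop := p.head? = some v ∨ p.getLast? = some v

theorem IsEnd.mem {p : List V} {v : V} (h : IsEnd p v) : v ∈ p := by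
  rcases h with h | h
  · exact mem_of_head? h
  · exact List.mem_of_getLast? h

theorem IsPathSystem.isEnd_iff {P : List (List V)} (hP : IsPathSystem T P)
    {p : List V} (hp : p ∈ P) {v : V} (hv : v ∈ p) :
    IsEnd p v ↔ edgeDegree (systemEdges P) v ≠ 2 := by
  rw [ne_eq, hP.edgeDegree_eq_two_iff hp hv, IsEnd]
  tauto

/-- The path `p` is connected by edges of the second system, and `q` is closed under these edges. -/
theorem mem_of_systemEdges_subset {P Q : List (List V)} (hP : IsPathSystem T P)
    (hQ : IsPathSystem T Q) (hE : systemEdges P ⊆ systemEdges Q) {p q : List V} (hp : p ∈ P)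
    (hq : q ∈ Q) {u : V} (hup : u ∈ p) (huq : u ∈ q) {w : V} (hw : w ∈ p) : w ∈ q := by
  have hchain : p.IsChain (fromEdgeSet (systemEdges Q)).Adj := by
    refine List.isChain_iff_getElem.2 fun i hi => ?_
    rw [fromEdgeSet_adj]
    refine ⟨hE ⟨p, hp, ?_⟩, ((hP.isPathList p hp).chain.getElem i hi).ne⟩
    refine mem_pathEdges.2 ⟨p.take i, p.drop (i + 2), p[i], p[i + 1], ?_, rfl⟩
    rw [List.getElem_cons_drop, List.getElem_cons_drop, List.take_append_drop]
  refine Reachable.mem_of_closed (reachable_of_isChain hchain hup hw) (S := {x | x ∈ q}) huq ?_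
  intro x y hx hxy
  rw [fromEdgeSet_adj] at hxy
  obtain ⟨⟨r, hr, he⟩, -⟩ := hxy
  have := hQ.eq_of_mem hr hq (mem_of_mem_pathEdges he (Sym2.mem_mk_left x y)) hx
  exact this ▸ mem_of_mem_pathEdges he (Sym2.mem_mk_right x y)

/-- `A` contains exactly one end-vertex of the path `p`. -/
def OneEnd (A : Set V) (p : List V) : Prop := ∃ v ∈ A, IsEnd p v ∧ ∀ w ∈ A, IsEnd p w → w = v

/-- Systems with the same edges have the same paths up to orientation, and whether a vertex is an
end can be read off from the number of path edges at it. -/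
theorem oneEnd_heads {P Q : List (List V)} (hP : IsPathSystem T P)
    (hQ : IsPathSystem T Q) (hcovQ : ∀ v, ∃ q ∈ Q, v ∈ q)
    (hE : systemEdges Q = systemEdges P) {p : List V} (hp : p ∈ P) : OneEnd (heads Q) p := by
  obtain ⟨a, ha⟩ := List.exists_mem_of_ne_nil p (hP.isPathList p hp).ne_nil
  obtain ⟨q, hq, haq⟩ := hcovQ a
  have hpq : ∀ w, w ∈ p → w ∈ q := fun w hw =>
    mem_of_systemEdges_subset hP hQ hE.symm.subset hp hq ha haq hw
  have hqp : ∀ w, w ∈ q → w ∈ p := fun w hw =>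
    mem_of_systemEdges_subset hQ hP hE.subset hq hp haq ha hw
  have hne := (hQ.isPathList q hq).ne_nil
  have hh : q.head? = some (q.head hne) := List.head?_eq_some_head hne
  refine ⟨q.head hne, ⟨q, hq, hh⟩, ?_, ?_⟩
  · rw [hP.isEnd_iff hp (hqp _ (List.head_mem hne)), ← hE,
      ← hQ.isEnd_iff hq (List.head_mem hne)]
    exact Or.inl hh
  · rintro w ⟨r, hr, hw⟩ hwp
    obtain rfl := hQ.eq_of_mem hr hq (mem_of_head? hw) (hpq w hwp.mem)
    rw [hh] at hw
    exact (Option.some.inj hw).symm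

theorem exists_isEnd_of_mem_heads {P Q : List (List V)} (hP : IsPathSystem T P)
    (hcov : ∀ v, ∃ p ∈ P, v ∈ p) (hQ : IsPathSystem T Q)
    (hE : systemEdges Q = systemEdges P) {v : V} (hv : v ∈ heads Q) : ∃ p ∈ P, IsEnd p v := by
  obtain ⟨q, hq, hv⟩ := hv
  obtain ⟨p, hp, hvp⟩ := hcov v
  refine ⟨p, hp, ?_⟩
  rw [hP.isEnd_iff hp hvp, ← hE, ← hQ.isEnd_iff hq (mem_of_head? hv)]
  exact Or.inl hv

theorem pathEdges_map {W : Type*} (f : V → W) (p : List V) :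
    pathEdges (p.map f) = Sym2.map f '' pathEdges p := by
  induction p with
  | nil => simp [pathEdges]
  | cons a l ih =>
    cases l with
    | nil => simp [pathEdges]
    | cons b l =>
      rw [List.map_cons] at ih
      rw [List.map_cons, List.map_cons, pathEdges, pathEdges, ih, Set.image_insert_eq,
        Sym2.map_mk]

theorem systemEdges_coverInT {removed : List V} (P : List (List {v // v ∉ removed})) :
    systemEdges (coverInT removed P) = Sym2.map Subtype.val '' systemEdges P := by
  ext e
  constructor
  · rintro ⟨p, hp, he⟩
    rcases List.mem_append.1 hp with hp | hp
    · obtain ⟨p, hp', rfl⟩ := List.mem_map.1 hp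
      rw [pathEdges_map] at he
      obtain ⟨e, he, rfl⟩ := he
      exact ⟨e, ⟨p, hp', he⟩, rfl⟩
    · obtain ⟨v, -, rfl⟩ := List.mem_map.1 hp
      simp [pathEdges] at he
  · rintro ⟨e, ⟨p, hp, he⟩, rfl⟩
    refine ⟨p.map Subtype.val, List.mem_append.2 (Or.inl (List.mem_map_of_mem hp)), ?_⟩
    rw [pathEdges_map]
    exact ⟨e, he, rfl⟩

theorem systemEdges_perm {P Q : List (List V)} (h : P.Perm Q) : systemEdges P = systemEdges Q := by
  ext e; simp [systemEdges, h.mem_iff]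

theorem heads_map (Q : List (List V)) (f : V → V) : heads (Q.map (List.map f)) = f '' heads Q := by
  ext v
  constructor
  · rintro ⟨p, hp, hv⟩
    obtain ⟨q, hq, rfl⟩ := List.mem_map.1 hp
    rw [List.head?_map] at hv
    obtain ⟨w, hw, rfl⟩ := Option.map_eq_some_iff.1 hv
    exact ⟨w, ⟨q, hq, hw⟩, rfl⟩
  · rintro ⟨w, ⟨q, hq, hw⟩, rfl⟩
    exact ⟨q.map f, List.mem_map_of_mem hq, by rw [List.head?_map, hw]; rfl⟩

/-- Every minimum zero forcing set is mapped, by an automorphism that fixes all vertices but the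
leaves at stars, to a choice of ends of the paths of the interior path cover. -/
theorem exists_normalize_zeroForcing [Finite V] (hT : T.IsAcyclic) {removed : List V}
    (hr : IsPruning T removed) {P : List (List {v // v ∉ removed})}
    (hP : IsMinPathCover (pruned T removed) P) (hint : IsInteriorCover (pruned T removed) P)
    {A : Set V} (hA : IsMinZeroForcingSet T A) :
    ∃ σ : T ≃g T, (∀ v, ¬ StarLeaf T v → σ v = v) ∧ (∀ u ∈ removed, u ∈ σ '' A) ∧
      (∀ p ∈ coverInT removed P, OneEnd (σ '' A) p) ∧
      ∀ v ∈ σ '' A, ∃ p ∈ coverInT removed P, IsEnd p v := by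
  obtain ⟨PA, hPA, rfl⟩ := hA.exists_minPathCover hT
  obtain ⟨h1, h2⟩ := (isPathCover_iff hT).1 hPA.1
  obtain ⟨σ, hσ, hsing⟩ := exists_normalize hr h1 h2
  have h3 := h1.map (f := σ) σ.injective fun a b hab => σ.map_adj_iff.2 hab
  have h4 := map_cover h2 σ
  obtain ⟨Q', h5, h6, hperm⟩ := exists_perm_coverInT hr.nodup h3 h4 hsing
  have hT' := isAcyclic_pruned hT removed
  obtain ⟨h7, h8⟩ := (isPathCover_iff hT').1 hP.1
  have hlen : Q'.length ≤ P.length := by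
    have e1 := hperm.length_eq
    have e2 := hPA.2 _ (isMinPathCover_coverInT hT hr hP).1
    rw [length_coverInT] at e1 e2
    rw [List.length_map] at e1
    omega
  have hE : systemEdges (PA.map (List.map σ)) = systemEdges (coverInT removed P) := by
    rw [systemEdges_perm hperm, systemEdges_coverInT, systemEdges_coverInT,
      systemEdges_eq_of_isInteriorCover hT' h7 h8 hint h5 h6 hlen]
  have h9 := isPathSystem_coverInT hr.nodup h7
  have h10 := cover_coverInT h8
  refine ⟨σ, hσ, fun u hu => ?_, fun p hp => ?_, fun v hv => ?_⟩
  · rw [← heads_map]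
    exact ⟨[u], hsing u hu, rfl⟩
  · rw [← heads_map]
    exact oneEnd_heads h9 h3 h4 hE hp
  · rw [← heads_map] at hv
    exact exists_isEnd_of_mem_heads h9 h10 h3 hE hv

/-- The path that contains a leaf at a star `s` in an interior path cover ends in two leaves. -/
theorem star_path [Finite V] (hT : T.IsAcyclic) {removed : List V}
    (hr : IsPruning T removed) {P : List (List {v // v ∉ removed})}
    (hP : IsMinPathCover (pruned T removed) P) (hint : IsInteriorCover (pruned T removed) P)
    {s : V} (hs : 2 < (leavesAt T s).ncard) :
    ∃ l₁ l₂, l₁ ≠ l₂ ∧ leavesAt T s \ {u | u ∈ removed} = {l₁, l₂} ∧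
      ∃ p ∈ coverInT removed P, ∀ v, IsEnd p v ↔ v = l₁ ∨ v = l₂ := by
  have hT' := isAcyclic_pruned hT removed
  obtain ⟨h1, h2⟩ := (isPathCover_iff hT').1 hP.1
  have h3 := isPathSystem_coverInT hr.nodup h1
  obtain ⟨l₁, l₂, hne, hl⟩ := Set.ncard_eq_two.1 (hr.two_remain s hs)
  refine ⟨l₁, l₂, hne, hl, ?_⟩
  have hdeg := (isInteriorCover_iff hT' h1 h2).1 hint
  have hsr : s ∉ removed := fun h => not_starLeaf_of_star hs (hr.starLeaf h)
  -- A kept leaf has degree one in the pruned forest, and an interior cover attains this degree, so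
  -- its only edge is a path edge.
  have hedge : ∀ l ∈ leavesAt T s \ {u | u ∈ removed},
      s(s, l) ∈ systemEdges (coverInT removed P) := by
    rintro l ⟨hl, hlr⟩
    have hlr' : l ∉ removed := hlr
    have hN : (pruned T removed).neighborSet ⟨l, hlr'⟩ = {⟨s, hsr⟩} := by
      ext ⟨x, hx⟩
      rw [mem_neighborSet, Set.mem_singleton_iff, Subtype.mk.injEq]
      constructor
      · exact fun h => neighbor_eq_of_leaf hl h
      · rintro rfl
        exact (hl.1.symm : T.Adj l x)
    have h := hdeg ⟨l, hlr'⟩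
    rw [hN, Set.ncard_singleton, edgeDegree] at h
    obtain ⟨x, hx⟩ := Set.ncard_eq_one.1 (h.trans (by simp))
    have hxm : s((⟨l, hlr'⟩ : {v // v ∉ removed}), x) ∈ systemEdges P := by
      have : x ∈ ({x} : Set _) := rfl
      rwa [← hx] at this
    have hxs : x ∈ (pruned T removed).neighborSet ⟨l, hlr'⟩ := h1.systemEdges_subset hxm
    rw [hN, Set.mem_singleton_iff] at hxs
    subst hxs
    rw [systemEdges_coverInT, Sym2.eq_swap]
    exact ⟨_, hxm, rfl⟩
  have hm1 : l₁ ∈ leavesAt T s \ {u | u ∈ removed} := hl ▸ Or.inl rfl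
  have hm2 : l₂ ∈ leavesAt T s \ {u | u ∈ removed} := hl ▸ Or.inr rfl
  obtain ⟨p, hp, he1⟩ := hedge l₁ hm1
  obtain ⟨p', hp', he2⟩ := hedge l₂ hm2
  have hsp := mem_of_mem_pathEdges he1 (Sym2.mem_mk_left s l₁)
  obtain rfl := h3.eq_of_mem hp hp' hsp (mem_of_mem_pathEdges he2 (Sym2.mem_mk_left s l₂))
  have hend : ∀ l ∈ leavesAt T s, l ∈ p → IsEnd p l := by
    intro l hl hlp
    rw [h3.isEnd_iff hp hlp]
    have := edgeDegree_le_ncard h3.systemEdges_subset l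
    rw [hl.2] at this
    omega
  have e1 := hend l₁ hm1.1 (mem_of_mem_pathEdges he1 (Sym2.mem_mk_right s l₁))
  have e2 := hend l₂ hm2.1 (mem_of_mem_pathEdges he2 (Sym2.mem_mk_right s l₂))
  refine ⟨p, hp, fun v => ⟨fun hv => ?_, ?_⟩⟩
  · by_contra hc
    push Not at hc
    rcases e1 with e1 | e1 <;> rcases e2 with e2 | e2 <;> rcases hv with hv | hv
    all_goals first
      | exact hne (Option.some.inj (e1.symm.trans e2))
      | exact hc.1 (Option.some.inj (hv.symm.trans e1))
      | exact hc.2 (Option.some.inj (hv.symm.trans e2))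
  · rintro (rfl | rfl)
    · exact e1
    · exact e2

/-- The vertices at the halves of another path are in smaller halves. -/
theorem ncard_headHalf_lt [Finite V] (hT : T.IsAcyclic) {P : List (List V)}
    (hP : IsPathSystem T P) {p q : List V} (hp : p ∈ P) (hq : q ∈ P) (hpq : p ≠ q)
    (h2 : 2 ≤ q.length)
    (hcp : (lastHalf T p).ncard = (headHalf T p).ncard)
    (hcq : (lastHalf T q).ncard = (headHalf T q).ncard)
    {v : V} (hv : v ∈ q) (hvp : v ∈ headHalf T p ∨ v ∈ lastHalf T p) :
    (headHalf T q).ncard < (headHalf T p).ncard := by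
  have hpp := hP.isPathList p hp
  have hqp := hP.isPathList q hq
  have hdisj : ∀ x, x ∈ p → x ∈ q → False := fun x h1 h2 => hpq (hP.eq_of_mem hp hq h1 h2)
  have hchain : ∀ a b : List V, IsPathList T a → (∀ x, x ∈ b → x ∈ a → False) →
      a.IsChain (T.deleteEdges (midEdges T b)).Adj := by
    intro a b ha hab
    refine List.isChain_iff_getElem.2 fun i hi => ?_
    rw [deleteEdges_adj]
    refine ⟨ha.chain.getElem i hi, fun he => ?_⟩
    obtain ⟨x, hx, hxe⟩ := exists_mem_of_mem_midEdges he
    rcases Sym2.mem_iff.1 hxe with rfl | rfl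
    · exact hab _ hx (List.getElem_mem _)
    · exact hab _ hx (List.getElem_mem _)
  have hqc := hchain q p hqp hdisj
  have hpc := hchain p q hpp fun x h1 h2 => hdisj x h2 h1
  -- the half `C` of `p` around `q`
  obtain ⟨a, ha, haC, hCcard⟩ : ∃ a ∈ p, (T.deleteEdges (midEdges T p)).Reachable a v ∧
      {x | (T.deleteEdges (midEdges T p)).Reachable a x}.ncard = (headHalf T p).ncard := by
    rcases hvp with ⟨hn, h⟩ | ⟨hn, h⟩
    · refine ⟨_, List.head_mem hn, h, ?_⟩
      congr 1
      ext x
      exact ⟨fun hx => ⟨hn, hx⟩, fun hx => hx.2⟩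
    · refine ⟨_, List.getLast_mem hn, h, ?_⟩
      rw [← hcp]
      congr 1
      ext x
      exact ⟨fun hx => ⟨hn, hx⟩, fun hx => hx.2⟩
  -- a half `D` of `q` that avoids `p`
  obtain ⟨b, hb, hbD, hDcard⟩ : ∃ b ∈ q,
      (∀ x, (T.deleteEdges (midEdges T q)).Reachable b x → x ∉ p) ∧
      {x | (T.deleteEdges (midEdges T q)).Reachable b x}.ncard = (headHalf T q).ncard := by
    have hn := hqp.ne_nil
    -- `p` stays connected when the middle of `q` is deleted, so it cannot meet both halves of `q`.
    by_cases h : ∃ x ∈ p, (T.deleteEdges (midEdges T q)).Reachable (q.head hn) x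
    · obtain ⟨x, hx, hr⟩ := h
      refine ⟨_, List.getLast_mem hn, fun y hy hyp => ?_, ?_⟩
      · exact not_reachable_ends hT hqp h2
          (hr.trans ((reachable_of_isChain hpc hx hyp).trans hy.symm))
      · rw [← hcq]
        congr 1
        ext x
        exact ⟨fun hx => ⟨hn, hx⟩, fun hx => hx.2⟩
    · refine ⟨_, List.head_mem hn, fun y hy hyp => h ⟨y, hyp, hy⟩, ?_⟩
      congr 1
      ext x
      exact ⟨fun hx => ⟨hn, hx⟩, fun hx => hx.2⟩
  rw [← hCcard, ← hDcard]
  -- The half `D` avoids `p`, so deleting the middle of `p` does not disconnect it, and `q` joins it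
  -- to `v` inside `C`. The inclusion is strict because `a` lies on `p`.
  refine Set.ncard_lt_ncard ⟨fun x hx => ?_, fun hsub => ?_⟩ (Set.toFinite _)
  · refine (haC.trans (reachable_of_isChain hqc hv hb)).trans ?_
    refine Reachable.mono_on hx fun y z hy hyz => ?_
    rw [deleteEdges_adj] at hyz ⊢
    refine ⟨hyz.1, fun he => ?_⟩
    have hz : (T.deleteEdges (midEdges T q)).Reachable b z :=
      hy.trans (Adj.reachable (by rw [deleteEdges_adj]; exact hyz))
    obtain ⟨w, hw, hwe⟩ := exists_mem_of_mem_midEdges he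
    rcases Sym2.mem_iff.1 hwe with rfl | rfl
    · exact hbD _ hy hw
    · exact hbD _ hz hw
  · exact hbD a (hsub (Reachable.refl a)) ha

/-- If all checks succeed for an interior path cover, then two minimum zero forcing sets can be
made to agree on the ends of all paths that contain no leaf at a star. -/
theorem exists_agree_on_ends [Finite V] (hT : T.IsAcyclic) {P : List (List V)}
    (hP : IsPathSystem T P) (hcheck : ∀ p ∈ P, PathCheck T p) {B : Set V}
    (hone : ∀ C, IsMinZeroForcingSet T C → ∀ p ∈ P, (∀ v ∈ p, ¬ StarLeaf T v) → OneEnd C p)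
    (hB : IsMinZeroForcingSet T B) {A : Set V} (hA : IsMinZeroForcingSet T A)
    (F : Finset (List V)) (hF : ∀ p ∈ F, p ∈ P ∧ (∀ v ∈ p, ¬ StarLeaf T v) ∧ 2 ≤ p.length) :
    ∃ ψ : T ≃g T, ∀ p ∈ F, ∀ v, IsEnd p v → (v ∈ ψ '' A ↔ v ∈ B) := by
  classical
  have hflip : ∀ p ∈ P, 2 ≤ p.length → ∃ (hn : p ≠ []) (ψ : T ≃g T),
      ψ (p.head hn) = p.getLast hn ∧ ψ (p.getLast hn) = p.head hn ∧
      (lastHalf T p).ncard = (headHalf T p).ncard ∧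
      ∀ v, v ∉ headHalf T p → v ∉ lastHalf T p → ψ v = v := by
    intro p hp h2
    have hpl := hP.isPathList p hp
    obtain ⟨φ, hφ, -⟩ := (hcheck p hp).swap hpl.ne_nil
    obtain ⟨ψ, h1, h3, h4, h5⟩ := exists_flip hT hpl h2 φ hφ
    refine ⟨hpl.ne_nil, ψ, h1, h3, ?_, h5⟩
    rw [← h4, Set.ncard_image_of_injective _ ψ.injective]
  -- Because of the order dual, the path inserted last has the smallest halves. Its flip moves only
  -- vertices in these halves, and a path met there would have still smaller halves; so the paths
  -- treated before are not disturbed.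
  induction F using Finset.induction_on_max_value
    (fun p => OrderDual.toDual (headHalf T p).ncard) with
  | empty => exact ⟨Iso.refl, by simp⟩
  | insert p F hpF hmax ih =>
    obtain ⟨ψ, hψ⟩ := ih fun q hq => hF q (Finset.mem_insert_of_mem hq)
    obtain ⟨hp, hst, h2⟩ := hF p (Finset.mem_insert_self _ _)
    obtain ⟨hn, θ, h3, h4, hcp, h5⟩ := hflip p hp h2
    have hA1 := hA.image ψ
    obtain ⟨a, haA, ha, hau⟩ := hone _ hA1 p hp hst
    obtain ⟨b, hbB, hb, hbu⟩ := hone _ hB p hp hst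
    have hends : ∀ v, IsEnd p v ↔ v = p.head hn ∨ v = p.getLast hn := by
      intro v
      rw [IsEnd, List.head?_eq_some_head hn, List.getLast?_eq_some_getLast hn, Option.some.injEq,
        Option.some.injEq, eq_comm, eq_comm (a := p.getLast hn)]
    by_cases hab : a = b
    · subst hab
      refine ⟨ψ, fun q hq v hv => ?_⟩
      rcases Finset.mem_insert.1 hq with rfl | hq
      · exact ⟨fun h => hau v h hv ▸ hbB, fun h => hbu v h hv ▸ haA⟩
      · exact hψ q hq v hv
    · have hfix : ∀ q ∈ F, ∀ v ∈ q, θ v = v := by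
        intro q hq v hv
        obtain ⟨hqP, -, hq2⟩ := hF q (Finset.mem_insert_of_mem hq)
        obtain ⟨-, -, -, -, hcq, -⟩ := hflip q hqP hq2
        have hpq : p ≠ q := fun e => hpF (e ▸ hq)
        have hle : (headHalf T p).ncard ≤ (headHalf T q).ncard := hmax q hq
        by_contra hne
        have : v ∈ headHalf T p ∨ v ∈ lastHalf T p := by
          by_contra hc
          rw [not_or] at hc
          exact hne (h5 v hc.1 hc.2)
        exact absurd (ncard_headHalf_lt hT hP hp hqP hpq hq2 hcp hcq hv this) (not_lt.2 hle)
      have hswap : θ a = b ∧ θ b = a := by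
        rcases (hends a).1 ha with rfl | rfl <;> rcases (hends b).1 hb with rfl | rfl
        · exact absurd rfl hab
        · exact ⟨h3, h4⟩
        · exact ⟨h4, h3⟩
        · exact absurd rfl hab
      refine ⟨ψ.trans θ, fun q hq v hv => ?_⟩
      have himg : (ψ.trans θ) '' A = θ '' (ψ '' A) := by
        rw [Set.image_image]; rfl
      rw [himg]
      rcases Finset.mem_insert.1 hq with rfl | hq
      · have hv' : v = a ∨ v = b := by
          rcases (hends a).1 ha with ha | ha <;> rcases (hends b).1 hb with hb | hb
          · exact absurd (ha.trans hb.symm) hab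
          · rw [ha, hb]; exact (hends v).1 hv
          · rw [ha, hb]; exact ((hends v).1 hv).symm
          · exact absurd (ha.trans hb.symm) hab
        rcases hv' with rfl | rfl
        · constructor
          · rintro ⟨w, hw, hwa⟩
            have : w = b := θ.injective (hwa.trans hswap.2.symm)
            subst this
            exact absurd (hau w hw hb).symm hab
          · intro hvB
            exact absurd (hbu v hvB ha) hab
        · exact ⟨fun _ => hbB, fun _ => ⟨a, haA, hswap.1⟩⟩
      · rw [← hψ q hq v hv]
        have hvv := hfix q hq v hv.mem
        constructor
        · rintro ⟨w, hw, hwv⟩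
          have : w = v := θ.injective (hwv.trans hvv.symm)
          exact this ▸ hw
        · exact fun h => ⟨v, h, hvv⟩

/-- Two minimum zero forcing sets that agree outside the leaves at stars are exchanged by an
automorphism, provided that each star has exactly one leaf that is not in the set. -/
theorem exists_iso_of_agree [Finite V] {B : Set V} (hB : IsMinZeroForcingSet T B)
    (hstar : ∀ C, IsMinZeroForcingSet T C → ∀ s, 2 < (leavesAt T s).ncard →
      ∃ l ∈ leavesAt T s, l ∉ C ∧ ∀ l' ∈ leavesAt T s, l' ≠ l → l' ∈ C)
    {A : Set V} (hA : IsMinZeroForcingSet T A)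
    (hagree : ∀ v, ¬ StarLeaf T v → (v ∈ A ↔ v ∈ B)) : ∃ ψ : T ≃g T, ψ '' A = B := by
  classical
  generalize hk : (A \ B).ncard = k
  induction k using Nat.strong_induction_on generalizing A with
  | _ k ih =>
    by_cases hsub : A ⊆ B
    · have := Set.eq_of_subset_of_ncard_le hsub (hB.2 A hA.1) (Set.toFinite _)
      exact ⟨Iso.refl, by simpa using this⟩
    obtain ⟨v, hvA, hvB⟩ := Set.not_subset.1 hsub
    have hvs : StarLeaf T v := by
      by_contra h
      exact hvB ((hagree v h).1 hvA)
    obtain ⟨s, hvs, hs⟩ := hvs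
    obtain ⟨l, hl, hlA, hlA'⟩ := hstar A hA s hs
    obtain ⟨m, hm, hmB, hmB'⟩ := hstar B hB s hs
    have hvm : v = m := by
      by_contra hne
      exact hvB (hmB' v hvs hne)
    subst hvm
    have hlv : l ≠ v := fun e => hlA (e ▸ hvA)
    -- Of the leaves at `s`, only `l` is missing in `A` and only `v` is missing in `B`, so
    -- exchanging them makes the sets agree at this star.
    obtain ⟨σ, hσ⟩ := exists_swap_leaves hvs hl
    have hmem : ∀ x, x ≠ v → x ≠ l → (x ∈ σ '' A ↔ x ∈ A) := by
      intro x h1 h2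
      have hx : σ x = x := by rw [hσ, Equiv.swap_apply_of_ne_of_ne h1 h2]
      constructor
      · rintro ⟨y, hy, hyx⟩
        have : y = x := σ.injective (hyx.trans hx.symm)
        exact this ▸ hy
      · exact fun h => ⟨x, h, hx⟩
    have hvσ : v ∉ σ '' A := by
      rintro ⟨y, hy, hyv⟩
      have : σ l = v := by rw [hσ, Equiv.swap_apply_right]
      exact hlA (σ.injective (hyv.trans this.symm) ▸ hy)
    have hlt : (σ '' A \ B).ncard < k := by
      rw [← hk]
      refine Set.ncard_lt_ncard ⟨fun x hx => ?_, fun hsub => ?_⟩ (Set.toFinite _)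
      · have h1 : x ≠ v := fun e => hvσ (e ▸ hx.1)
        have h2 : x ≠ l := fun e => hx.2 (e ▸ hmB' l hl hlv)
        exact ⟨(hmem x h1 h2).1 hx.1, hx.2⟩
      · exact hvσ (hsub ⟨hvA, hvB⟩).1
    obtain ⟨ψ, hψ⟩ := ih _ hlt (hA.image σ) (fun x hx => by
      rw [hmem x (fun e => hx (e ▸ ⟨s, hvs, hs⟩)) (fun e => hx (e ▸ ⟨s, hl, hs⟩)), hagree x hx]) rfl
    refine ⟨σ.trans ψ, ?_⟩
    rw [← hψ, Set.image_image]
    rfl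

/-- The normalizing automorphisms fix everything but leaves at stars. Hence the statements about
ends hold for the original sets on all paths without such leaves, and at each star exactly one leaf
is missing. Flips match the former, leaf exchanges the latter. -/
theorem isoUnique_of_checks [Finite V] (hT : T.IsAcyclic) {removed : List V}
    (hr : IsPruning T removed) {P : List (List {v // v ∉ removed})}
    (hP : IsMinPathCover (pruned T removed) P) (hint : IsInteriorCover (pruned T removed) P)
    (hcheck : ∀ p ∈ coverInT removed P, PathCheck T p) : IsIsoUniqueZeroForcing T := by
  classical
  have hT' := isAcyclic_pruned hT removed
  obtain ⟨h1, h2⟩ := (isPathCover_iff hT').1 hP.1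
  have h3 := isPathSystem_coverInT hr.nodup h1
  have hfixed : ∀ {σ : T ≃g T}, (∀ v, ¬ StarLeaf T v → σ v = v) → ∀ (C : Set V) v,
      ¬ StarLeaf T v → (v ∈ σ '' C ↔ v ∈ C) := by
    intro σ hσ C v hv
    constructor
    · rintro ⟨y, hy, hyv⟩
      have : y = v := σ.injective (hyv.trans (hσ v hv).symm)
      exact this ▸ hy
    · exact fun h => ⟨v, h, hσ v hv⟩
  have hone : ∀ C, IsMinZeroForcingSet T C → ∀ p ∈ coverInT removed P,
      (∀ v ∈ p, ¬ StarLeaf T v) → OneEnd C p := by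
    intro C hC p hp hst
    obtain ⟨σ, hσ, -, h4, -⟩ := exists_normalize_zeroForcing hT hr hP hint hC
    obtain ⟨v, hv, hv', hvu⟩ := h4 p hp
    refine ⟨v, (hfixed hσ C v (hst v hv'.mem)).1 hv, hv', fun w hw hw' => hvu w ?_ hw'⟩
    exact (hfixed hσ C w (hst w hw'.mem)).2 hw
  have hstar : ∀ C, IsMinZeroForcingSet T C → ∀ s, 2 < (leavesAt T s).ncard →
      ∃ l ∈ leavesAt T s, l ∉ C ∧ ∀ l' ∈ leavesAt T s, l' ≠ l → l' ∈ C := by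
    intro C hC s hs
    obtain ⟨σ, hσ, hrem, h4, -⟩ := exists_normalize_zeroForcing hT hr hP hint hC
    have hσs := hσ s (not_starLeaf_of_star hs)
    have hleaf : ∀ x, σ x ∈ leavesAt T s ↔ x ∈ leavesAt T s := by
      intro x
      have e1 : T.Adj s (σ x) ↔ T.Adj s x := by
        conv_lhs => rw [← hσs]
        exact σ.map_adj_iff
      exact and_congr e1 (by rw [ncard_neighborSet_apply])
    obtain ⟨l, hl, hlC, hlu⟩ : ∃ l ∈ leavesAt T s, l ∉ σ '' C ∧
        ∀ l' ∈ leavesAt T s, l' ≠ l → l' ∈ σ '' C := by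
      obtain ⟨l₁, l₂, hne, hl, p, hp, hend⟩ := star_path hT hr hP hint hs
      have hkept : ∀ l' ∈ leavesAt T s, l' ∉ σ '' C → l' = l₁ ∨ l' = l₂ := by
        intro l' hl' hl'C
        have : l' ∈ leavesAt T s \ {u | u ∈ removed} := ⟨hl', fun h => hl'C (hrem l' h)⟩
        rw [hl] at this
        exact this
      have hm1 : l₁ ∈ leavesAt T s \ {u | u ∈ removed} := hl ▸ Or.inl rfl
      have hm2 : l₂ ∈ leavesAt T s \ {u | u ∈ removed} := hl ▸ Or.inr rfl
      obtain ⟨v, hv, hv', hvu⟩ := h4 p hp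
      have hx : ∃ l, (l = l₁ ∨ l = l₂) ∧ l ∉ σ '' C ∧ ∀ l', (l' = l₁ ∨ l' = l₂) → l' ≠ l →
          l' ∈ σ '' C := by
        rcases (hend v).1 hv' with rfl | rfl
        · refine ⟨l₂, Or.inr rfl, fun h => hne (hvu l₂ h ((hend l₂).2 (Or.inr rfl))).symm, ?_⟩
          rintro l' (rfl | rfl) h
          · exact hv
          · exact absurd rfl h
        · refine ⟨l₁, Or.inl rfl, fun h => hne (hvu l₁ h ((hend l₁).2 (Or.inl rfl))), ?_⟩
          rintro l' (rfl | rfl) h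
          · exact absurd rfl h
          · exact hv
      obtain ⟨l, hl', hlC, hlu⟩ := hx
      refine ⟨l, ?_, hlC, fun l' hl'' hne' => ?_⟩
      · rcases hl' with rfl | rfl
        · exact hm1.1
        · exact hm2.1
      · by_contra hc
        exact hc (hlu l' (hkept l' hl'' hc) hne')
    refine ⟨σ.symm l, (hleaf _).1 (by simpa using hl), fun h => hlC ⟨_, h, by simp⟩,
      fun l' hl' hne => ?_⟩
    obtain ⟨y, hy, hyl⟩ := hlu (σ l') ((hleaf l').2 hl') (fun e => hne (by simp [← e]))
    exact σ.injective hyl ▸ hy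
  have hends : ∀ C, IsMinZeroForcingSet T C → ∀ v ∈ C, ¬ StarLeaf T v →
      ∃ p ∈ coverInT removed P, IsEnd p v ∧ ∀ w ∈ p, ¬ StarLeaf T w := by
    intro C hC v hv hvs
    obtain ⟨σ, hσ, -, -, h4⟩ := exists_normalize_zeroForcing hT hr hP hint hC
    obtain ⟨p, hp, hvp⟩ := h4 v ((hfixed hσ C v hvs).2 hv)
    -- A path that contains a leaf at a star has only such leaves as ends, so it cannot end in `v`.
    refine ⟨p, hp, hvp, fun w hw hws => ?_⟩
    obtain ⟨s, hws, hs⟩ := hws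
    obtain ⟨l₁, l₂, hne, hl, q, hq, hend⟩ := star_path hT hr hP hint hs
    have hm1 : l₁ ∈ leavesAt T s \ {u | u ∈ removed} := hl ▸ Or.inl rfl
    have hm2 : l₂ ∈ leavesAt T s \ {u | u ∈ removed} := hl ▸ Or.inr rfl
    by_cases hwr : w ∈ removed
    · have hw1 : [w] ∈ coverInT removed P :=
        List.mem_append.2 (Or.inr (List.mem_map.2 ⟨w, hwr, rfl⟩))
      obtain rfl := h3.eq_of_mem hp hw1 hw (by simp)
      exact hvs (List.mem_singleton.1 hvp.mem ▸ ⟨s, hws, hs⟩)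
    · have hwl : w = l₁ ∨ w = l₂ := by
        have : w ∈ leavesAt T s \ {u | u ∈ removed} := ⟨hws, hwr⟩
        rwa [hl] at this
      obtain rfl := h3.eq_of_mem hp hq hw ((hend w).2 hwl).mem
      rcases (hend v).1 hvp with rfl | rfl
      · exact hvs ⟨s, hm1.1, hs⟩
      · exact hvs ⟨s, hm2.1, hs⟩
  intro A B hA hB
  let F : Finset (List V) := (coverInT removed P).toFinset.filter fun p =>
    (∀ v ∈ p, ¬ StarLeaf T v) ∧ 2 ≤ p.length
  obtain ⟨ψ, hψ⟩ := exists_agree_on_ends hT h3 hcheck hone hB hA F (fun p hp => by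
    simpa [F] using hp)
  have hA1 := hA.image ψ
  have hagree : ∀ p ∈ coverInT removed P, (∀ w ∈ p, ¬ StarLeaf T w) → ∀ v, IsEnd p v →
      (v ∈ ψ '' A ↔ v ∈ B) := by
    intro p hp hst v hv
    by_cases h2 : 2 ≤ p.length
    · exact hψ p (by simp only [F, Finset.mem_filter, List.mem_toFinset]; exact ⟨hp, hst, h2⟩) v hv
    · have hpos := List.length_pos_iff.2 (h3.isPathList p hp).ne_nil
      obtain ⟨x, rfl⟩ := List.length_eq_one_iff.1 (show p.length = 1 by omega)
      obtain ⟨a, ha, ha', -⟩ := hone _ hA1 _ hp hst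
      obtain ⟨b, hb, hb', -⟩ := hone _ hB _ hp hst
      rw [List.mem_singleton.1 ha'.mem] at ha
      rw [List.mem_singleton.1 hb'.mem] at hb
      rw [List.mem_singleton.1 hv.mem]
      exact ⟨fun _ => hb, fun _ => ha⟩
  obtain ⟨θ, hθ⟩ := exists_iso_of_agree hB hstar hA1 (fun v hv => by
    constructor
    · intro h
      obtain ⟨p, hp, hvp, hst⟩ := hends _ hA1 v h hv
      exact (hagree p hp hst v hvp).1 h
    · intro h
      obtain ⟨p, hp, hvp, hst⟩ := hends _ hB v h hv
      exact (hagree p hp hst v hvp).2 h)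
  refine ⟨ψ.trans θ, ?_⟩
  rw [← hθ, Set.image_image]
  rfl

/-- The answer of every run of the algorithm is correct. -/
theorem Run.IsRunOn.answer_iff [Finite V] (hT : T.IsAcyclic) {r : Run V} (hr : r.IsRunOn T) :
    r.answer = true ↔ IsIsoUniqueZeroForcing T := by
  constructor
  · intro h
    have hi : r.interior = true := by
      by_contra hc
      have := (hr.not_interior (by simpa using hc)).2
      rw [h] at this
      exact Bool.noConfusion this
    obtain ⟨h1, h2⟩ := hr.when_interior hi
    rw [h] at h2
    have h3 := List.all_eq_true.1 h2.symm
    refine isoUnique_of_checks hT hr.prune hr.minCover (hr.interior_iff.1 hi) fun p hp => ?_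
    obtain ⟨i, hi, rfl⟩ := List.getElem_of_mem hp
    have hlen := h1.length_eq
    have h4 := (List.forall₂_iff_get.1 h1).2 i hi (hlen ▸ hi)
    exact h4.1 (h3 _ (List.getElem_mem _))
  · intro h
    have hi := hr.interior_iff.2 (isInteriorCover_of_isoUnique hT h hr.prune hr.minCover)
    obtain ⟨h1, h2⟩ := hr.when_interior hi
    rw [h2, List.all_eq_true]
    intro b hb
    obtain ⟨i, hi, rfl⟩ := List.getElem_of_mem hb
    have hlen := h1.length_eq
    have h4 := (List.forall₂_iff_get.1 h1).2 i (hlen ▸ hi) hi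
    exact h4.2 (pathCheck_of_isoUnique hT h (isMinPathCover_coverInT hT hr.prune hr.minCover)
      (List.get_mem _ _))

end Sufficiency


/-! ### Equitable colourings of forests and automorphisms -/

section Equitable

variable {V α : Type*} {T : SimpleGraph V}

/-- Vertices of the same colour have the same number of neighbours of each colour. -/
def IsEquitable (T : SimpleGraph V) (f : V → α) : Prop :=
  ∀ v w, f v = f w → ∀ c, {u | T.Adj v u ∧ f u = c}.ncard = {u | T.Adj w u ∧ f u = c}.ncard

/-- Used to contradict that an edge is a bridge: a walk inside `S`, or its image under `g`, would
bypass it. -/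
theorem reachable_map_deleteEdges {S : Set V} {g : V → V} {e : Sym2 V} {a b : V}
    (hg : ∀ a ∈ S, ∀ b ∈ S, T.Adj a b → T.Adj (g a) (g b))
    (he : ∀ a ∈ S, ∀ b ∈ S, T.Adj a b → s(g a, g b) ≠ e)
    (h : Relation.ReflTransGen (fun a b => T.Adj a b ∧ a ∈ S ∧ b ∈ S) a b) :
    (T.deleteEdges {e}).Reachable (g a) (g b) := by
  induction h with
  | refl => exact Reachable.refl _
  | @tail c d _ hcd ih =>
    refine ih.trans (Adj.reachable ?_)
    simp only [deleteEdges_adj, Set.mem_singleton_iff]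
    exact ⟨hg c hcd.2.1 d hcd.2.2 hcd.1, he c hcd.2.1 d hcd.2.2 hcd.1⟩

/-- The inverse of a permutation of a finite set is one of its powers, so it preserves edges as
well. -/
theorem exists_iso_of_injective_hom [Finite V] {g : V → V} (hinj : Function.Injective g)
    (hg : ∀ a b, T.Adj a b → T.Adj (g a) (g b)) : ∃ φ : T ≃g T, ∀ v, φ v = g v := by
  let e : Equiv.Perm V := Equiv.ofBijective g (Finite.injective_iff_bijective.1 hinj)
  have hpow : ∀ (k : ℕ) a b, T.Adj a b → T.Adj ((e ^ k) a) ((e ^ k) b) := by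
    intro k
    induction k with
    | zero => exact fun a b h => h
    | succ k ih =>
      intro a b h
      rw [pow_succ]
      exact ih _ _ (hg a b h)
  refine ⟨⟨e, fun {a b} => ⟨fun h => ?_, hg a b⟩⟩, fun v => rfl⟩
  have hpos := orderOf_pos e
  have h1 : ∀ v, (e ^ (orderOf e - 1)) (e v) = v := by
    intro v
    have : (e ^ (orderOf e - 1)) * e = 1 := by
      rw [← pow_succ, Nat.sub_add_cancel hpos, pow_orderOf_eq_one]
    exact congrArg (fun f : Equiv.Perm V => f v) this
  have := hpow (orderOf e - 1) _ _ h
  rwa [h1, h1] at this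

/-- A colour-preserving embedding of a connected set `S` is enlarged vertex by vertex. If `v` is
outside `S` and adjacent to `u` in `S`, equitability supplies an unused neighbour `w` of `g u` with
the colour of `v`. Acyclicity ensures that `w` is not yet an image and that `u` is the only
neighbour of `v` in `S`. Once `S` is closed it is the component of `x`; it is mapped into itself
because `y` lies in it, and the identity extends the map. -/
theorem exists_extension [Finite V] (hT : T.IsAcyclic) {f : V → α} (hf : IsEquitable T f) {x y : V}
    {S : Set V} {g : V → V} (hx : x ∈ S)
    (hconn : ∀ v ∈ S, Relation.ReflTransGen (fun a b => T.Adj a b ∧ a ∈ S ∧ b ∈ S) x v)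
    (hinj : Set.InjOn g S) (hcol : ∀ v ∈ S, f (g v) = f v)
    (hg : ∀ a ∈ S, ∀ b ∈ S, T.Adj a b → T.Adj (g a) (g b)) (hgx : g x = y)
    (hxy : T.Reachable x y) :
    ∃ φ : T ≃g T, φ x = y := by
  classical
  generalize hk : Sᶜ.ncard = k
  induction k using Nat.strong_induction_on generalizing S g with
  | _ k ih =>
  have hsymm : ∀ {a b}, Relation.ReflTransGen (fun a b => T.Adj a b ∧ a ∈ S ∧ b ∈ S) a b →
      Relation.ReflTransGen (fun a b => T.Adj a b ∧ a ∈ S ∧ b ∈ S) b a := fun {a b} h =>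
    have : Std.Symm (fun a b => T.Adj a b ∧ a ∈ S ∧ b ∈ S) :=
      ⟨fun _ _ h => ⟨h.1.symm, h.2.2, h.2.1⟩⟩
    Relation.ReflTransGen.stdSymm.symm _ _ h
  by_cases hclosed : ∀ u ∈ S, ∀ v, T.Adj u v → v ∈ S
  · have hmem : ∀ v, T.Reachable x v → v ∈ S := fun v h =>
      Reachable.mem_of_closed h hx fun a b ha hab => hclosed a ha b hab
    have hmap : ∀ v ∈ S, T.Reachable y (g v) := by
      intro v hv
      have := hconn v hv
      clear hv
      induction this with
      | refl => rw [hgx]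
      | tail _ h ih => exact ih.trans (hg _ h.2.1 _ h.2.2 h.1).reachable
    have hgS : ∀ v ∈ S, g v ∈ S := fun v hv => hmem _ (hxy.trans (hmap v hv))
    obtain ⟨φ, hφ⟩ := exists_iso_of_injective_hom (T := T) (g := fun v => if v ∈ S then g v else v)
      (by
        intro a b hab
        by_cases ha : a ∈ S <;> by_cases hb : b ∈ S <;> simp only [ha, hb, if_true, if_false] at hab
        · exact hinj ha hb hab
        · exact absurd (hab ▸ hgS a ha) hb
        · exact absurd (hab ▸ hgS b hb) ha
        · exact hab)
      (by
        intro a b hab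
        by_cases ha : a ∈ S <;> by_cases hb : b ∈ S <;> simp only [ha, hb, if_true, if_false]
        · exact hg a ha b hb hab
        · exact absurd (hclosed a ha b hab) hb
        · exact absurd (hclosed b hb a hab.symm) ha
        · exact hab)
    exact ⟨φ, by rw [hφ, if_pos hx, hgx]⟩
  · push Not at hclosed
    obtain ⟨u, hu, v, huv, hv⟩ := hclosed
    obtain ⟨w, hw, hwv, hwn⟩ : ∃ w, T.Adj (g u) w ∧ f w = f v ∧ ∀ z ∈ S, T.Adj u z → g z ≠ w := by
      -- Otherwise all neighbours of `g u` with the colour of `v` are images of neighbours of `u` in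
      -- `S`. There are fewer of the latter than neighbours of `u` with this colour, because `v` is
      -- missing.
      by_contra! hcon
      have hlt : {z | (T.Adj u z ∧ f z = f v) ∧ z ∈ S}.ncard < {z | T.Adj u z ∧ f z = f v}.ncard :=
        Set.ncard_lt_ncard ⟨fun z hz => hz.1, fun h => hv (h ⟨huv, rfl⟩).2⟩ (Set.toFinite _)
      have hle : {z | T.Adj (g u) z ∧ f z = f v}.ncard ≤
          (g '' {z | (T.Adj u z ∧ f z = f v) ∧ z ∈ S}).ncard := by
        refine Set.ncard_le_ncard (fun w hw => ?_) (Set.toFinite _)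
        obtain ⟨z, hz, huz, rfl⟩ := hcon w hw.1 hw.2
        exact ⟨z, ⟨⟨huz, (hcol z hz).symm.trans hw.2⟩, hz⟩, rfl⟩
      have := Set.ncard_image_le (f := g) (Set.toFinite {z | (T.Adj u z ∧ f z = f v) ∧ z ∈ S})
      have := hf (g u) u (hcol u hu) (f v)
      omega
    have hwS : ∀ z ∈ S, g z ≠ w := by
      rintro z hz rfl
      have hzu : ¬ T.Adj u z := fun h => hwn z hz h rfl
      -- A walk from `u` to `z` inside `S` is mapped to a walk that avoids the edge from `g u` to `g
      -- z`, since `u` and `z` are not adjacent; but that edge is a bridge.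
      refine not_reachable_deleteEdges hT hw (reachable_map_deleteEdges hg ?_
        ((hsymm (hconn u hu)).trans (hconn z hz)))
      intro a ha b hb hab e
      rcases Sym2.eq_iff.1 e with ⟨h1, h2⟩ | ⟨h1, h2⟩
      · exact hzu (hinj ha hu h1 ▸ hinj hb hz h2 ▸ hab)
      · exact hzu (hinj hb hu h2 ▸ hinj ha hz h1 ▸ hab.symm)
    have hvu : ∀ z ∈ S, T.Adj z v → z = u := by
      intro z hz hzv
      by_contra hne
      have h1 := reachable_map_deleteEdges (T := T) (S := S) (g := id) (e := s(u, v))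
        (fun _ _ _ _ h => h) (fun a ha b hb _ e => by
          rcases Sym2.eq_iff.1 e with ⟨-, h2⟩ | ⟨h1, -⟩
          · exact hv (h2 ▸ hb)
          · exact hv (h1 ▸ ha)) ((hsymm (hconn u hu)).trans (hconn z hz))
      refine not_reachable_deleteEdges hT huv (h1.trans (Adj.reachable ?_))
      simp only [deleteEdges_adj, Set.mem_singleton_iff, id]
      refine ⟨hzv, fun e => ?_⟩
      rcases Sym2.eq_iff.1 e with ⟨h1, -⟩ | ⟨h1, -⟩
      · exact hne h1
      · exact hv (h1 ▸ hz)
    have hne : ∀ z ∈ S, z ≠ v := fun z hz e => hv (e ▸ hz)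
    have hgS : ∀ z ∈ S, Function.update g v w z = g z := fun z hz =>
      Function.update_of_ne (hne z hz) _ _
    refine ih (insert v S)ᶜ.ncard ?_ (S := insert v S) (g := Function.update g v w)
      (Set.mem_insert_of_mem _ hx) ?_ ?_ ?_ ?_ ?_ rfl
    · rw [← hk]
      refine Set.ncard_lt_ncard ⟨fun z hz hzS => hz (Set.mem_insert_of_mem _ hzS), fun h => ?_⟩
        (Set.toFinite _)
      exact h hv (Set.mem_insert _ _)
    · have hmono : ∀ z ∈ S, Relation.ReflTransGen
          (fun a b => T.Adj a b ∧ a ∈ insert v S ∧ b ∈ insert v S) x z := fun z hz =>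
        Relation.ReflTransGen.mono (fun a b h =>
          ⟨h.1, Set.mem_insert_of_mem _ h.2.1, Set.mem_insert_of_mem _ h.2.2⟩) _ _ (hconn z hz)
      rintro z (rfl | hz)
      · exact (hmono u hu).tail ⟨huv, Set.mem_insert_of_mem _ hu, Set.mem_insert _ _⟩
      · exact hmono z hz
    · rintro a (rfl | ha) b (rfl | hb) hab
      · rfl
      · rw [hgS b hb, Function.update_self] at hab
        exact absurd hab.symm (hwS b hb)
      · rw [hgS a ha, Function.update_self] at hab
        exact absurd hab (hwS a ha)
      · rw [hgS a ha, hgS b hb] at hab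
        exact hinj ha hb hab
    · rintro z (rfl | hz)
      · rw [Function.update_self, hwv]
      · rw [hgS z hz, hcol z hz]
    · rintro a (rfl | ha) b (rfl | hb) hab
      · exact absurd hab (T.irrefl)
      · rw [hgS b hb, Function.update_self]
        rw [hvu b hb hab.symm]
        exact hw.symm
      · rw [hgS a ha, Function.update_self, hvu a ha hab]
        exact hw
      · rw [hgS a ha, hgS b hb]
        exact hg a ha b hb hab
    · rw [hgS x hx, hgx]

/-- Two vertices of the same component of a forest that have the same colour in an equitable
colouring are exchanged by an automorphism. -/
theorem IsEquitable.exists_iso [Finite V] {f : V → α} (hf : IsEquitable T f) (hT : T.IsAcyclic)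
    {x y : V} (hxy : T.Reachable x y) (h : f x = f y) : ∃ φ : T ≃g T, φ x = y :=
  exists_extension hT hf (S := {x}) (g := fun _ => y) rfl
    (by rintro v rfl; exact Relation.ReflTransGen.refl)
    (by rintro a rfl b rfl _; rfl) (by rintro v rfl; exact h.symm)
    (by rintro a rfl b rfl hab; exact absurd hab (T.irrefl)) rfl hxy

end Equitable


/-! ### A program logic for the machine, with step counts -/

section Verification

def State.setReg (s : State) (x k : ℕ) : State := { s with reg := Function.update s.reg x k }

def State.setArr (s : State) (a i k : ℕ) : State :=
  { s with arr := Function.update s.arr a (Function.update (s.arr a) i k) }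

def State.put (s : State) (k : ℕ) : State := { s with out := s.out ++ [k] }

@[simp] theorem State.setReg_reg (s : State) (x k y : ℕ) :
    (s.setReg x k).reg y = if y = x then k else s.reg y := Function.update_apply _ _ _ _
@[simp] theorem State.setReg_arr (s : State) (x k : ℕ) : (s.setReg x k).arr = s.arr := rfl
@[simp] theorem State.setReg_out (s : State) (x k : ℕ) : (s.setReg x k).out = s.out := rfl
@[simp] theorem State.setArr_reg (s : State) (a i k : ℕ) : (s.setArr a i k).reg = s.reg := rfl
@[simp] theorem State.setArr_out (s : State) (a i k : ℕ) : (s.setArr a i k).out = s.out := rfl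
@[simp] theorem State.setArr_arr (s : State) (a i k b : ℕ) : (s.setArr a i k).arr b =
    if b = a then Function.update (s.arr a) i k else s.arr b := Function.update_apply _ _ _ _
@[simp] theorem State.put_reg (s : State) (k : ℕ) : (s.put k).reg = s.reg := rfl
@[simp] theorem State.put_arr (s : State) (k : ℕ) : (s.put k).arr = s.arr := rfl
@[simp] theorem State.put_out (s : State) (k : ℕ) : (s.put k).out = s.out ++ [k] := rfl

attribute [simp] RamExpr.eval RamExpr.cost

def Program.writesReg : Program → ℕ → Bool
  | .set x _, y => x == y
  | .seq c d, y => c.writesReg y || d.writesReg y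
  | .cond _ c d, y => c.writesReg y || d.writesReg y
  | .loop _ c, y => c.writesReg y
  | _, _ => false

def Program.writesArr : Program → ℕ → Bool
  | .store a _ _, b => a == b
  | .seq c d, b => c.writesArr b || d.writesArr b
  | .cond _ c d, b => c.writesArr b || d.writesArr b
  | .loop _ c, b => c.writesArr b
  | _, _ => false

def Program.writesOut : Program → Bool
  | .write _ => true
  | .seq c d => c.writesOut || d.writesOut
  | .cond _ c d => c.writesOut || d.writesOut
  | .loop _ c => c.writesOut
  | _ => false

/-- What `c` does not write is the same in both states. -/
structure Frame (c : Program) (s s' : State) : Prop where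
  reg : ∀ x, c.writesReg x = false → s'.reg x = s.reg x
  arr : ∀ a, c.writesArr a = false → s'.arr a = s.arr a
  out : c.writesOut = false → s'.out = s.out

theorem Frame.refl (c : Program) (s : State) : Frame c s s :=
  ⟨fun _ _ => rfl, fun _ _ => rfl, fun _ => rfl⟩

theorem Frame.trans {c : Program} {s s' s'' : State} (h : Frame c s s') (h' : Frame c s' s'') :
    Frame c s s'' :=
  ⟨fun x hx => (h'.reg x hx).trans (h.reg x hx), fun x hx => (h'.arr x hx).trans (h.arr x hx),
    fun hx => (h'.out hx).trans (h.out hx)⟩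

theorem Frame.mono {c d : Program} {s s' : State} (h : Frame c s s')
    (h1 : ∀ x, d.writesReg x = false → c.writesReg x = false)
    (h2 : ∀ x, d.writesArr x = false → c.writesArr x = false)
    (h3 : d.writesOut = false → c.writesOut = false) : Frame d s s' :=
  ⟨fun x hx => h.reg x (h1 x hx), fun x hx => h.arr x (h2 x hx), fun hx => h.out (h3 hx)⟩

theorem Exec.frame {c : Program} {s s' : State} {t : ℕ} (h : Exec c s t s') : Frame c s s' := by
  induction h with
  | skip | loop_done => exact Frame.refl _ _
  | set x e s =>
    refine ⟨fun y hy => Function.update_of_ne ?_ _ _, fun _ _ => rfl, fun _ => rfl⟩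
    rintro rfl
    simp [Program.writesReg] at hy
  | store a i e s =>
    refine ⟨fun _ _ => rfl, fun y hy => Function.update_of_ne ?_ _ _, fun _ => rfl⟩
    rintro rfl
    simp [Program.writesArr] at hy
  | write e s => exact ⟨fun _ _ => rfl, fun _ _ => rfl, fun h => by simp [Program.writesOut] at h⟩
  | seq _ _ ih1 ih2 =>
    refine (ih1.mono ?_ ?_ ?_).trans (ih2.mono ?_ ?_ ?_) <;>
      simp +contextual [Program.writesReg, Program.writesArr, Program.writesOut]
  | cond_true _ _ ih | cond_false _ _ ih =>
    refine ih.mono ?_ ?_ ?_ <;>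
      simp +contextual [Program.writesReg, Program.writesArr, Program.writesOut]
  | loop_step _ _ _ ih1 ih2 =>
    refine (ih1.mono ?_ ?_ ?_).trans ih2 <;>
      simp +contextual [Program.writesReg, Program.writesArr, Program.writesOut]

/-- Started in the state `s`, the program halts after a number of steps and in a state that
satisfy `Q`. -/
def WP (c : Program) (s : State) (Q : ℕ → State → Prop) : Prop :=
  ∃ t s', Exec c s t s' ∧ Q t s'

/-- The continuation also receives the frame, so specifications need not list what a program leaves
unchanged. -/
theorem WP.mono {c : Program} {s : State} {Q Q' : ℕ → State → Prop} (h : WP c s Q)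
    (hQ : ∀ t s', Frame c s s' → Q t s' → Q' t s') : WP c s Q' := by
  obtain ⟨t, s', h1, h2⟩ := h
  exact ⟨t, s', h1, hQ t s' h1.frame h2⟩

theorem wp_skip {s : State} {Q : ℕ → State → Prop} (h : Q 1 s) : WP .skip s Q :=
  ⟨_, _, Exec.skip s, h⟩

theorem wp_set {x : ℕ} {e : RamExpr} {s : State} {Q : ℕ → State → Prop}
    (h : Q (e.cost + 1) (s.setReg x (e.eval s))) : WP (.set x e) s Q :=
  ⟨_, _, Exec.set x e s, h⟩

theorem wp_store {a : ℕ} {i e : RamExpr} {s : State} {Q : ℕ → State → Prop}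
    (h : Q (i.cost + e.cost + 1) (s.setArr a (i.eval s) (e.eval s))) : WP (.store a i e) s Q :=
  ⟨_, _, Exec.store a i e s, h⟩

theorem wp_write {e : RamExpr} {s : State} {Q : ℕ → State → Prop}
    (h : Q (e.cost + 1) (s.put (e.eval s))) : WP (.write e) s Q :=
  ⟨_, _, Exec.write e s, h⟩

theorem wp_seq {c d : Program} {s : State} {Q : ℕ → State → Prop}
    (h : WP c s fun t s' => WP d s' fun t' s'' => Q (t + t') s'') : WP (.seq c d) s Q := by
  obtain ⟨t, s', h1, t', s'', h2, h3⟩ := h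
  exact ⟨_, _, Exec.seq h1 h2, h3⟩

theorem wp_cond {e : RamExpr} {c d : Program} {s : State} {Q : ℕ → State → Prop}
    (h1 : e.eval s ≠ 0 → WP c s fun t s' => Q (e.cost + 1 + t) s')
    (h2 : e.eval s = 0 → WP d s fun t s' => Q (e.cost + 1 + t) s') : WP (.cond e c d) s Q := by
  by_cases h : e.eval s = 0
  · obtain ⟨t, s', h3, h4⟩ := h2 h
    exact ⟨_, _, Exec.cond_false h h3, h4⟩
  · obtain ⟨t, s', h3, h4⟩ := h1 h
    exact ⟨_, _, Exec.cond_true h h3, h4⟩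

/-- The loop rule: `Inv t s` holds before each test, where `t` counts the steps made so far, and
`m` is a measure that decreases. -/
theorem wp_loop {e : RamExpr} {c : Program} {s : State} {Q : ℕ → State → Prop}
    (Inv : ℕ → State → Prop) (m : State → ℕ) (h0 : Inv 0 s)
    (hstep : ∀ t s1, Frame c s s1 → Inv t s1 → e.eval s1 ≠ 0 → WP c s1 fun t' s2 =>
      Inv (t + (e.cost + 1 + t')) s2 ∧ m s2 < m s1)
    (hend : ∀ t s1, Frame c s s1 → Inv t s1 → e.eval s1 = 0 → Q (t + (e.cost + 1)) s1) :
    WP (.loop e c) s Q := by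
  suffices H : ∀ k t s1, m s1 = k → Frame c s s1 → Inv t s1 →
      WP (.loop e c) s1 fun t' s2 => Q (t + t') s2 by
    simpa using H (m s) 0 s rfl (Frame.refl _ _) h0
  intro k
  induction k using Nat.strong_induction_on with
  | _ k ih =>
    intro t s1 hk hF hI
    by_cases h : e.eval s1 = 0
    · exact ⟨_, _, Exec.loop_done h, hend t s1 hF hI h⟩
    · obtain ⟨t', s2, h1, h2, h3⟩ := hstep t s1 hF hI h
      obtain ⟨t'', s3, h4, h5⟩ := ih (m s2) (hk ▸ h3) _ s2 rfl (hF.trans h1.frame) h2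
      refine ⟨_, _, Exec.loop_step h h1 h4, ?_⟩
      simpa only [Nat.add_assoc] using h5

def Program.forTo (x N : ℕ) (body : Program) : Program :=
  .seq (.set x (.lit 0)) (.loop (.lt (.reg x) (.reg N)) (.seq body (.set x (.succ (.reg x)))))

/-- A round costs 7 steps besides the body, 4 for the test and 3 for the increment; the initial
assignment and the last test cost 6. The time is an argument of the invariant, so that amortized
bounds can be carried through the loop. -/
theorem wp_forTo_time {x N : ℕ} {body : Program} {s : State} {Q : ℕ → State → Prop} {m : ℕ}
    (Inv : ℕ → ℕ → State → Prop) (hm : s.reg N = m) (hx : body.writesReg x = false)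
    (hN : (Program.forTo x N body).writesReg N = false)
    (h0 : Inv 0 0 (s.setReg x 0))
    (hstep : ∀ i t s1, i < m → Frame (.forTo x N body) s s1 → s1.reg x = i → Inv i t s1 →
      WP body s1 fun t' s2 => Inv (i + 1) (t + t' + 7) (s2.setReg x (i + 1)))
    (hend : ∀ t s1, Frame (.forTo x N body) s s1 → Inv m t s1 → Q (t + 6) s1) :
    WP (.forTo x N body) s Q := by
  have hF0 : Frame (.forTo x N body) s (s.setReg x 0) := by
    refine ⟨fun y hy => ?_, fun _ _ => rfl, fun _ => rfl⟩
    rw [State.setReg_reg, if_neg]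
    rintro rfl
    simp [Program.writesReg, Program.forTo] at hy
  have hF1 : ∀ {s1}, Frame (.seq body (.set x (.succ (.reg x)))) (s.setReg x 0) s1 →
      Frame (.forTo x N body) s s1 := fun h => hF0.trans (h.mono
        (by simp +contextual [Program.writesReg, Program.forTo])
        (by simp +contextual [Program.writesArr, Program.forTo])
        (by simp +contextual [Program.writesOut, Program.forTo]))
  refine wp_seq (wp_set (wp_loop (fun t s1 => s1.reg x ≤ m ∧ Inv (s1.reg x) t s1)
    (fun s1 => m - s1.reg x) (by simpa using h0) ?_ ?_))
  · rintro t s1 hF ⟨-, hI⟩ he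
    have hF' := hF1 hF
    have hlt : s1.reg x < m := by
      by_contra hc
      simp [hF'.reg N hN, hm] at he
      omega
    refine wp_seq ((hstep _ t s1 hlt hF' rfl hI).mono fun t' s2 hF2 h => wp_set ?_)
    have hx2 := hF2.reg x hx
    simp only [RamExpr.eval, RamExpr.cost, State.setReg_reg, if_true, hx2]
    refine ⟨⟨by omega, ?_⟩, by omega⟩
    convert h using 1
    omega
  · rintro t s1 hF ⟨hle, hI⟩ he
    have hF' := hF1 hF
    have hge : s1.reg x = m := by
      simp [hF'.reg N hN, hm] at he
      omega
    have := hend t s1 hF' (hge ▸ hI)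
    simp only [RamExpr.cost]
    convert this using 1
    omega

theorem wp_forTo {x N : ℕ} {body : Program} {s : State} {Q : ℕ → State → Prop} {m : ℕ}
    (Inv : ℕ → State → Prop) (k : ℕ) (hm : s.reg N = m) (hx : body.writesReg x = false)
    (hN : (Program.forTo x N body).writesReg N = false)
    (h0 : Inv 0 (s.setReg x 0))
    (hstep : ∀ i s1, i < m → Frame (.forTo x N body) s s1 → s1.reg x = i → Inv i s1 →
      WP body s1 fun t' s2 => t' ≤ k ∧ Inv (i + 1) (s2.setReg x (i + 1)))
    (hend : ∀ t s1, Frame (.forTo x N body) s s1 → Inv m s1 → t ≤ m * (k + 7) + 6 → Q t s1) :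
    WP (.forTo x N body) s Q := by
  refine wp_forTo_time (fun i t s1 => t ≤ i * (k + 7) ∧ Inv i s1) hm hx hN ⟨by simp, h0⟩ ?_ ?_
  · rintro i t s1 hi hF hx ⟨ht, hI⟩
    refine (hstep i s1 hi hF hx hI).mono fun t' s2 _ h => ⟨?_, h.2⟩
    rw [Nat.add_mul]
    omega
  · rintro t s1 hF ⟨ht, hI⟩
    exact hend _ s1 hF hI (by omega)

/-- The arrays `a` and `b` store the list `L` as their list with number `i`: array `a` holds the
positions where the lists begin in array `b`. -/
structure Stores {α : Type*} (f : α → ℕ) (a b : ℕ → ℕ) (i : ℕ) (L : List α) : Prop where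
  length : a (i + 1) = a i + L.length
  get : ∀ j (h : j < L.length), b (a i + j) = f L[j]

def Program.forList (a b v j u : ℕ) (body : Program) : Program :=
  .seq (.set j (.get a (.reg v)))
    (.loop (.lt (.reg j) (.get a (.succ (.reg v))))
      (.seq (.set u (.get b (.reg j))) (.seq body (.set j (.succ (.reg j))))))

/-- An entry costs 12 steps besides the body, 6 for the test and 3 each for fetching the entry and
advancing; initialization and the last test cost 9. Quantifying over the value written to `j` keeps
positions in the array out of the invariants, which speak of the list only. -/
theorem wp_forList {α : Type*} {f : α → ℕ} {L : List α} {a b v j u : ℕ} {body : Program}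
    {s : State} {Q : ℕ → State → Prop} (Inv : List α → State → Prop) (k : ℕ)
    (hL : Stores f (s.arr a) (s.arr b) (s.reg v) L)
    (hj : body.writesReg j = false) (huj : u ≠ j)
    (hv : (Program.forList a b v j u body).writesReg v = false)
    (ha : body.writesArr a = false) (hb : body.writesArr b = false)
    (h0 : ∀ y, Inv [] (s.setReg j y))
    (hstep : ∀ done x rest s1, L = done ++ x :: rest → Frame (.forList a b v j u body) s s1 →
      Inv done s1 → WP body (s1.setReg u (f x)) fun t' s2 =>
        t' ≤ k ∧ ∀ y, Inv (done ++ [x]) (s2.setReg j y))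
    (hend : ∀ t s1, Frame (.forList a b v j u body) s s1 → Inv L s1 →
      t ≤ L.length * (k + 12) + 9 → Q t s1) :
    WP (.forList a b v j u body) s Q := by
  have hF0 : ∀ y, Frame (.forList a b v j u body) s (s.setReg j y) := by
    refine fun y => ⟨fun z hz => ?_, fun _ _ => rfl, fun _ => rfl⟩
    rw [State.setReg_reg, if_neg]
    rintro rfl
    simp [Program.writesReg, Program.forList] at hz
  have hF1 : ∀ {s1 y}, Frame (.seq (.set u (.get b (.reg j))) (.seq body (.set j (.succ (.reg j)))))
      (s.setReg j y) s1 → Frame (.forList a b v j u body) s s1 := fun h => (hF0 _).trans (h.mono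
        (by simp +contextual [Program.writesReg, Program.forList])
        (by simp +contextual [Program.writesArr, Program.forList])
        (by simp +contextual [Program.writesOut, Program.forList]))
  have ha' : (Program.forList a b v j u body).writesArr a = false := by
    simp [Program.writesArr, Program.forList, ha]
  have hb' : (Program.forList a b v j u body).writesArr b = false := by
    simp [Program.writesArr, Program.forList, hb]
  refine wp_seq (wp_set (wp_loop (fun t s1 => ∃ i, i ≤ L.length ∧ t ≤ i * (k + 12) ∧
      s1.reg j = s.arr a (s.reg v) + i ∧ Inv (L.take i) s1)
    (fun s1 => s.arr a (s.reg v) + L.length - s1.reg j) ?_ ?_ ?_))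
  · exact ⟨0, by simp, by simp, by simp, by simpa using h0 _⟩
  · rintro t s1 hF ⟨i, hi, ht, hji, hI⟩ he
    have hF' := hF1 hF
    have hlt : i < L.length := by
      by_contra hc
      simp [hF'.reg v hv, hF'.arr a ha', hL.length, hji] at he
      omega
    have hx : s1.arr b (s1.reg j) = f L[i] := by rw [hF'.arr b hb', hji, hL.get i hlt]
    refine wp_seq (wp_set (wp_seq ?_))
    simp only [RamExpr.eval, hx]
    refine (hstep (L.take i) L[i] (L.drop (i + 1)) s1 (by simp) hF' hI).mono
      fun t' s2 hF2 h => wp_set ?_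
    have hj2 := hF2.reg j hj
    simp only [State.setReg_reg, huj.symm, if_false, hji] at hj2
    simp only [RamExpr.eval, RamExpr.cost, State.setReg_reg, if_true, hj2]
    refine ⟨⟨i + 1, hlt, ?_, by omega, ?_⟩, by omega⟩
    · rw [Nat.add_mul]
      omega
    · have := h.2 (s.arr a (s.reg v) + i + 1)
      rwa [List.take_append_getElem] at this
  · rintro t s1 hF ⟨i, hi, ht, hji, hI⟩ he
    have hF' := hF1 hF
    have hge : i = L.length := by
      simp [hF'.reg v hv, hF'.arr a ha', hL.length, hji] at he
      omega
    subst hge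
    rw [List.take_length] at hI
    refine hend _ s1 hF' hI ?_
    simp only [RamExpr.cost]
    omega

end Verification


/-! ### The number of edges of a forest -/

section EdgeBound

variable {V : Type*} {T : SimpleGraph V}

/-- Vertices with at most one neighbour in the remaining set are removed one after the other, each
taking at most one edge with it. -/
theorem ncard_edges_within_le [Finite V] (hT : T.IsAcyclic) (U : Set V) :
    {e | e ∈ T.edgeSet ∧ ∀ v ∈ e, v ∈ U}.ncard ≤ U.ncard := by
  generalize hk : U.ncard = k
  induction k generalizing U with
  | zero =>
    rw [Set.ncard_eq_zero] at hk
    subst hk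
    rw [Nat.le_zero, Set.ncard_eq_zero, Set.eq_empty_iff_forall_notMem]
    rintro ⟨a, b⟩ h
    exact h.2 a (Sym2.mem_mk_left a b)
  | succ k ih =>
    obtain ⟨v, hv, huniq⟩ := exists_atMostOne_neighbor hT (U := U)
      (by rw [← Set.ncard_pos]; omega)
    have h1 := ih (U \ {v}) (by rw [Set.ncard_sdiff_singleton_of_mem hv]; omega)
    have hsub : {e | e ∈ T.edgeSet ∧ ∀ x ∈ e, x ∈ U} ⊆
        {e | e ∈ T.edgeSet ∧ ∀ x ∈ e, x ∈ U \ {v}} ∪ {e | e ∈ T.edgeSet ∧ v ∈ e ∧ ∀ x ∈ e, x ∈ U} := by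
      rintro e ⟨h1, h2⟩
      by_cases hve : v ∈ e
      · exact Or.inr ⟨h1, hve, h2⟩
      · exact Or.inl ⟨h1, fun x hx => ⟨h2 x hx, fun h => hve (h ▸ hx)⟩⟩
    have h2 : {e | e ∈ T.edgeSet ∧ v ∈ e ∧ ∀ x ∈ e, x ∈ U}.ncard ≤ 1 := by
      rw [Set.ncard_le_one]
      rintro e ⟨h1, h2, h3⟩ e' ⟨h1', h2', h3'⟩
      obtain ⟨a, rfl⟩ := Sym2.mem_iff_exists.1 h2
      obtain ⟨b, rfl⟩ := Sym2.mem_iff_exists.1 h2'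
      rw [huniq a (h3 a (Sym2.mem_mk_right _ _)) b (h3' b (Sym2.mem_mk_right _ _)) h1 h1']
    have h3 := Set.ncard_le_ncard hsub (Set.toFinite _)
    have h4 := Set.ncard_union_le {e | e ∈ T.edgeSet ∧ ∀ x ∈ e, x ∈ U \ {v}}
      {e | e ∈ T.edgeSet ∧ v ∈ e ∧ ∀ x ∈ e, x ∈ U}
    omega

theorem sum_ncard_neighborSet_le [Fintype V] (hT : T.IsAcyclic) :
    ∑ v, (T.neighborSet v).ncard ≤ 2 * Fintype.card V := by
  classical
  have h1 := sum_edgeDegree (T := T) (N := T.edgeSet) subset_rfl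
  have h2 := ncard_edges_within_le hT Set.univ
  simp only [Set.mem_univ, implies_true, and_true, Set.ncard_univ, Set.ofPred_mem_eq,
    Nat.card_eq_fintype_card] at h2
  have h3 : ∀ v, edgeDegree T.edgeSet v = (T.neighborSet v).ncard := fun v => rfl
  simp only [h3] at h1
  omega

end EdgeBound

/-! ### The input in memory, and passes over all adjacency lists -/

section Input

variable {n : ℕ} {T : SimpleGraph (Fin n)} {adj : Fin n → List (Fin n)}

theorem IsAdjacencyList.length (h : IsAdjacencyList T adj) (v : Fin n) :
    (adj v).length = (T.neighborSet v).ncard := by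
  rw [← List.toFinset_card_of_nodup (h v).1, ← Set.ncard_coe_finset]
  congr 1
  ext w
  simp [(h v).2]

/-- The registers and arrays that hold the input. -/
structure HoldsInput (adj : Fin n → List (Fin n)) (s : State) : Prop where
  size : s.reg 0 = n
  stores : ∀ v : Fin n, Stores Fin.val (s.arr 0) (s.arr 1) v (adj v)
  sum_le : ∑ v, (adj v).length ≤ 2 * n

theorem HoldsInput.frame {s s' : State} {c : Program} (h : HoldsInput adj s) (hF : Frame c s s')
    (h1 : c.writesReg 0 = false) (h2 : c.writesArr 0 = false) (h3 : c.writesArr 1 = false) :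
    HoldsInput adj s' :=
  ⟨by rw [hF.reg 0 h1, h.size], by rw [hF.arr 0 h2, hF.arr 1 h3]; exact h.stores, h.sum_le⟩

theorem HoldsInput.setReg {s : State} (h : HoldsInput adj s) {x : ℕ} (k : ℕ) (hx : 0 ≠ x) :
    HoldsInput adj (s.setReg x k) := ⟨by simp [hx, h.size], h.stores, h.sum_le⟩

theorem HoldsInput.setArr {s : State} (h : HoldsInput adj s) {a : ℕ} (i k : ℕ) (h0 : 0 ≠ a)
    (h1 : 1 ≠ a) : HoldsInput adj (s.setArr a i k) :=
  ⟨h.size, by simpa [h0, h1] using h.stores, h.sum_le⟩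

theorem HoldsInput.length_eq {s : State} (h : HoldsInput adj s) (v : Fin n) :
    s.arr 0 (v + 1) - s.arr 0 v = (adj v).length := by
  rw [(h.stores v).length]
  omega

theorem offsets_getD (adj : Fin n → List (Fin n)) {i : ℕ} (hi : i ≤ n) :
    (offsets adj).getD i 0 = (((List.finRange n).take i).flatMap adj).length := by
  rw [offsets, List.getD_eq_getElem _ _ (by simp; omega)]
  simp

theorem holdsInput_initialState (hT : T.IsAcyclic) (h : IsAdjacencyList T adj) :
    HoldsInput adj (initialState adj) := by
  refine ⟨rfl, fun v => ?_, ?_⟩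
  · have hsplit : (List.finRange n).take (v + 1) = (List.finRange n).take v ++ [v] := by
      rw [List.take_succ_eq_append_getElem (by simp)]
      simp
    have hall : targets adj = ((((List.finRange n).take v).flatMap adj) ++ (adj v ++
        ((List.finRange n).drop (v + 1)).flatMap adj)).map Fin.val := by
      rw [targets]
      conv_lhs => rw [← List.take_append_drop (v + 1) (List.finRange n), hsplit]
      simp
    have h0 := offsets_getD adj v.2.le
    have h1 := offsets_getD adj (i := v + 1) v.2
    constructor
    · simp only [initialState, if_true, h0, h1, hsplit]
      simp
    · intro j hj
      simp only [initialState, if_true, h0, Nat.one_ne_zero, if_false]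
      rw [hall, List.getD_eq_getElem _ _ (by simp; omega), List.getElem_map,
        List.getElem_append_right (by omega)]
      simp [List.getElem_append_left hj]
  · have := sum_ncard_neighborSet_le hT
    simpa [h.length] using this

/-- The degrees sum to at most `2 * n`, so the rounds cost at most `(3 * K + 7) * n` in total;
adding 6 for entering and leaving the loop gives the stated bound. -/
theorem wp_forTo_sum {x N : ℕ} {body : Program} {s : State} {Q : ℕ → State → Prop}
    (hadj : HoldsInput adj s) (Inv : ℕ → State → Prop) (K : ℕ) (hN : s.reg N = n)
    (hx : body.writesReg x = false)
    (hN' : (Program.forTo x N body).writesReg N = false)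
    (h0 : Inv 0 (s.setReg x 0))
    (hstep : ∀ (v : Fin n) s1, Frame (.forTo x N body) s s1 → s1.reg x = v → Inv v s1 →
      WP body s1 fun t' s2 => t' ≤ K * ((adj v).length + 1) ∧ Inv (v + 1) (s2.setReg x (v + 1)))
    (hend : ∀ t s1, Frame (.forTo x N body) s s1 → Inv n s1 → t ≤ (3 * K + 13) * (n + 1) → Q t s1) :
    WP (.forTo x N body) s Q := by
  classical
  refine wp_forTo_time (fun i t s1 => t ≤ ∑ v with v.val < i, (K * ((adj v).length + 1) + 7) ∧
    Inv i s1) hN hx hN' ⟨by simp, h0⟩ ?_ ?_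
  · rintro i t s1 hi hF hx ⟨ht, hI⟩
    refine (hstep ⟨i, hi⟩ s1 hF hx hI).mono fun t' s2 _ h => ⟨?_, h.2⟩
    have : (Finset.univ.filter fun v : Fin n => v.val < i + 1) =
        insert ⟨i, hi⟩ (Finset.univ.filter fun v : Fin n => v.val < i) := by
      ext v
      simp only [Finset.mem_filter, Finset.mem_univ, true_and, Finset.mem_insert, Fin.ext_iff]
      omega
    rw [this, Finset.sum_insert (by simp)]
    have := h.1
    omega
  · rintro t s1 hF ⟨ht, hI⟩
    refine hend _ s1 hF hI ?_
    have : (Finset.univ.filter fun v : Fin n => v.val < n) = Finset.univ := by simp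
    rw [this, Finset.sum_add_distrib, ← Finset.mul_sum, Finset.sum_add_distrib] at ht
    simp only [Finset.sum_const, Finset.card_univ, Fintype.card_fin, smul_eq_mul, mul_one] at ht
    have := Nat.mul_le_mul_left K (Nat.add_le_add_right hadj.sum_le n)
    nlinarith

end Input


/-! ### Removal of superfluous leaves -/

section Prune

variable {n : ℕ} {T : SimpleGraph (Fin n)} {adj : Fin n → List (Fin n)}

/-- The leaves adjacent to `v`, in the order of the adjacency list. -/
def leafList (adj : Fin n → List (Fin n)) (v : Fin n) : List (Fin n) :=
  (adj v).filter fun u => (adj u).length = 1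

/-- The program removes all but the first two leaves of each adjacency list. -/
def Dead (adj : Fin n → List (Fin n)) (u : Fin n) : Prop :=
  ∃ v, u ∈ (leafList adj v).drop 2

open Classical in
noncomputable def deadList (adj : Fin n → List (Fin n)) : List (Fin n) :=
  (List.finRange n).filter fun u => Dead adj u

theorem mem_deadList {u : Fin n} : u ∈ deadList adj ↔ Dead adj u := by
  simp [deadList]

theorem IsAdjacencyList.mem_leafList (h : IsAdjacencyList T adj) {u v : Fin n} :
    u ∈ leafList adj v ↔ u ∈ leavesAt T v := by
  simp [leafList, leavesAt, (h v).2, h.length]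

theorem IsAdjacencyList.length_leafList (h : IsAdjacencyList T adj) (v : Fin n) :
    (leafList adj v).length = (leavesAt T v).ncard := by
  have hnd : (leafList adj v).Nodup := (h v).1.filter _
  rw [← List.toFinset_card_of_nodup hnd, ← Set.ncard_coe_finset]
  congr 1
  ext w
  simpa using h.mem_leafList

theorem IsAdjacencyList.isPruning (h : IsAdjacencyList T adj) : IsPruning T (deadList adj) := by
  classical
  refine ⟨(List.nodup_finRange n).filter _, fun u hu => ?_, fun v hv => ?_⟩
  · obtain ⟨v, hv⟩ := mem_deadList.1 hu
    refine ⟨v, h.mem_leafList.1 (List.mem_of_mem_drop hv), ?_⟩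
    have := List.length_pos_of_mem hv
    rw [← h.length_leafList]
    simp at this
    omega
  · have hsplit := List.take_append_drop 2 (leafList adj v)
    have hnd : ((leafList adj v).take 2 ++ (leafList adj v).drop 2).Nodup := by
      rw [hsplit]
      exact (h v).1.filter _
    have hset : leavesAt T v \ {u | u ∈ deadList adj} = ↑((leafList adj v).take 2).toFinset := by
      ext u
      simp only [Set.mem_sdiff, Set.mem_ofPred_eq, mem_deadList, List.coe_toFinset]
      constructor
      · rintro ⟨h1, h2⟩
        rw [← h.mem_leafList, ← hsplit, List.mem_append] at h1
        exact h1.resolve_right fun h3 => h2 ⟨v, h3⟩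
      · intro h1
        have h2 := h.mem_leafList.1 (List.mem_of_mem_take h1)
        refine ⟨h2, ?_⟩
        rintro ⟨w, hw⟩
        have h3 := h.mem_leafList.1 (List.mem_of_mem_drop hw)
        -- A leaf has one neighbour only and so occurs in a single leaf list. Hence a leaf among the
        -- first two at `v` is not removed on account of another vertex.
        have : w = v := by
          obtain ⟨x, hx⟩ := Set.ncard_eq_one.1 h2.2
          have e1 : w ∈ T.neighborSet u := h3.1.symm
          have e2 : v ∈ T.neighborSet u := h2.1.symm
          rw [hx] at e1 e2
          exact e1.trans e2.symm
        subst this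
        exact List.disjoint_of_nodup_append hnd h1 hw
    rw [hset, Set.ncard_coe_finset, List.toFinset_card_of_nodup (List.nodup_append.1 hnd).1]
    rw [← h.length_leafList] at hv
    simp
    omega

/-- Array 2 marks the removed vertices. Register 4 counts the leaves met so far at the current
vertex, but stops at 2. -/
def pruneLeaf : Program :=
  .cond (.eq (.sub (.get 0 (.succ (.reg 3))) (.get 0 (.reg 3))) (.lit 1))
    (.cond (.lt (.reg 4) (.lit 2)) (.set 4 (.succ (.reg 4))) (.store 2 (.reg 3) (.lit 1))) .skip

def pruneProg : Program :=
  .forTo 1 0 (.seq (.set 4 (.lit 0)) (.forList 0 1 1 2 3 pruneLeaf))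

theorem wp_pruneProg {s : State} (h : HoldsInput adj s) (h0 : ∀ u : Fin n, s.arr 2 u = 0) :
    WP pruneProg s fun t s' => t ≤ 200 * (n + 1) ∧ ∀ u : Fin n, s'.arr 2 u ≠ 0 ↔ Dead adj u := by
  refine wp_forTo_sum h
    (fun i s1 => ∀ u : Fin n, s1.arr 2 u ≠ 0 ↔ ∃ v : Fin n, v.val < i ∧ u ∈ (leafList adj v).drop 2)
    50 h.size rfl rfl (by simp [h0]) ?_ ?_
  · intro v s1 hF hv hI
    have hin := h.frame hF rfl rfl rfl
    refine wp_seq (wp_set ?_)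
    refine wp_forList (f := Fin.val) (L := adj v)
      (fun done s2 => s2.reg 4 = min 2 (done.filter fun u => (adj u).length = 1).length ∧
        ∀ u : Fin n, s2.arr 2 u ≠ 0 ↔ (∃ w : Fin n, w.val < v.val ∧ u ∈ (leafList adj w).drop 2) ∨
          u ∈ (done.filter fun u => (adj u).length = 1).drop 2) 30 ?_ rfl (by decide) rfl rfl rfl
      ?_ ?_ ?_
    · simpa [hv] using hin.stores v
    · intro y
      simpa using hI
    · intro done x rest s2 hL hF2 hI2
      have hin2 := (hin.setReg (x := 4) 0 (by decide)).frame hF2 rfl rfl rfl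
      have hlen := hin2.length_eq x
      rw [List.filter_append, List.filter_singleton]
      obtain ⟨hI3, hI4⟩ := hI2
      refine wp_cond (fun he => ?_) (fun he => wp_skip ?_)
      · simp [hlen] at he
        refine wp_cond (fun h4 => wp_set ?_) (fun h4 => wp_store ?_)
        · simp [hI3] at h4
          refine ⟨by simp, fun y => ⟨by simp [he, hI3]; omega, fun u => ?_⟩⟩
          have h5 := hI4 u
          rw [List.drop_eq_nil_of_le (by omega)] at h5
          rw [List.drop_eq_nil_of_le (by simp [he]; omega)]
          exact h5
        · simp [hI3] at h4
          refine ⟨by simp, fun y => ⟨by simp [he, hI3]; omega, fun u => ?_⟩⟩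
          have h5 := hI4 u
          rw [List.drop_append_of_le_length h4]
          by_cases hux : u = x
          · subst hux
            simp [he]
          · simpa [he, Function.update_apply, hux, Fin.val_inj] using h5
      · simp [hlen] at he
        exact ⟨by simp, fun y => ⟨by simp [he, hI3], fun u => by simpa [he] using hI4 u⟩⟩
    · intro t s2 hF2 hI2 ht
      refine ⟨?_, ?_⟩
      · simp
        omega
      · intro u
        refine (hI2.2 u).trans ⟨?_, ?_⟩
        · rintro (⟨w, hw, hu⟩ | hu)
          · exact ⟨w, by omega, hu⟩
          · exact ⟨v, by omega, hu⟩
        · rintro ⟨w, hw, hu⟩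
          rcases Nat.lt_succ_iff_lt_or_eq.1 hw with hw | hw
          · exact Or.inl ⟨w, hw, hu⟩
          · rw [Fin.val_inj] at hw
            exact Or.inr (hw ▸ hu)
  · intro t s1 hF hI ht
    refine ⟨by omega, fun u => (hI u).trans ?_⟩
    simp [Dead]

end Prune


/-! ### Degrees in the pruned forest and initial marks -/

section Setup

variable {n : ℕ} {T : SimpleGraph (Fin n)} {adj : Fin n → List (Fin n)}

/-- Array 3 receives the degrees in the pruned forest, for the interiority test. Arrays 5 and 8
begin as copies of the removal marks: a removed vertex counts as processed in the greedy phase and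
as visited in the traversal. -/
def setupProg : Program :=
  .forTo 5 0 (.seq (.set 8 (.lit 0)) (.seq
    (.forList 0 1 5 6 7 (.cond (.get 2 (.reg 7)) .skip (.set 8 (.succ (.reg 8)))))
    (.seq (.store 3 (.reg 5) (.reg 8)) (.seq (.store 5 (.reg 5) (.get 2 (.reg 5)))
      (.store 8 (.reg 5) (.get 2 (.reg 5)))))))

theorem wp_setupProg {s : State} (h : HoldsInput adj s) :
    WP setupProg s fun t s' => t ≤ 200 * (n + 1) ∧ ∀ v : Fin n,
      s'.arr 3 v = ((adj v).filter fun u : Fin n => s.arr 2 u = 0).length ∧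
      s'.arr 5 v = s.arr 2 v ∧ s'.arr 8 v = s.arr 2 v := by
  refine wp_forTo_sum h
    (fun i s1 => ∀ v : Fin n, v.val < i →
      s1.arr 3 v = ((adj v).filter fun u : Fin n => s.arr 2 u = 0).length ∧
      s1.arr 5 v = s.arr 2 v ∧ s1.arr 8 v = s.arr 2 v) 50 h.size rfl rfl (by simp) ?_ ?_
  · intro v s1 hF hv hI
    have hin := h.frame hF rfl rfl rfl
    refine wp_seq (wp_set (wp_seq ?_))
    refine wp_forList (f := Fin.val) (L := adj v)
      (fun done s2 => s2.reg 8 = (done.filter fun u : Fin n => s.arr 2 u = 0).length) 30 ?_ rfl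
      (by decide) rfl rfl rfl ?_ ?_ ?_
    · simpa [hv] using hin.stores v
    · simp
    · intro done x rest s2 hL hF2 hI2
      have h2 : s2.arr 2 = s.arr 2 := (hF2.arr 2 rfl).trans (hF.arr 2 rfl)
      refine wp_cond (fun he => wp_skip ?_) (fun he => wp_set ?_)
      · simp [h2] at he
        simp [he, hI2]
      · simp [h2] at he
        simp [he, hI2]
    · intro t s2 hF2 hI2 ht
      have h2 : s2.arr 2 = s.arr 2 := (hF2.arr 2 rfl).trans (hF.arr 2 rfl)
      have h3 : s2.arr 3 = s1.arr 3 := hF2.arr 3 rfl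
      have h5 : s2.arr 5 = s1.arr 5 := hF2.arr 5 rfl
      have h8 : s2.arr 8 = s1.arr 8 := hF2.arr 8 rfl
      have hv2 : s2.reg 5 = v := (hF2.reg 5 rfl).trans (by simpa using hv)
      refine wp_seq (wp_store (wp_seq (wp_store (wp_store ⟨?_, fun w hw => ?_⟩))))
      · simp
        omega
      · by_cases hwv : w = v
        · subst hwv
          simp [hv2, hI2, h2]
        · simpa [hv2, hI2, h2, h3, h5, h8, Function.update_apply, Fin.val_inj, hwv] using hI w
            (by have := Fin.val_ne_of_ne hwv; omega)
  · intro t s1 hF hI ht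
    exact ⟨by omega, fun v => hI v v.2⟩

end Setup


/-! ### Greedy choice of a maximum edge set with at most two edges at each vertex -/

section Greedy

variable {V : Type*} {T : SimpleGraph V}

theorem edgeDegree_mono [Finite V] {N N' : Set (Sym2 V)} (h : N ⊆ N') (v : V) :
    edgeDegree N v ≤ edgeDegree N' v :=
  Set.ncard_le_ncard (fun _ hw => h hw) (Set.toFinite _)

theorem edgeDegree_insert_left [Finite V] {N : Set (Sym2 V)} {a b : V} (hN : s(a, b) ∉ N) :
    edgeDegree (insert s(a, b) N) a = edgeDegree N a + 1 := by
  have : {w | s(a, w) ∈ insert s(a, b) N} = insert b {w | s(a, w) ∈ N} := by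
    ext w
    simp only [Set.mem_ofPred_eq, Set.mem_insert_iff, Sym2.congr_right]
  rw [edgeDegree, this, Set.ncard_insert_of_notMem (by exact hN)]
  rfl

theorem edgeDegree_insert_right [Finite V] {N : Set (Sym2 V)} {a b : V} (hN : s(a, b) ∉ N) :
    edgeDegree (insert s(a, b) N) b = edgeDegree N b + 1 := by
  rw [Sym2.eq_swap] at hN ⊢
  exact edgeDegree_insert_left hN

theorem edgeDegree_insert_of_ne {N : Set (Sym2 V)} {a b v : V} (ha : v ≠ a) (hb : v ≠ b) :
    edgeDegree (insert s(a, b) N) v = edgeDegree N v := by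
  have : {w | s(v, w) ∈ insert s(a, b) N} = {w | s(v, w) ∈ N} := by
    ext w
    simp only [Set.mem_ofPred_eq, Set.mem_insert_iff, Sym2.eq_iff]
    tauto
  rw [edgeDegree, this]
  rfl

/-- `N` is a set of edges of `T - D` in which no vertex has more than two edges. -/
structure IsLinear (T : SimpleGraph V) (D : Set V) (N : Set (Sym2 V)) : Prop where
  subset : N ⊆ T.edgeSet
  avoid : ∀ v w, s(v, w) ∈ N → v ∉ D
  degree_le : ∀ v, edgeDegree N v ≤ 2

/-- The vertices of `G` have been processed, and the set `M` of edges at these vertices can be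
extended to a maximum linear set of edges of `T - D`. -/
structure IsExtendable (T : SimpleGraph V) (D G : Set V) (M : Set (Sym2 V)) : Prop where
  subset : D ⊆ G
  isLinear : IsLinear T D M
  touch : ∀ v w, s(v, w) ∈ M → v ∈ G ∨ w ∈ G
  extend : ∀ N, IsLinear T D N → ∃ N', IsLinear T D N' ∧ N.ncard ≤ N'.ncard ∧
    ∀ v w, v ∈ G → (s(v, w) ∈ N' ↔ s(v, w) ∈ M)

theorem isExtendable_empty (T : SimpleGraph V) (D : Set V) : IsExtendable T D D ∅ := by
  refine ⟨subset_rfl, ⟨by simp, by simp, by simp [edgeDegree]⟩, by simp, fun N hN => ?_⟩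
  refine ⟨N, hN, le_rfl, fun v w hv => ?_⟩
  simp only [Set.mem_empty_iff_false, iff_false]
  exact fun h => hN.avoid v w h hv

variable {D G : Set V} {M : Set (Sym2 V)}

/-- An edge from `v` to a processed vertex is already decided, and an edge to an unprocessed one has
an end that `M` saturates. So the extensions that agree with `M` on `G` agree with it at `v` too. -/
theorem IsExtendable.skip [Finite V] (h : IsExtendable T D G M) {v : V} (hv : v ∉ G)
    (hfull : ∀ u, u ∉ G → T.Adj v u → 2 ≤ edgeDegree M v ∨ 2 ≤ edgeDegree M u) :
    IsExtendable T D (insert v G) M := by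
  refine ⟨h.subset.trans (Set.subset_insert _ _), h.isLinear,
    fun a b hab => (h.touch a b hab).imp (Set.mem_insert_of_mem _) (Set.mem_insert_of_mem _),
    fun N hN => ?_⟩
  obtain ⟨N', h1, h2, h3⟩ := h.extend N hN
  have hMN : M ⊆ N' := by
    intro e
    induction e using Sym2.ind with
    | _ a b =>
    intro hab
    rcases h.touch a b hab with ha | hb
    · exact (h3 a b ha).2 hab
    · rw [Sym2.eq_swap] at hab ⊢
      exact (h3 b a hb).2 hab
  have hblock : ∀ a b, s(a, b) ∈ N' → s(a, b) ∉ M → ¬ 2 ≤ edgeDegree M a := by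
    intro a b h4 h5 h6
    have h7 := edgeDegree_mono (Set.insert_subset h4 hMN) a
    rw [edgeDegree_insert_left h5] at h7
    have := h1.degree_le a
    omega
  refine ⟨N', h1, h2, fun a b ha => ⟨fun hab => ?_, fun hab => hMN hab⟩⟩
  by_contra hM
  have haG : a ∉ G := fun ha => hM ((h3 a b ha).1 hab)
  have hav : a = v := (Set.mem_insert_iff.1 ha).resolve_right haG
  subst hav
  have hbG : b ∉ G := by
    intro hb
    rw [Sym2.eq_swap] at hab hM
    exact hM ((h3 b a hb).1 hab)
  rcases hfull b hbG (h1.subset hab) with h4 | h4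
  · exact hblock a b hab hM h4
  · rw [Sym2.eq_swap] at hab hM
    exact hblock b a hab hM h4

/-- An exchange argument. If an optimal extension omits the edge `vp`, then `v` has room in it,
since `p` is the only unprocessed neighbour of `v`. If `p` is full there, one of its edges outside
`M` makes way for `vp`, and the size does not drop. -/
theorem IsExtendable.link [Finite V] (h : IsExtendable T D G M) {v p : V} (hv : v ∉ G) (hp : p ∉ G)
    (hvp : T.Adj v p) (huniq : ∀ u, u ∉ G → T.Adj v u → u = p) (hdv : edgeDegree M v < 2)
    (hdp : edgeDegree M p < 2) : IsExtendable T D (insert v G) (insert s(v, p) M) := by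
  have hnM : s(v, p) ∉ M := fun hm => (h.touch v p hm).elim hv hp
  have hlin : ∀ N1, IsLinear T D N1 → s(v, p) ∉ N1 → edgeDegree N1 v < 2 → edgeDegree N1 p < 2 →
      IsLinear T D (insert s(v, p) N1) := by
    intro N1 h1 h2 h3 h4
    refine ⟨Set.insert_subset hvp h1.subset, fun a b hab => ?_, fun x => ?_⟩
    · rcases Set.mem_insert_iff.1 hab with e | hab
      · rcases Sym2.eq_iff.1 e with ⟨rfl, -⟩ | ⟨rfl, -⟩
        · exact fun hd => hv (h.subset hd)
        · exact fun hd => hp (h.subset hd)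
      · exact h1.avoid a b hab
    · by_cases hxv : x = v
      · subst hxv
        rw [edgeDegree_insert_left h2]
        omega
      by_cases hxp : x = p
      · subst hxp
        rw [edgeDegree_insert_right h2]
        omega
      · rw [edgeDegree_insert_of_ne hxv hxp]
        exact h1.degree_le x
  refine ⟨h.subset.trans (Set.subset_insert _ _), hlin M h.isLinear hnM hdv hdp, ?_, fun N hN => ?_⟩
  · intro a b hab
    rcases Set.mem_insert_iff.1 hab with e | hab
    · rcases Sym2.eq_iff.1 e with ⟨rfl, -⟩ | ⟨-, rfl⟩
      · exact Or.inl (Set.mem_insert _ _)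
      · exact Or.inr (Set.mem_insert _ _)
    · exact (h.touch a b hab).imp (Set.mem_insert_of_mem _) (Set.mem_insert_of_mem _)
  obtain ⟨N', h1, h2, h3⟩ := h.extend N hN
  have h3' : ∀ a b, b ∈ G → (s(a, b) ∈ N' ↔ s(a, b) ∈ M) := by
    intro a b hb
    rw [Sym2.eq_swap]
    exact h3 b a hb
  have hagree : ∀ N'' : Set (Sym2 V), (∀ a b, s(a, b) ∈ N'' → T.Adj a b) → s(v, p) ∈ N'' →
      (∀ a b, a ∈ G → (s(a, b) ∈ N'' ↔ s(a, b) ∈ N')) →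
      ∀ a b, a ∈ insert v G → (s(a, b) ∈ N'' ↔ s(a, b) ∈ insert s(v, p) M) := by
    intro N'' h4 h5 h6 a b ha
    by_cases haG : a ∈ G
    · rw [h6 a b haG, h3 a b haG, Set.mem_insert_iff, or_iff_right]
      intro e
      rcases Sym2.eq_iff.1 e with ⟨rfl, -⟩ | ⟨rfl, -⟩
      · exact hv haG
      · exact hp haG
    · obtain rfl := (Set.mem_insert_iff.1 ha).resolve_right haG
      by_cases hbp : b = p
      · subst hbp
        simp [h5]
      · rw [Set.mem_insert_iff, or_iff_right (fun e => hbp (Sym2.congr_right.1 e))]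
        by_cases hbG : b ∈ G
        · have := h6 b a hbG
          rw [Sym2.eq_swap (a := b)] at this
          rw [this, h3' a b hbG]
        · refine ⟨fun hab => absurd (huniq b hbG (h4 _ _ hab)) hbp, fun hab => ?_⟩
          exact absurd (huniq b hbG (h.isLinear.subset hab)) hbp
  by_cases hmem : s(v, p) ∈ N'
  · exact ⟨N', h1, h2, hagree N' (fun _ _ hab => h1.subset hab) hmem fun _ _ _ => Iff.rfl⟩
  -- `N1` is `N'` with room made at `p`, at the cost of at most one edge. The discarded edge is not
  -- in `M`, so the agreement with `M` on `G` is kept.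
  obtain ⟨N1, hsub, hp1, hc1, hk1⟩ : ∃ N1 ⊆ N', edgeDegree N1 p < 2 ∧ N'.ncard ≤ N1.ncard + 1 ∧
      ∀ a b, a ∈ G → s(a, b) ∈ N' → s(a, b) ∈ N1 := by
    by_cases hdp' : edgeDegree N' p < 2
    · exact ⟨N', subset_rfl, hdp', by omega, fun _ _ _ h => h⟩
    obtain ⟨z, hz, hzM⟩ : ∃ z, s(p, z) ∈ N' ∧ s(p, z) ∉ M := by
      by_contra! hcon
      have : edgeDegree N' p ≤ edgeDegree M p :=
        Set.ncard_le_ncard (fun z hz => hcon z hz) (Set.toFinite _)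
      omega
    have hins : insert s(p, z) (N' \ {s(p, z)}) = N' := by
      rw [Set.insert_sdiff_singleton, Set.insert_eq_of_mem hz]
    refine ⟨N' \ {s(p, z)}, Set.sdiff_subset, ?_, ?_, fun a b ha hab => ⟨hab, fun e => ?_⟩⟩
    · have h4 := edgeDegree_insert_left (N := N' \ {s(p, z)}) (a := p) (b := z) (by simp)
      rw [hins] at h4
      have := h1.degree_le p
      omega
    · rw [Set.ncard_sdiff_singleton_of_mem hz]
      omega
    · have h5 := (h3 a b ha).1 hab
      rw [Set.mem_singleton_iff.1 e] at h5
      exact hzM h5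
  have hN1 : IsLinear T D N1 := ⟨hsub.trans h1.subset, fun a b hab => h1.avoid a b (hsub hab),
    fun x => (edgeDegree_mono hsub x).trans (h1.degree_le x)⟩
  have hv1 : edgeDegree N1 v < 2 := by
    refine lt_of_le_of_lt (Set.ncard_le_ncard (fun w hw => ?_) (Set.toFinite _)) hdv
    have hw' : s(v, w) ∈ N' := hsub hw
    by_cases hwG : w ∈ G
    · exact (h3' v w hwG).1 hw'
    · exact absurd (huniq w hwG (h1.subset hw') ▸ hw') hmem
  have hn1 : s(v, p) ∉ N1 := fun h => hmem (hsub h)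
  have hlin' := hlin N1 hN1 hn1 hv1 hp1
  refine ⟨_, hlin', ?_, hagree _ (fun _ _ hab => hlin'.subset hab) (Set.mem_insert _ _) ?_⟩
  · rw [Set.ncard_insert_of_notMem hn1 (Set.toFinite _)]
    omega
  · intro a b ha
    rw [Set.mem_insert_iff, or_iff_right]
    · exact ⟨fun hab => hsub hab, hk1 a b ha⟩
    · intro e
      rcases Sym2.eq_iff.1 e with ⟨rfl, -⟩ | ⟨rfl, -⟩
      · exact hv ha
      · exact hp ha

theorem IsExtendable.ncard_le [Finite V] (h : IsExtendable T D G M) (hG : ∀ v, v ∈ G)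
    {N : Set (Sym2 V)} (hN : IsLinear T D N) : N.ncard ≤ M.ncard := by
  obtain ⟨N', -, h2, h3⟩ := h.extend N hN
  have : N' = M := by
    ext ⟨a, b⟩
    exact h3 a b (hG a)
  rwa [← this]

end Greedy


/-! ### The greedy phase as a program -/

section Strip

variable {n : ℕ} {T : SimpleGraph (Fin n)} {adj : Fin n → List (Fin n)}

/-- The edges recorded in an array: `par v = u + 1` records the edge `vu`. -/
def recorded (par : ℕ → ℕ) : Set (Sym2 (Fin n)) :=
  {e | ∃ v u : Fin n, e = s(v, u) ∧ par v = u + 1}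

theorem mk_mem_recorded {par : ℕ → ℕ} {v u : Fin n} :
    s(v, u) ∈ recorded par ↔ par v = u + 1 ∨ par u = v + 1 := by
  constructor
  · rintro ⟨a, b, e, h⟩
    rcases Sym2.eq_iff.1 e with ⟨rfl, rfl⟩ | ⟨rfl, rfl⟩
    · exact Or.inl h
    · exact Or.inr h
  · rintro (h | h)
    · exact ⟨v, u, rfl, h⟩
    · exact ⟨u, v, Sym2.eq_swap, h⟩

theorem recorded_update {par : ℕ → ℕ} {v p : Fin n} (hv : par v = 0) :
    (recorded (Function.update par v (p + 1)) : Set (Sym2 (Fin n))) =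
      insert s(v, p) (recorded par) := by
  ext e
  constructor
  · rintro ⟨a, b, rfl, h⟩
    by_cases hav : a = v
    · subst hav
      rw [Function.update_self] at h
      have : p = b := Fin.ext (by omega)
      exact Or.inl (by rw [this])
    · rw [Function.update_of_ne (Fin.val_ne_of_ne hav)] at h
      exact Or.inr ⟨a, b, rfl, h⟩
  · rintro (rfl | ⟨a, b, rfl, h⟩)
    · exact ⟨v, p, rfl, Function.update_self _ _ _⟩
    · refine ⟨a, b, rfl, ?_⟩
      rw [Function.update_of_ne, h]
      intro e
      rw [e, hv] at h
      omega

/-- The entries `u` of `L` with `gone u = 0`. -/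
def restOf (gone : ℕ → ℕ) (L : List (Fin n)) : List (Fin n) := L.filter fun u => gone u = 0

/-- One more than the last entry of `L`, and 0 if there is none. -/
def lastCode (L : List (Fin n)) : ℕ := L.getLast?.elim 0 fun u => u + 1

def scanNeighbors : Program :=
  .forList 0 1 11 14 15 (.cond (.get 5 (.reg 15)) .skip
    (.seq (.set 12 (.succ (.reg 12))) (.set 13 (.succ (.reg 15)))))

/-- Registers 12 and 13 hold the number of remaining neighbours of the current vertex and the code,
one more than the vertex, of the last of them. A vertex with at most one remaining neighbour leaves
its code in register 10 and the code of that neighbour in register 16; the code 0 stands for none.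
-/
def scanProg : Program :=
  .forTo 11 0 (.cond (.get 5 (.reg 11)) .skip
    (.seq (.set 12 (.lit 0)) (.seq (.set 13 (.lit 0)) (.seq scanNeighbors
      (.cond (.lt (.reg 12) (.lit 2))
        (.seq (.set 10 (.succ (.reg 11))) (.set 16 (.reg 13))) .skip)))))

theorem wp_scanProg {s : State} (h : HoldsInput adj s) (h0 : s.reg 10 = 0) :
    WP scanProg s fun t s' => t ≤ 400 * (n + 1) ∧
      ((s'.reg 10 = 0 ∧ ∀ v : Fin n, s.arr 5 v = 0 → 2 ≤ (restOf (s.arr 5) (adj v)).length) ∨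
        ∃ v : Fin n, s'.reg 10 = v + 1 ∧ s.arr 5 v = 0 ∧ (restOf (s.arr 5) (adj v)).length < 2 ∧
          s'.reg 16 = lastCode (restOf (s.arr 5) (adj v))) := by
  refine wp_forTo_sum h (fun i s1 => (s1.reg 10 = 0 ∧ ∀ v : Fin n, v.val < i → s.arr 5 v = 0 →
      2 ≤ (restOf (s.arr 5) (adj v)).length) ∨
        ∃ v : Fin n, s1.reg 10 = v + 1 ∧ s.arr 5 v = 0 ∧ (restOf (s.arr 5) (adj v)).length < 2 ∧
          s1.reg 16 = lastCode (restOf (s.arr 5) (adj v))) 100 h.size rfl rfl (by simp [h0]) ?_ ?_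
  · intro v s1 hF hv hI
    have hin := h.frame hF rfl rfl rfl
    have h5 : s1.arr 5 = s.arr 5 := hF.arr 5 rfl
    refine wp_cond (fun he => wp_skip ⟨by simp; omega, ?_⟩) (fun he => ?_)
    · simp [hv, h5] at he
      refine hI.imp (fun hI => ⟨by simpa using hI.1, fun w hw hw0 => ?_⟩) (by simp)
      refine hI.2 w ?_ hw0
      rcases Nat.lt_succ_iff_lt_or_eq.1 hw with hw | hw
      · exact hw
      · rw [hw] at hw0
        exact absurd hw0 he
    · simp [hv, h5] at he
      refine wp_seq (wp_set (wp_seq (wp_set (wp_seq ?_))))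
      refine wp_forList (f := Fin.val) (L := adj v)
        (fun done s2 => s2.reg 12 = (restOf (s.arr 5) done).length ∧
          s2.reg 13 = lastCode (restOf (s.arr 5) done)) 30 ?_ rfl
        (by decide) rfl rfl rfl ?_ ?_ ?_
      · simpa [hv] using hin.stores v
      · simp [restOf, lastCode]
      · intro done x rest s2 hL hF2 hI2
        have h5' : s2.arr 5 = s.arr 5 := (hF2.arr 5 rfl).trans h5
        refine wp_cond (fun he => wp_skip ?_) (fun he => wp_seq (wp_set (wp_set ?_)))
        · simp [h5'] at he
          simpa [he, restOf] using hI2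
        · simp [h5'] at he
          simpa [he, restOf, lastCode] using hI2.1
      · intro t s2 hF2 hI2 ht
        have h10 : s2.reg 10 = s1.reg 10 := hF2.reg 10 rfl
        have h16 : s2.reg 16 = s1.reg 16 := hF2.reg 16 rfl
        have h11 : s2.reg 11 = v := (hF2.reg 11 rfl).trans (by simpa using hv)
        refine wp_cond (fun he => wp_seq (wp_set (wp_set ⟨?_, Or.inr ⟨v, ?_⟩⟩)))
          (fun he => wp_skip ⟨?_, ?_⟩)
        · simp
          omega
        · simp [hI2.1] at he
          simp [hI2.2, *]
        · simp
          omega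
        · simp [hI2.1] at he
          refine hI.imp (fun hI => ⟨by simpa [h10] using hI.1, fun w hw hw0 => ?_⟩)
            (by simp [h10, h16])
          rcases Nat.lt_succ_iff_lt_or_eq.1 hw with hw | hw
          · exact hI.2 w hw hw0
          · rw [Fin.val_inj] at hw
            rw [hw]
            exact he
  · intro t s1 hF hI ht
    exact ⟨by omega, hI.imp (fun hI => ⟨hI.1, fun v => hI.2 v v.2⟩) id⟩

/-- Array 6 records a chosen edge at the vertex that is being stripped, so each entry is used at
most once. Array 7 counts the chosen edges at each vertex. -/
def linkProg : Program :=
  .cond (.reg 16) (.cond (.lt (.get 7 (.sub (.reg 10) (.lit 1))) (.lit 2))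
    (.cond (.lt (.get 7 (.sub (.reg 16) (.lit 1))) (.lit 2))
      (.seq (.store 6 (.sub (.reg 10) (.lit 1)) (.reg 16))
        (.seq (.store 7 (.sub (.reg 10) (.lit 1)) (.succ (.get 7 (.sub (.reg 10) (.lit 1)))))
          (.store 7 (.sub (.reg 16) (.lit 1)) (.succ (.get 7 (.sub (.reg 16) (.lit 1)))))))
      .skip) .skip) .skip

def stripProg : Program :=
  .forTo 9 0 (.seq (.set 10 (.lit 0)) (.seq scanProg
    (.cond (.reg 10) (.seq (.store 5 (.sub (.reg 10) (.lit 1)) (.lit 1)) linkProg) .skip)))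

/-- The invariant of the greedy construction of a maximum linear set of edges. -/
structure StripInv (T : SimpleGraph (Fin n)) (D : Set (Fin n)) (gone par md : ℕ → ℕ) : Prop where
  extendable : IsExtendable T D {v | gone v ≠ 0} (recorded par)
  degree : ∀ v : Fin n, md v = edgeDegree (recorded par : Set (Sym2 (Fin n))) v
  fresh : ∀ v : Fin n, gone v = 0 → par v = 0

theorem IsAdjacencyList.mem_restOf (hadj : IsAdjacencyList T adj) {gone : ℕ → ℕ} {u v : Fin n} :
    u ∈ restOf gone (adj v) ↔ T.Adj v u ∧ gone u = 0 := by
  simp [restOf, (hadj v).2]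

theorem StripInv.finish {D : Set (Fin n)} {gone par md : ℕ → ℕ} (h : StripInv T D gone par md)
    {v : Fin n} (hv : gone v = 0) (hfull : ∀ u : Fin n, gone u = 0 → T.Adj v u →
      2 ≤ md v ∨ 2 ≤ md u) : StripInv T D (Function.update gone v 1) par md := by
  have hset : {w : Fin n | Function.update gone v 1 w ≠ 0} = insert v {w : Fin n | gone w ≠ 0} := by
    ext w
    by_cases hwv : w = v
    · simp [hwv]
    · simp [hwv, Function.update_apply, Fin.val_inj]
  refine ⟨?_, h.degree, fun w hw => h.fresh w ?_⟩
  · rw [hset]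
    refine h.extendable.skip (by simpa using hv) fun u hu hvu => ?_
    rw [← h.degree, ← h.degree]
    exact hfull u (by simpa using hu) hvu
  · by_cases hwv : w = v
    · rw [hwv, hv]
    · rwa [Function.update_of_ne (Fin.val_ne_of_ne hwv)] at hw

theorem StripInv.link {D : Set (Fin n)} {gone par md : ℕ → ℕ} (h : StripInv T D gone par md)
    {v p : Fin n} (hv : gone v = 0) (hp : gone p = 0) (hvp : T.Adj v p)
    (huniq : ∀ u : Fin n, gone u = 0 → T.Adj v u → u = p) (hdv : md v < 2) (hdp : md p < 2) :
    StripInv T D (Function.update gone v 1) (Function.update par v (p + 1))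
      (Function.update (Function.update md v (md v + 1)) p (md p + 1)) := by
  have hset : {w : Fin n | Function.update gone v 1 w ≠ 0} = insert v {w : Fin n | gone w ≠ 0} := by
    ext w
    by_cases hwv : w = v
    · simp [hwv]
    · simp [hwv, Function.update_apply, Fin.val_inj]
  have hn : s(v, p) ∉ (recorded par : Set (Sym2 (Fin n))) := by
    intro hm
    rw [mk_mem_recorded, h.fresh v hv, h.fresh p hp] at hm
    omega
  refine ⟨?_, fun w => ?_, fun w hw => ?_⟩
  · rw [hset, recorded_update (h.fresh v hv)]
    refine h.extendable.link (by simpa using hv) (by simpa using hp) hvp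
      (fun u hu hvu => huniq u (by simpa using hu) hvu) ?_ ?_
    · rwa [← h.degree]
    · rwa [← h.degree]
  · rw [recorded_update (h.fresh v hv)]
    by_cases hwp : w = p
    · rw [hwp, Function.update_self, edgeDegree_insert_right hn, h.degree]
    rw [Function.update_of_ne (Fin.val_ne_of_ne hwp)]
    by_cases hwv : w = v
    · rw [hwv, Function.update_self, edgeDegree_insert_left hn, h.degree]
    · rw [Function.update_of_ne (Fin.val_ne_of_ne hwv), edgeDegree_insert_of_ne hwv hwp, h.degree]
  · by_cases hwv : w = v
    · simp [hwv] at hw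
    · have hwv' := Fin.val_ne_of_ne hwv
      rw [Function.update_of_ne hwv'] at hw ⊢
      exact h.fresh w hw

theorem ncard_update_lt {gone : ℕ → ℕ} {v : Fin n} (hv : gone v = 0) :
    {w : Fin n | Function.update gone v 1 w = 0}.ncard < {w : Fin n | gone w = 0}.ncard := by
  refine Set.ncard_lt_ncard ⟨fun w hw => ?_, fun hsub => ?_⟩ (Set.toFinite _)
  · by_cases hwv : w = v
    · rw [hwv]
      exact hv
    · rwa [Set.mem_ofPred_eq, Function.update_of_ne (Fin.val_ne_of_ne hwv)] at hw
  · have : v ∈ {w : Fin n | Function.update gone v 1 w = 0} := hsub hv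
    simp at this

/-- Each of the `n` rounds makes one scan of linear cost and strips a vertex unless none remains.
The number of remaining vertices plus the number of rounds never exceeds `n`, so everything is
processed at the end. -/
theorem wp_stripProg (hT : T.IsAcyclic) (hadj : IsAdjacencyList T adj) {s : State}
    (h : HoldsInput adj s) (h5 : ∀ v : Fin n, s.arr 5 v = s.arr 2 v)
    (h6 : ∀ v : Fin n, s.arr 6 v = 0) (h7 : ∀ v : Fin n, s.arr 7 v = 0) :
    WP stripProg s fun t s' => t ≤ 600 * (n + 1) ^ 2 ∧
      IsLinear T {v : Fin n | s.arr 2 v ≠ 0} (recorded (s'.arr 6)) ∧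
      (∀ v : Fin n, s'.arr 7 v = edgeDegree (recorded (s'.arr 6) : Set (Sym2 (Fin n))) v) ∧
      ∀ N, IsLinear T {v : Fin n | s.arr 2 v ≠ 0} N →
        N.ncard ≤ (recorded (s'.arr 6) : Set (Sym2 (Fin n))).ncard := by
  refine wp_forTo (m := n) (fun i s1 => StripInv T {v : Fin n | s.arr 2 v ≠ 0} (s1.arr 5) (s1.arr 6)
    (s1.arr 7) ∧ {v : Fin n | s1.arr 5 v = 0}.ncard + i ≤ n) (500 * (n + 1)) h.size rfl rfl ?_ ?_ ?_
  · have hempty : (recorded (s.arr 6) : Set (Sym2 (Fin n))) = ∅ := by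
      rw [Set.eq_empty_iff_forall_notMem]
      rintro _ ⟨a, b, -, hab⟩
      rw [h6] at hab
      omega
    refine ⟨⟨?_, fun v => ?_, fun v _ => h6 v⟩, ?_⟩
    · simp only [State.setReg_arr, hempty, h5]
      exact isExtendable_empty _ _
    · simp [hempty, edgeDegree, h7]
    · simpa using Set.ncard_le_card {v : Fin n | s.arr 5 v = 0}
  · rintro i s1 hi hF hi' ⟨⟨hI1, hI2, hI3⟩, hI4⟩
    have hin := h.frame hF rfl rfl rfl
    refine wp_seq (wp_set (wp_seq ?_))
    refine (wp_scanProg (hin.setReg 0 (by decide)) (by simp)).mono fun t1 s2 hF2 ⟨ht, hs⟩ => ?_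
    simp only [State.setReg_arr] at hs
    have e5 : s2.arr 5 = s1.arr 5 := hF2.arr 5 rfl
    have e6 : s2.arr 6 = s1.arr 6 := hF2.arr 6 rfl
    have e7 : s2.arr 7 = s1.arr 7 := hF2.arr 7 rfl
    rcases hs with ⟨h10, hs⟩ | ⟨v, h10, hv, hlen, h16⟩
    -- The scan can only fail if nothing remains, because every nonempty set of vertices of a forest
    -- has a vertex with at most one neighbour in it.
    · have hzero : {v : Fin n | s1.arr 5 v = 0} = ∅ := by
        by_contra hne
        obtain ⟨v, hv, huniq⟩ := exists_atMostOne_neighbor hT (Set.nonempty_iff_ne_empty.2 hne)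
        have h2 := hs v hv
        have hnd : (restOf (s1.arr 5) (adj v)).Nodup := (hadj v).1.filter _
        obtain ⟨a, b, l, hl⟩ : ∃ a b l, restOf (s1.arr 5) (adj v) = a :: b :: l := by
          match hL : restOf (s1.arr 5) (adj v), h2 with
          | a :: b :: l, _ => exact ⟨a, b, l, rfl⟩
        have ha := hadj.mem_restOf.1 (hl ▸ List.mem_cons_self : a ∈ restOf (s1.arr 5) (adj v))
        have hb := hadj.mem_restOf.1
          (hl ▸ List.mem_cons_of_mem _ List.mem_cons_self : b ∈ restOf (s1.arr 5) (adj v))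
        rw [hl] at hnd
        have := huniq a ha.2 b hb.2 ha.1 hb.1
        simp [this] at hnd
      refine wp_cond (fun he => absurd h10 he) fun _ => wp_skip ⟨?_, ?_, ?_⟩
      · simp
        omega
      · simp only [State.setReg_arr, e5, e6, e7]
        exact ⟨hI1, hI2, hI3⟩
      · simp only [State.setReg_arr, e5, hzero, Set.ncard_empty]
        omega
    · have hnc := ncard_update_lt hv
      have hI : StripInv T {v : Fin n | s.arr 2 v ≠ 0} (s1.arr 5) (s1.arr 6) (s1.arr 7) :=
        ⟨hI1, hI2, hI3⟩
      refine wp_cond (fun _ => wp_seq (wp_store ?_)) fun he => absurd he (by simp [h10])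
      simp only [RamExpr.eval, RamExpr.cost, h10, Nat.add_sub_cancel]
      obtain hL | ⟨p, hL⟩ : restOf (s1.arr 5) (adj v) = [] ∨ ∃ p, restOf (s1.arr 5) (adj v) = [p] := by
        match hL : restOf (s1.arr 5) (adj v), hlen with
        | [], _ => exact Or.inl rfl
        | [p], _ => exact Or.inr ⟨p, rfl⟩
      · have hno : ∀ u : Fin n, s1.arr 5 u = 0 → ¬ T.Adj v u := by
          intro u hu hvu
          have := hadj.mem_restOf.2 ⟨hvu, hu⟩
          simp [hL] at this
        refine wp_cond (fun he => absurd he (by simp [h16, hL, lastCode])) fun _ => wp_skip ?_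
        refine ⟨by simp; omega, ?_, ?_⟩
        · simpa [e5, e6, e7] using hI.finish hv fun u hu hvu => absurd hvu (hno u hu)
        · simp [e5]
          omega
      · have hp := hadj.mem_restOf.1 (hL ▸ List.mem_singleton_self p : p ∈ restOf (s1.arr 5) (adj v))
        have huniq : ∀ u : Fin n, s1.arr 5 u = 0 → T.Adj v u → u = p := by
          intro u hu hvu
          have := hadj.mem_restOf.2 ⟨hvu, hu⟩
          rwa [hL, List.mem_singleton] at this
        have hvp : (p : ℕ) ≠ v := Fin.val_ne_of_ne hp.1.ne'
        have h16' : s2.reg 16 = p + 1 := by simp [h16, hL, lastCode]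
        refine wp_cond (fun _ => ?_) fun he => absurd he (by simp [h16'])
        refine wp_cond (fun hdv => wp_cond (fun hdp => ?_) fun hdp => wp_skip ?_)
          fun hdv => wp_skip ?_
        · simp [h10, h16', e7] at hdv hdp
          refine wp_seq (wp_store (wp_seq (wp_store (wp_store ?_))))
          refine ⟨by simp; omega, ?_, ?_⟩
          · simpa [h10, h16', e5, e6, e7, hvp, Function.update_of_ne] using
              hI.link hv hp.2 hp.1 huniq (by omega) (by omega)
          · simp [e5]
            omega
        · simp [h10, h16', e7] at hdv hdp
          refine ⟨by simp; omega, ?_, ?_⟩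
          · simpa [e5, e6, e7] using hI.finish hv fun u hu hvu => Or.inr (huniq u hu hvu ▸ hdp)
          · simp [e5]
            omega
        · simp [h10, e7] at hdv
          refine ⟨by simp; omega, ?_, ?_⟩
          · simpa [e5, e6, e7] using hI.finish hv fun u hu hvu => Or.inl hdv
          · simp [e5]
            omega
  · rintro t s1 hF ⟨⟨hI1, hI2, hI3⟩, hI4⟩ ht
    refine ⟨by nlinarith, hI1.isLinear, hI2, fun N hN => hI1.ncard_le (fun v hv => ?_) hN⟩
    have : {v : Fin n | s1.arr 5 v = 0}.ncard = 0 := by omega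
    rw [Set.ncard_eq_zero] at this
    exact (Set.eq_empty_iff_forall_notMem.1 this) v hv

end Strip


/-! ### Tracing the paths formed by the chosen edges -/

section Traversal

variable {V : Type*} {T : SimpleGraph V}

/-- The paths `P` of `T - D` contain all edges of `M` at their vertices. -/
structure IsClosedSystem (T : SimpleGraph V) (D : Set V) (M : Set (Sym2 V)) (P : List (List V)) :
    Prop where
  isPathSystem : IsPathSystem T P
  avoid : ∀ v ∈ P.flatten, v ∉ D
  closed : ∀ a ∈ P.flatten, ∀ b, s(a, b) ∈ M → s(a, b) ∈ systemEdges P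

/-- The path `q` is being extended to the path `q ++ c`, where `c` has at most one vertex. -/
structure IsOpenPath (T : SimpleGraph V) (D : Set V) (M : Set (Sym2 V)) (P : List (List V))
    (q : List V) (c : Option V) : Prop where
  chain : (q ++ c.toList).IsChain T.Adj
  nodup : (P.flatten ++ (q ++ c.toList)).Nodup
  avoid : ∀ v ∈ q ++ c.toList, v ∉ D
  closed : ∀ a ∈ q, ∀ b, s(a, b) ∈ M → s(a, b) ∈ pathEdges (q ++ c.toList)
  unique : ∀ x ∈ c, ∀ a b, a ∉ q → b ∉ q → s(x, a) ∈ M → s(x, b) ∈ M → a = b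
  ne_nil : q ++ c.toList ≠ []

variable {D : Set V} {M : Set (Sym2 V)} {P : List (List V)} {q : List V}

theorem isClosedSystem_nil : IsClosedSystem T D M [] :=
  ⟨⟨by simp, by simp⟩, by simp, by simp⟩

theorem IsClosedSystem.mem_of_mk_mem (h : IsClosedSystem T D M P) {a b : V} (ha : a ∈ P.flatten)
    (hab : s(a, b) ∈ M) : b ∈ P.flatten := by
  obtain ⟨p, hp, hm⟩ := h.closed a ha b hab
  exact List.mem_flatten.2 ⟨p, hp, mem_of_mem_pathEdges hm (Sym2.mem_mk_right _ _)⟩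

/-- A vertex with at most one chosen edge is an end of its path, so tracing from it never leaves a
piece behind. -/
theorem isOpenPath_start [Finite V] (hP : IsClosedSystem T D M P) {v : V}
    (hv : v ∉ D) (hvP : v ∉ P.flatten) (hdeg : edgeDegree M v < 2) :
    IsOpenPath T D M P [] (some v) := by
  refine ⟨by simp, ?_, by simpa using hv, by simp, ?_, by simp⟩
  · refine List.nodup_append.2 ⟨hP.isPathSystem.nodup_flatten, by simp, ?_⟩
    rintro a ha b hb rfl
    obtain rfl : a = v := by simpa using hb
    exact hvP ha
  · rintro x hx a b - - ha hb
    obtain rfl : v = x := by simpa using hx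
    exact (Set.ncard_le_one (Set.toFinite _)).1 (Nat.lt_succ_iff.1 hdeg) a ha b hb

theorem IsOpenPath.finish (hP : IsClosedSystem T D M P) (h : IsOpenPath T D M P q none) :
    IsClosedSystem T D M (P ++ [q]) := by
  obtain ⟨h1, h2, h3, h4, -, h6⟩ := h
  simp only [Option.toList_none, List.append_nil] at h1 h2 h3 h4 h6
  have hdis := (List.nodup_append.1 h2).2.2
  refine ⟨⟨fun p hp => ?_, ?_⟩, fun v hv => ?_, fun a ha b hab => ?_⟩
  · rcases List.mem_append.1 hp with hp | hp
    · exact hP.isPathSystem.isPathList p hp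
    · rw [List.mem_singleton.1 hp]
      exact ⟨h6, (List.nodup_append.1 h2).2.1, h1⟩
  · refine List.pairwise_append.2 ⟨hP.isPathSystem.disjoint, List.pairwise_singleton _ _, ?_⟩
    intro p hp q' hq' v hv hv'
    rw [List.mem_singleton.1 hq'] at hv'
    exact hdis v (List.mem_flatten.2 ⟨p, hp, hv⟩) v hv' rfl
  · rw [List.flatten_append, List.mem_append] at hv
    rcases hv with hv | hv
    · exact hP.avoid v hv
    · exact h3 v (by simpa using hv)
  · rw [List.flatten_append, List.mem_append] at ha
    rcases ha with ha | ha
    · obtain ⟨p, hp, hm⟩ := hP.closed a ha b hab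
      exact ⟨p, List.mem_append_left _ hp, hm⟩
    · exact ⟨q, by simp, h4 a (by simpa using ha) b hab⟩

theorem pathEdges_append_subset {p q : List V} {e : Sym2 V} (h : e ∈ pathEdges p) :
    e ∈ pathEdges (p ++ q) := by
  obtain ⟨L, R, a, b, rfl, rfl⟩ := mem_pathEdges.1 h
  exact mem_pathEdges.2 ⟨L, R ++ q, a, b, by simp, rfl⟩

theorem IsOpenPath.mem_of_mk_mem {x : V} (h : IsOpenPath T D M P q (some x)) {b : V} (hb : b ∈ q)
    (hM : s(x, b) ∈ M) : s(x, b) ∈ pathEdges (q ++ [x]) := by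
  rw [Sym2.eq_swap] at hM ⊢
  exact h.closed b hb x hM

theorem IsOpenPath.close {x : V} (h : IsOpenPath T D M P q (some x)) (hM : M ⊆ T.edgeSet)
    (hno : ∀ y, y ∉ q ++ [x] → s(x, y) ∉ M) : IsOpenPath T D M P (q ++ [x]) none := by
  refine ⟨by simpa using h.chain, by simpa using h.nodup, by simpa using h.avoid, ?_, by simp,
    by simp⟩
  intro a ha b hab
  rw [Option.toList_none, List.append_nil]
  rcases List.mem_append.1 ha with ha | ha
  · exact h.closed a ha b hab
  · rw [List.mem_singleton] at ha
    subst ha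
    have hb : b ∈ q ++ [a] := by
      by_contra hb
      exact hno b hb hab
    rcases List.mem_append.1 hb with hb | hb
    · exact h.mem_of_mk_mem hb hab
    · rw [List.mem_singleton] at hb
      subst hb
      exact absurd (hM hab) (T.irrefl)

/-- The new vertex is in no finished path, because a finished path contains all its chosen
neighbours and would contain `x`. Of its at most two chosen edges one leads back to `x`, so the
continuation stays unique. -/
theorem IsOpenPath.step [Finite V] {x y : V} (hP : IsClosedSystem T D M P)
    (h : IsOpenPath T D M P q (some x)) (hM : IsLinear T D M) (hy : y ∉ q ++ [x])
    (hxy : s(x, y) ∈ M) : IsOpenPath T D M P (q ++ [x]) (some y) := by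
  have hyP : y ∉ P.flatten := by
    intro hy
    have := hP.mem_of_mk_mem hy (Sym2.eq_swap ▸ hxy : s(y, x) ∈ M)
    exact (List.nodup_append.1 h.nodup).2.2 x this x (by simp) rfl
  refine ⟨?_, ?_, ?_, ?_, ?_, by simp⟩
  · rw [Option.toList_some, List.append_assoc, List.singleton_append, List.isChain_append_cons_cons]
    exact ⟨h.chain, hM.subset hxy, by simp⟩
  · rw [← List.append_assoc, List.nodup_append]
    refine ⟨h.nodup, by simp, fun a ha b hb e => ?_⟩
    have hb' : b = y := by simpa using hb
    subst hb' e
    rcases List.mem_append.1 ha with ha | ha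
    · exact hyP ha
    · exact hy ha
  · intro v hv
    rcases List.mem_append.1 hv with hv | hv
    · exact h.avoid v hv
    · obtain rfl : v = y := by simpa using hv
      exact hM.avoid v x (Sym2.eq_swap ▸ hxy)
  · intro a ha b hab
    rcases List.mem_append.1 ha with ha | ha
    · exact pathEdges_append_subset (h.closed a ha b hab)
    · rw [List.mem_singleton] at ha
      subst ha
      by_cases hbq : b ∈ q
      · exact pathEdges_append_subset (h.mem_of_mk_mem hbq hab)
      · have hyq : y ∉ q := fun h => hy (List.mem_append_left _ h)
        rw [h.unique a rfl b y hbq hyq hab hxy]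
        exact mem_pathEdges.2 ⟨q, [], a, y, by simp, rfl⟩
  · rintro z hz a b ha hb hza hzb
    obtain rfl : y = z := by simpa using hz
    by_contra hab
    have hax : a ≠ x := fun e => ha (by simp [e])
    have hbx : b ≠ x := fun e => hb (by simp [e])
    have hsub : ({x, a, b} : Set V) ⊆ {w | s(y, w) ∈ M} := by
      rintro w (rfl | rfl | rfl)
      · exact (Sym2.eq_swap ▸ hxy : s(y, w) ∈ M)
      · exact hza
      · exact hzb
    have h3 := Set.ncard_le_ncard hsub (Set.toFinite _)
    rw [Set.ncard_eq_three.2 ⟨x, a, b, hax.symm, hbx.symm, hab, rfl⟩] at h3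
    have := hM.degree_le y
    rw [edgeDegree] at this
    omega

/-- A closed system that contains all vertices with less than two edges of `M` contains all
vertices. -/
theorem IsClosedSystem.mem_flatten [Finite V] (hT : T.IsAcyclic) (h : IsClosedSystem T D M P)
    (hM : IsLinear T D M) (hend : ∀ v, v ∉ D → edgeDegree M v < 2 → v ∈ P.flatten) {v : V}
    (hv : v ∉ D) : v ∈ P.flatten := by
  by_contra hvP
  -- Chosen edges at an unreached vertex lead to unreached vertices. A vertex with at most one
  -- unreached neighbour thus has at most one chosen edge and should have been reached.
  obtain ⟨u, ⟨huD, huP⟩, huniq⟩ := exists_atMostOne_neighbor hT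
    (U := {v | v ∉ D ∧ v ∉ P.flatten}) ⟨v, hv, hvP⟩
  refine huP (hend u huD (Nat.lt_succ_of_le ((Set.ncard_le_one (Set.toFinite _)).2 fun a ha b hb => ?_)))
  have hmem : ∀ c, s(u, c) ∈ M → c ∈ {v | v ∉ D ∧ v ∉ P.flatten} := fun c hc =>
    ⟨hM.avoid c u (Sym2.eq_swap ▸ hc), fun hcP =>
      huP (h.mem_of_mk_mem hcP (Sym2.eq_swap ▸ hc : s(c, u) ∈ M))⟩
  exact huniq a (hmem a ha) b (hmem b hb) (hM.subset ha) (hM.subset hb)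

end Traversal


/-! ### The tracing of a single path as a program -/

section TraversalProgram

variable {n : ℕ} {T : SimpleGraph (Fin n)} {adj : Fin n → List (Fin n)}

theorem IsAdjacencyList.length_le (hadj : IsAdjacencyList T adj) (v : Fin n) :
    (adj v).length ≤ n := by
  simpa using (hadj v).1.length_le_card

/-- Register 20 receives the code of an unvisited vertex that is joined to the vertex in register
21 by a recorded edge. -/
def nextProg : Program :=
  .forList 0 1 21 22 23 (.cond (.get 8 (.reg 23)) .skip
    (.cond (.eq (.get 6 (.reg 21)) (.succ (.reg 23))) (.set 20 (.succ (.reg 23)))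
      (.cond (.eq (.get 6 (.reg 23)) (.succ (.reg 21))) (.set 20 (.succ (.reg 23))) .skip)))

theorem wp_nextProg (hadj : IsAdjacencyList T adj) {s : State} (h : HoldsInput adj s) {x : Fin n}
    (hx : s.reg 21 = x) (h0 : s.reg 20 = 0)
    (hM : (recorded (s.arr 6) : Set (Sym2 (Fin n))) ⊆ T.edgeSet) :
    WP nextProg s fun t s' => t ≤ 60 * (n + 1) ∧
      ((s'.reg 20 = 0 ∧ ∀ u : Fin n, s.arr 8 u = 0 → s(x, u) ∉ recorded (s.arr 6)) ∨
        ∃ y : Fin n, s'.reg 20 = y + 1 ∧ s.arr 8 y = 0 ∧ s(x, y) ∈ recorded (s.arr 6)) := by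
  refine wp_forList (f := Fin.val) (L := adj x) (fun done s1 =>
      (s1.reg 20 = 0 ∧ ∀ u ∈ done, s.arr 8 u = 0 → s(x, u) ∉ recorded (s.arr 6)) ∨
        ∃ y : Fin n, s1.reg 20 = y + 1 ∧ s.arr 8 y = 0 ∧ s(x, y) ∈ recorded (s.arr 6)) 40
    (hx ▸ h.stores x) rfl (by decide) rfl rfl rfl (by simp [h0]) ?_ ?_
  · intro done u rest s1 hL hF hI
    have e8 : s1.arr 8 = s.arr 8 := hF.arr 8 rfl
    have e6 : s1.arr 6 = s.arr 6 := hF.arr 6 rfl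
    have e21 : s1.reg 21 = x := (hF.reg 21 rfl).trans hx
    have hcons : (s.arr 8 u = 0 → s(x, u) ∉ recorded (s.arr 6)) → ∀ y,
        (((s1.setReg 23 u).setReg 22 y).reg 20 = 0 ∧ ∀ w ∈ done ++ [u], s.arr 8 w = 0 →
          s(x, w) ∉ recorded (s.arr 6)) ∨
        ∃ z : Fin n, ((s1.setReg 23 u).setReg 22 y).reg 20 = z + 1 ∧ s.arr 8 z = 0 ∧
          s(x, z) ∈ recorded (s.arr 6) := by
      refine fun hu y => hI.imp (fun hI => ⟨by simpa using hI.1, fun w hw => ?_⟩) (by simp)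
      rcases List.mem_append.1 hw with hw | hw
      · exact hI.2 w hw
      · rw [List.mem_singleton.1 hw]
        exact hu
    refine wp_cond (fun he => wp_skip ⟨by simp, hcons fun hu => ?_⟩) fun he => ?_
    · simp [e8] at he
      exact absurd hu he
    simp [e8] at he
    refine wp_cond (fun h1 => wp_set ⟨by simp, fun y => Or.inr ⟨u, by simp, he, ?_⟩⟩) fun h1 =>
      wp_cond (fun h2 => wp_set ⟨by simp, fun y => Or.inr ⟨u, by simp, he, ?_⟩⟩) fun h2 =>
      wp_skip ⟨by simp, hcons fun hu => ?_⟩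
    · simp [e6, e21] at h1
      exact mk_mem_recorded.2 (Or.inl h1)
    · simp [e6, e21] at h2
      exact mk_mem_recorded.2 (Or.inr h2)
    · simp [e6, e21] at h1 h2
      exact fun hm => (mk_mem_recorded.1 hm).elim h1 h2
  · intro t s1 hF hI ht
    have := hadj.length_le x
    refine ⟨by nlinarith, hI.imp (fun hI => ⟨hI.1, fun u hu hm => hI.2 u ?_ hu hm⟩) id⟩
    exact ((hadj x).2 u).2 (hM hm)

/-- Array 9 holds the list `F`, and the vertices of `F` and those with `dead v ≠ 0` are marked in
array 8. -/
structure Visited (dead : ℕ → ℕ) (s : State) (F : List (Fin n)) : Prop where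
  length : s.reg 18 = F.length
  get : ∀ j (h : j < F.length), s.arr 9 j = F[j]
  mark : ∀ v : Fin n, s.arr 8 v = 0 ↔ dead v = 0 ∧ v ∉ F

theorem Visited.append {dead : ℕ → ℕ} {s s' : State} {F : List (Fin n)} (h : Visited dead s F)
    {x : Fin n} (h18 : s'.reg 18 = s.reg 18 + 1)
    (h9 : s'.arr 9 = Function.update (s.arr 9) (s.reg 18) x)
    (h8 : s'.arr 8 = Function.update (s.arr 8) x 1) : Visited dead s' (F ++ [x]) := by
  refine ⟨by simp [h18, h.length], fun j hj => ?_, fun v => ?_⟩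
  · rw [h9, h.length]
    rcases Nat.lt_succ_iff_lt_or_eq.1 (by simpa using hj : j < F.length + 1) with hj' | rfl
    · rw [Function.update_of_ne hj'.ne, h.get j hj', List.getElem_append_left hj']
    · simp
  · rw [h8]
    by_cases hvx : v = x
    · simp [hvx]
    · rw [Function.update_of_ne (Fin.val_ne_of_ne hvx), h.mark]
      simp [hvx]

/-- Register 20 holds the code of the vertex to be visited next, and 0 at the end of the path.
Visited vertices are appended to array 9, whose used length is in register 18, and marked in array
8. -/
def visitProg : Program :=
  .seq (.set 21 (.sub (.reg 20) (.lit 1))) (.seq (.store 8 (.reg 21) (.lit 1))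
    (.seq (.store 9 (.reg 18) (.reg 21)) (.seq (.set 18 (.succ (.reg 18)))
      (.seq (.set 20 (.lit 0)) nextProg))))

theorem wp_pathProg (hadj : IsAdjacencyList T adj) {s : State} (h : HoldsInput adj s)
    {dead : ℕ → ℕ} {P : List (List (Fin n))} {v : Fin n}
    (hM : IsLinear T {v : Fin n | dead v ≠ 0} (recorded (s.arr 6)))
    (hP : IsClosedSystem T {v : Fin n | dead v ≠ 0} (recorded (s.arr 6)) P)
    (hv : IsOpenPath T {v : Fin n | dead v ≠ 0} (recorded (s.arr 6)) P [] (some v))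
    (h20 : s.reg 20 = v + 1) (hvis : Visited dead s P.flatten) :
    WP (.loop (.reg 20) visitProg) s fun t s' => ∃ q,
      IsClosedSystem T {v : Fin n | dead v ≠ 0} (recorded (s.arr 6)) (P ++ [q]) ∧
      Visited dead s' (P ++ [q]).flatten ∧ v ∈ q ∧ t ≤ 100 * (n + 1) * q.length + 2 := by
  -- The loop ends because the visited vertices are distinct, so the used length of array 9 cannot
  -- exceed `n`. Every visit costs one scan of an adjacency list.
  refine wp_loop (fun t s1 => ∃ q c,
    IsOpenPath T {v : Fin n | dead v ≠ 0} (recorded (s.arr 6)) P q c ∧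
    s1.reg 20 = c.elim 0 (fun x : Fin n => x.val + 1) ∧ Visited dead s1 (P.flatten ++ q) ∧
    v ∈ q ++ c.toList ∧ t ≤ 100 * (n + 1) * q.length) (fun s1 => n - s1.reg 18) ?_ ?_ ?_
  · exact ⟨[], some v, hv, by simpa using h20, by simpa using hvis, by simp, by simp⟩
  · rintro t s1 hF ⟨q, c, h1, h2, h3, h4, h5⟩ he
    obtain ⟨x, rfl⟩ : ∃ x, c = some x := by
      cases c with
      | none => simp [h2] at he
      | some x => exact ⟨x, rfl⟩
    have e6 : s1.arr 6 = s.arr 6 := hF.arr 6 rfl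
    have hin := h.frame hF rfl rfl rfl
    have hlen : s1.reg 18 < n := by
      have := h1.nodup.length_le_card
      simp at this
      rw [h3.length, List.length_append, List.length_flatten]
      omega
    refine wp_seq (wp_set (wp_seq (wp_store (wp_seq (wp_store (wp_seq (wp_set (wp_seq
      (wp_set ?_)))))))))
    refine (wp_nextProg hadj (x := x) ?_ ?_ ?_ ?_).mono fun t' s2 hF2 ⟨ht', hn⟩ => ?_
    · exact ((((hin.setReg _ (by decide)).setArr _ _ (by decide) (by decide)).setArr _ _ (by decide)
        (by decide)).setReg _ (by decide)).setReg _ (by decide)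
    · simp [h2]
    · simp
    · simpa [e6] using hM.subset
    have hvis2 : Visited dead s2 (P.flatten ++ (q ++ [x])) := by
      rw [← List.append_assoc]
      refine h3.append ((hF2.reg 18 rfl).trans ?_) ((hF2.arr 9 rfl).trans ?_)
        ((hF2.arr 8 rfl).trans ?_)
      · simp
      · simp [h2]
      · simp [h2]
    have hmark : ∀ w : Fin n, s2.arr 8 w = 0 ↔ dead w = 0 ∧ w ∉ P.flatten ++ (q ++ [x]) := hvis2.mark
    have e8 := hF2.arr 8 rfl
    rw [← e8] at hn
    have hpos : s2.reg 18 = s1.reg 18 + 1 := (hF2.reg 18 rfl).trans (by simp)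
    simp only [State.setReg_arr, State.setArr_arr] at hn
    simp only [show (6 : ℕ) ≠ 9 by decide, show (6 : ℕ) ≠ 8 by decide, if_false, e6] at hn
    refine ⟨?_, by omega⟩
    have htime : t + ((RamExpr.reg 20).cost + 1 + (((RamExpr.reg 20).sub (RamExpr.lit 1)).cost + 1 +
        ((RamExpr.reg 21).cost + (RamExpr.lit 1).cost + 1 + ((RamExpr.reg 18).cost +
        (RamExpr.reg 21).cost + 1 + ((RamExpr.reg 18).succ.cost + 1 + ((RamExpr.lit 0).cost + 1 +
        t')))))) ≤ 100 * (n + 1) * (q ++ [x]).length := by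
      simp only [RamExpr.cost, List.length_append, List.length_singleton]
      rw [Nat.mul_add]
      omega
    rcases hn with ⟨h7, h8⟩ | ⟨y, h7, h8, h9⟩
    · refine ⟨q ++ [x], none, h1.close hM.subset fun y hy hxy => h8 y ?_ hxy, by simpa using h7,
        hvis2, by simpa using h4, htime⟩
      rw [hmark]
      refine ⟨?_, fun hm => ?_⟩
      · by_contra hd
        exact hM.avoid y x (Sym2.eq_swap ▸ hxy) hd
      · rcases List.mem_append.1 hm with hm | hm
        · have := hP.mem_of_mk_mem hm (Sym2.eq_swap ▸ hxy : s(y, x) ∈ recorded (s.arr 6))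
          exact (List.nodup_append.1 h1.nodup).2.2 x this x (by simp) rfl
        · exact hy hm
    · have hy := ((hmark y).1 h8).2
      refine ⟨q ++ [x], some y, h1.step hP hM (fun hm => hy (List.mem_append_right _ hm)) h9,
        by simpa using h7, hvis2, ?_, htime⟩
      exact List.mem_append_left _ (by simpa using h4)
  · rintro t s1 hF ⟨q, c, h1, h2, h3, h4, h5⟩ he
    obtain rfl : c = none := by
      cases c with
      | none => rfl
      | some x => simp [h2] at he
    refine ⟨q, h1.finish hP, by simpa using h3, by simpa using h4, ?_⟩
    simp only [RamExpr.cost]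
    omega

end TraversalProgram


/-! ### Tracing all paths -/

section TraversalProgram

variable {n : ℕ} {T : SimpleGraph (Fin n)} {adj : Fin n → List (Fin n)}

theorem stores_of_flatten {α : Type*} {f : α → ℕ} {a b : ℕ → ℕ} {P : List (List α)}
    (ha : ∀ k ≤ P.length, a k = (P.take k).flatten.length)
    (hb : ∀ j (h : j < P.flatten.length), b j = f P.flatten[j]) {k : ℕ} (hk : k < P.length) :
    Stores f a b k P[k] := by
  have hsplit : (P.take (k + 1)).flatten = (P.take k).flatten ++ P[k] := by
    rw [List.take_succ_eq_append_getElem hk, List.flatten_append, List.flatten_singleton]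
  have hall : P.flatten = (P.take k).flatten ++ (P[k] ++ (P.drop (k + 1)).flatten) := by
    conv_lhs => rw [← List.take_append_drop (k + 1) P, List.flatten_append, hsplit]
    simp
  refine ⟨?_, fun j hj => ?_⟩
  · rw [ha _ hk, ha _ hk.le, hsplit, List.length_append]
  · rw [ha _ hk.le, hb _ (by rw [hall]; simp only [List.length_append]; omega)]
    congr 1
    simp only [hall]
    rw [List.getElem_append_right (by omega), List.getElem_append_left (by simpa using hj)]
    simp

/-- Paths are started only at unvisited vertices with fewer than two chosen edges, that is, at ends.
Array 10 stores where each path begins in array 9. -/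
def traverseStep : Program :=
  .cond (.get 8 (.reg 19)) .skip (.cond (.lt (.get 7 (.reg 19)) (.lit 2))
    (.seq (.set 20 (.succ (.reg 19))) (.seq (.loop (.reg 20) visitProg)
      (.seq (.set 17 (.succ (.reg 17))) (.store 10 (.reg 17) (.reg 18))))) .skip)

def traverseProg : Program :=
  .seq (.set 17 (.lit 0)) (.seq (.set 18 (.lit 0)) (.seq (.store 10 (.lit 0) (.lit 0))
    (.forTo 19 0 traverseStep)))

theorem wp_traverseProg (hT : T.IsAcyclic) (hadj : IsAdjacencyList T adj) {s : State}
    (h : HoldsInput adj s) {dead : ℕ → ℕ} (h8 : ∀ v : Fin n, s.arr 8 v = dead v)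
    (hM : IsLinear T {v : Fin n | dead v ≠ 0} (recorded (s.arr 6)))
    (h7 : ∀ v : Fin n, s.arr 7 v = edgeDegree (recorded (s.arr 6) : Set (Sym2 (Fin n))) v) :
    WP traverseProg s fun t s' => t ≤ 200 * (n + 1) ^ 2 ∧ ∃ P,
      IsClosedSystem T {v : Fin n | dead v ≠ 0} (recorded (s.arr 6)) P ∧
      (∀ v : Fin n, dead v = 0 → v ∈ P.flatten) ∧ s'.reg 17 = P.length ∧
      ∀ k (hk : k < P.length), Stores Fin.val (s'.arr 10) (s'.arr 9) k P[k] := by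
  refine wp_seq (wp_set (wp_seq (wp_set (wp_seq (wp_store ?_)))))
  -- The time for tracing is charged to the visited vertices. As these are distinct, the total stays
  -- quadratic although tracing may be started in every round.
  refine wp_forTo_time (m := n) (fun i t s1 => ∃ P,
    IsClosedSystem T {v : Fin n | dead v ≠ 0} (recorded (s.arr 6)) P ∧
    (∀ v : Fin n, dead v = 0 → v.val < i → edgeDegree (recorded (s.arr 6)) v < 2 →
      v ∈ P.flatten) ∧ s1.reg 17 = P.length ∧ Visited dead s1 P.flatten ∧
    (∀ k ≤ P.length, s1.arr 10 k = (P.take k).flatten.length) ∧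
    t ≤ 100 * (n + 1) * P.flatten.length + 60 * i) (by simpa using h.size) rfl rfl ?_ ?_ ?_
  · refine ⟨[], isClosedSystem_nil, by simp, by simp, ⟨by simp, by simp, ?_⟩, by simp, by simp⟩
    simp [h8]
  · rintro i t s1 hi hF hi' ⟨P, hI1, hI2, hI3, hI4, hI5, hI6⟩
    have e6 : s1.arr 6 = s.arr 6 := (hF.arr 6 rfl).trans (by simp)
    have e7 : s1.arr 7 = s.arr 7 := (hF.arr 7 rfl).trans (by simp)
    have hin : HoldsInput adj s1 := by
      refine HoldsInput.frame ?_ hF rfl rfl rfl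
      exact ((h.setReg _ (by decide)).setReg _ (by decide)).setArr _ _ (by decide) (by decide)
    have hkeep : ∀ t' ≤ 40, (s1.arr 8 i ≠ 0 ∨ 2 ≤ s.arr 7 i) → ∃ P,
        IsClosedSystem T {v : Fin n | dead v ≠ 0} (recorded (s.arr 6)) P ∧
        (∀ v : Fin n, dead v = 0 → v.val < i + 1 → edgeDegree (recorded (s.arr 6)) v < 2 →
          v ∈ P.flatten) ∧ (s1.setReg 19 (i + 1)).reg 17 = P.length ∧
        Visited dead (s1.setReg 19 (i + 1)) P.flatten ∧
        (∀ k ≤ P.length, (s1.setReg 19 (i + 1)).arr 10 k = (P.take k).flatten.length) ∧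
        t + t' + 7 ≤ 100 * (n + 1) * P.flatten.length + 60 * (i + 1) := by
      intro t' ht' hcase
      refine ⟨P, hI1, fun v hv hvi hdeg => ?_, by simpa using hI3,
        ⟨by simpa using hI4.length, hI4.get, hI4.mark⟩, hI5, by omega⟩
      rcases Nat.lt_succ_iff_lt_or_eq.1 hvi with hvi | hvi
      · exact hI2 v hv hvi hdeg
      · by_contra hvP
        rw [← hvi] at hcase
        rcases hcase with h1 | h1
        · exact h1 ((hI4.mark v).2 ⟨hv, hvP⟩)
        · rw [h7] at h1
          omega
    refine wp_cond (fun he => wp_skip ?_) fun he => wp_cond (fun h2 => ?_) fun h2 => wp_skip ?_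
    · simp [hi'] at he
      exact hkeep _ (by simp) (Or.inl he)
    · simp [hi'] at he
      simp [hi', e7] at h2
      obtain ⟨v, rfl⟩ : ∃ v : Fin n, v.val = i := ⟨⟨i, hi⟩, rfl⟩
      have hv := (hI4.mark v).1 he
      refine wp_seq (wp_set (wp_seq ?_))
      refine (wp_pathProg hadj (v := v) (dead := dead) (P := P) (hin.setReg _ (by decide)) ?_ ?_ ?_
        ?_ ?_).mono ?_
      · simpa [e6] using hM
      · simpa [e6] using hI1
      · simp only [State.setReg_arr, e6]
        refine isOpenPath_start hI1 (by simpa using hv.1) hv.2 ?_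
        rw [← h7]
        omega
      · simp [hi']
      · exact ⟨by simpa using hI4.length, hI4.get, hI4.mark⟩
      · rintro t' s2 hF2 ⟨q, h3, h4, h5, h6⟩
        have h17 : s2.reg 17 = P.length := (hF2.reg 17 rfl).trans (by simpa using hI3)
        have h10 : s2.arr 10 = s1.arr 10 := hF2.arr 10 rfl
        simp only [State.setReg_arr, e6] at h3
        refine wp_seq (wp_set (wp_store ⟨P ++ [q], h3, fun w hw hwi hdeg => ?_, by simp [h17],
          ⟨by simpa using h4.length, by simpa using h4.get, by simpa using h4.mark⟩,
          fun k hk => ?_, ?_⟩))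
        · rw [List.flatten_append, List.mem_append]
          rcases Nat.lt_succ_iff_lt_or_eq.1 hwi with hwi | hwi
          · exact Or.inl (hI2 w hw hwi hdeg)
          · exact Or.inr (by simpa [Fin.ext hwi] using h5)
        · simp only [List.length_append, List.length_singleton] at hk
          rcases Nat.lt_or_ge k (P.length + 1) with hk' | hk'
          · have := hI5 k (by omega)
            simpa [h17, h10, Function.update_apply, hk'.ne, List.take_append_of_le_length
              (Nat.lt_succ_iff.1 hk')] using this
          · obtain rfl : k = P.length + 1 := by omega
            have := h4.length
            rw [List.take_of_length_le (by simp)]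
            simpa [h17] using this
        · simp only [RamExpr.cost, List.flatten_append, List.flatten_singleton, List.length_append] at h6 ⊢
          rw [Nat.mul_add (100 * (n + 1))]
          omega
    · simp [hi', e7] at h2
      exact hkeep _ (by simp) (Or.inr h2)
  · rintro t s1 hF ⟨P, hI1, hI2, hI3, hI4, hI5, hI6⟩
    have hlen : P.flatten.length ≤ n := by
      simpa using hI1.isPathSystem.nodup_flatten.length_le_card
    refine ⟨?_, P, hI1, fun v hv => ?_, hI3, fun k hk => stores_of_flatten hI5 hI4.get hk⟩
    · simp only [RamExpr.cost]
      nlinarith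
    · refine hI1.mem_flatten hT hM (fun w hw hdeg => hI2 w ?_ w.2 hdeg) (by simpa using hv)
      simpa using hw

end TraversalProgram


/-! ### From a maximum edge set to a minimum path cover and its interiority -/

section OptimalCover

variable {V : Type*} {T : SimpleGraph V}

theorem IsPathSystem.isLinear_map_val [Finite V] {removed : List V}
    {Q : List (List {v // v ∉ removed})} (hQ : IsPathSystem (pruned T removed) Q) :
    IsLinear T {v | v ∈ removed} (systemEdges (Q.map (List.map Subtype.val))) := by
  have h := isPathSystem_map_val_iff.2 hQ
  refine ⟨h.systemEdges_subset, ?_, h.edgeDegree_le⟩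
  rintro v w ⟨p, hp, hvw⟩
  obtain ⟨q, -, rfl⟩ := List.mem_map.1 hp
  obtain ⟨x, -, hx⟩ := List.mem_map.1 (mem_of_mem_pathEdges hvw (Sym2.mem_mk_left v w))
  exact hx ▸ x.2

variable {removed : List V} {M : Set (Sym2 V)} {P : List (List {v // v ∉ removed})}

theorem subset_systemEdges (hM : IsLinear T {v | v ∈ removed} M)
    (hP : IsClosedSystem T {v | v ∈ removed} M (P.map (List.map Subtype.val)))
    (hcov : ∀ v, v ∉ removed → v ∈ (P.map (List.map Subtype.val)).flatten) :
    M ⊆ systemEdges (P.map (List.map Subtype.val)) := by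
  intro e
  induction e using Sym2.ind with
  | _ a b => exact fun hab => hP.closed a (hcov a (hM.avoid a b hab)) b hab

variable [Finite V]

/-- Paths and edges of a cover together number as many as the vertices, so the most edges give the
fewest paths. -/
theorem isMinPathCover_of_isClosedSystem (hT : T.IsAcyclic) (hM : IsLinear T {v | v ∈ removed} M)
    (hmax : ∀ N, IsLinear T {v | v ∈ removed} N → N.ncard ≤ M.ncard)
    (hP : IsClosedSystem T {v | v ∈ removed} M (P.map (List.map Subtype.val)))
    (hcov : ∀ v, v ∉ removed → v ∈ (P.map (List.map Subtype.val)).flatten) :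
    IsMinPathCover (pruned T removed) P := by
  have hT' := isAcyclic_pruned hT removed
  have h1 := isPathSystem_map_val_iff.1 hP.isPathSystem
  have h2 : ∀ v, ∃ p ∈ P, v ∈ p := by
    intro v
    have := hcov v v.2
    rw [← List.map_flatten] at this
    obtain ⟨w, hw, hwv⟩ := List.mem_map.1 this
    obtain ⟨p, hp, hwp⟩ := List.mem_flatten.1 hw
    exact ⟨p, hp, Subtype.ext hwv ▸ hwp⟩
  refine ⟨(isPathCover_iff hT').2 ⟨h1, h2⟩, fun Q hQ => ?_⟩
  obtain ⟨h3, h4⟩ := (isPathCover_iff hT').1 hQ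
  have h5 := (isPathSystem_map_val_iff.2 h3).ncard_systemEdges.2
  have h6 := hP.isPathSystem.ncard_systemEdges.2
  rw [← List.map_flatten, List.length_map, List.length_map, length_flatten_of_cover h3 h4] at h5
  rw [← List.map_flatten, List.length_map, List.length_map, length_flatten_of_cover h1 h2] at h6
  have h7 := hmax _ h3.isLinear_map_val
  have h8 := Set.ncard_le_ncard (subset_systemEdges hM hP hcov) (Set.toFinite _)
  omega

/-- By maximality `M` is the whole edge set of the cover, so its degrees decide interiority.
Vertices with two chosen edges need no test. -/
theorem isInteriorCover_iff_of_isClosedSystem (hT : T.IsAcyclic)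
    (hM : IsLinear T {v | v ∈ removed} M)
    (hmax : ∀ N, IsLinear T {v | v ∈ removed} N → N.ncard ≤ M.ncard)
    (hP : IsClosedSystem T {v | v ∈ removed} M (P.map (List.map Subtype.val)))
    (hcov : ∀ v, v ∉ removed → v ∈ (P.map (List.map Subtype.val)).flatten) :
    IsInteriorCover (pruned T removed) P ↔ ∀ v, v ∉ removed → edgeDegree M v < 2 →
      edgeDegree M v = {w | T.Adj v w ∧ w ∉ removed}.ncard := by
  have hT' := isAcyclic_pruned hT removed
  obtain ⟨h1, h2⟩ := (isPathCover_iff hT').1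
    (isMinPathCover_of_isClosedSystem hT hM hmax hP hcov).1
  have hMP : M = systemEdges (P.map (List.map Subtype.val)) :=
    Set.eq_of_subset_of_ncard_le (subset_systemEdges hM hP hcov) (hmax _ h1.isLinear_map_val)
      (Set.toFinite _)
  have hdeg : ∀ v : {v // v ∉ removed}, edgeDegree (systemEdges P) v = edgeDegree M v.val := by
    intro v
    obtain ⟨p, hp, hv⟩ := h2 v
    obtain ⟨L, R, rfl⟩ := List.append_of_mem hv
    rw [hMP, h1.edgeDegree_eq hp, hP.isPathSystem.edgeDegree_eq (L := L.map Subtype.val)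
      (R := R.map Subtype.val) (List.mem_map.2 ⟨_, hp, by simp⟩), List.length_map, List.length_map]
  have hnb : ∀ v : {v // v ∉ removed}, ((pruned T removed).neighborSet v).ncard =
      {w | T.Adj v w ∧ w ∉ removed}.ncard := by
    intro v
    rw [← Set.ncard_image_of_injective _ Subtype.val_injective]
    congr 1
    ext w
    constructor
    · rintro ⟨x, hx, rfl⟩
      exact ⟨hx, x.2⟩
    · rintro ⟨h, hw⟩
      exact ⟨⟨w, hw⟩, h, rfl⟩
  rw [isInteriorCover_iff hT' h1 h2]
  constructor
  · intro h v hv hlt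
    have := h ⟨v, hv⟩
    rw [hdeg, hnb] at this
    simp only at this
    omega
  · intro h v
    have h3 := hM.degree_le v
    have h4 := edgeDegree_le_ncard h1.systemEdges_subset v
    have h5 := h v v.2
    rw [hdeg] at h4 ⊢
    rw [hnb] at h4 ⊢
    omega

end OptimalCover

/-! ### The check of a path in terms of colours -/

section Coloring

variable {V : Type*} {T : SimpleGraph V}

/-- The ends of a path lie in one component, so equal colours yield an automorphism; invariance of
the colouring gives the converse. -/
theorem pathCheck_iff_of_isEquitable [Finite V] (hT : T.IsAcyclic) {α : Type*} {f : V → α}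
    (hf : IsEquitable T f) (hinv : ∀ (φ : T ≃g T) v, f (φ v) = f v) {p : List V}
    (hp : IsPathList T p) : PathCheck T p ↔ f (p.head hp.ne_nil) = f (p.getLast hp.ne_nil) := by
  rw [pathCheck_iff hT hp]
  constructor
  · rintro ⟨φ, hφ⟩
    rw [← hφ, hinv]
  · exact hf.exists_iso hT
      (reachable_of_isChain hp.chain (List.head_mem _) (List.getLast_mem _))

end Coloring


/-! ### Colour refinement in which every colour is used once -/

section StableColoring

variable {V : Type*} {T : SimpleGraph V} {col col' : V → ℕ} {c : ℕ}

/-- The colours below `c` have been used for refinement: each such colour class is contained in a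
union of classes whose other colours are at least `c` and with respect to which vertices of the same
colour have equally many neighbours. -/
def IsStableBelow (T : SimpleGraph V) (col : V → ℕ) (c : ℕ) : Prop :=
  ∀ d < c, ∃ S : Set V, (∀ v, col v = d → v ∈ S) ∧ (∀ v w, col v = col w → v ∈ S → w ∈ S) ∧
    (∀ v ∈ S, col v ≠ d → c ≤ col v) ∧
    ∀ v w, col v = col w → {u | T.Adj v u ∧ u ∈ S}.ncard = {u | T.Adj w u ∧ u ∈ S}.ncard

/-- The class of `c` lies inside `S` or is disjoint from it. In the first case it is cut out of `S`,
and the counts remain equal by subtraction. Parts that split off receive colours above `c` and still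
get their turn, so a class used before need not be used again after it has been split. -/
theorem IsStableBelow.step [Finite V] (h : IsStableBelow T col c)
    (href : ∀ v w, col' v = col' w → col v = col w)
    (hnew : ∀ v, col' v ≠ col v → c + 1 ≤ col' v)
    (hcount : ∀ v w, col' v = col' w →
      {u | T.Adj v u ∧ col u = c}.ncard = {u | T.Adj w u ∧ col u = c}.ncard) :
    IsStableBelow T col' (c + 1) := by
  intro d hd
  rcases Nat.lt_succ_iff_lt_or_eq.1 hd with hd | rfl
  · obtain ⟨S, h1, h2, h3, h4⟩ := h d hd
    refine ⟨{v | v ∈ S ∧ col v ≠ c}, fun v hv => ?_, fun v w hvw hv => ?_, fun v hv hvd => ?_,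
      fun v w hvw => ?_⟩
    · have : col v = d := by
        by_contra hne
        have := hnew v (by omega)
        omega
      exact ⟨h1 v this, by omega⟩
    · have := href v w hvw
      exact ⟨h2 v w this hv.1, this ▸ hv.2⟩
    · by_cases hne : col' v = col v
      · have := h3 v hv.1 (hne ▸ hvd)
        have := hv.2
        omega
      · exact hnew v hne
    · by_cases hcS : ∃ x ∈ S, col x = c
      · obtain ⟨x, hx, hxc⟩ := hcS
        have hsplit : ∀ v, {u | T.Adj v u ∧ u ∈ S}.ncard =
            {u | T.Adj v u ∧ u ∈ {v | v ∈ S ∧ col v ≠ c}}.ncard +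
              {u | T.Adj v u ∧ col u = c}.ncard := by
          intro v
          rw [← Set.ncard_union_eq _ (Set.toFinite _) (Set.toFinite _)]
          · congr 1
            ext u
            simp only [Set.mem_ofPred_eq, Set.mem_union]
            have := h2 x u
            rw [hxc] at this
            constructor
            · rintro ⟨h5, h6⟩
              by_cases h7 : col u = c
              · exact Or.inr ⟨h5, h7⟩
              · exact Or.inl ⟨h5, h6, h7⟩
            · rintro (⟨h5, h6, -⟩ | ⟨h5, h6⟩)
              · exact ⟨h5, h6⟩
              · exact ⟨h5, this h6.symm hx⟩
          · rw [Set.disjoint_left]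
            exact fun u hu hu' => hu.2.2 hu'.2
        have h5 := h4 v w (href v w hvw)
        rw [hsplit, hsplit, hcount v w hvw] at h5
        omega
      · have : {v | v ∈ S ∧ col v ≠ c} = S := by
          ext x
          exact ⟨fun hx => hx.1, fun hx => ⟨hx, fun e => hcS ⟨x, hx, e⟩⟩⟩
        rw [this]
        exact h4 v w (href v w hvw)
  · refine ⟨{v | col v = d}, fun v hv => ?_, fun v w hvw hv => ?_, fun v hv hvd => ?_, hcount⟩
    · by_contra hne
      have := hnew v (fun e => hne (e.symm.trans hv))
      omega
    · exact (href v w hvw).symm.trans hv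
    · exact hnew v fun e => hvd (e.trans hv)

/-- When all colours have been used, none is left for the rest of `S`, so each `S` is a single
colour class. -/
theorem IsStableBelow.isEquitable {num : ℕ} (h : IsStableBelow T col num)
    (hlt : ∀ v, col v < num) : IsEquitable T col := by
  intro v w hvw c
  by_cases hc : c < num
  · obtain ⟨S, h1, -, h3, h4⟩ := h c hc
    have hS : ∀ u, col u = c ↔ u ∈ S := by
      refine fun u => ⟨h1 u, fun hu => ?_⟩
      by_contra hne
      have := h3 u hu hne
      have := hlt u
      omega
    simp only [hS]
    exact h4 v w hvw
  · have hne : ∀ u, col u ≠ c := fun u e => hc (e ▸ hlt u)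
    simp [hne]

/-- A colouring with `num` colours, each with a representative, that does not distinguish vertices
of the same orbit. -/
structure IsOrbitColoring {n : ℕ} (T : SimpleGraph (Fin n)) (col : Fin n → ℕ) (rep : ℕ → ℕ)
    (num : ℕ) : Prop where
  lt : ∀ v, col v < num
  rep_spec : ∀ d < num, ∃ r : Fin n, rep d = r ∧ col r = d
  invariant : ∀ (φ : T ≃g T) v, col (φ v) = col v

/-- Representatives of different colours are distinct. This bounds the number of refinement steps
and the number of relabellings. -/
theorem IsOrbitColoring.num_le {n : ℕ} {T : SimpleGraph (Fin n)} {col : Fin n → ℕ} {rep : ℕ → ℕ}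
    {num : ℕ} (h : IsOrbitColoring T col rep num) : num ≤ n := by
  have : Function.Injective fun i : Fin num => (h.rep_spec i i.2).choose := by
    intro i j hij
    have h1 := (h.rep_spec i i.2).choose_spec.2
    have h2 := (h.rep_spec j j.2).choose_spec.2
    simp only at hij
    rw [hij, h2] at h1
    exact Fin.ext h1.symm
  simpa using Nat.card_le_card_of_injective _ this

/-- The vertices `w` with the colour and the count of `v` receive the new colour `num`. -/
theorem IsOrbitColoring.split {n : ℕ} {T : SimpleGraph (Fin n)} {col col' cnt : Fin n → ℕ}
    {rep : ℕ → ℕ} {num : ℕ} (h : IsOrbitColoring T col rep num)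
    (hcnt : ∀ (φ : T ≃g T) v, cnt (φ v) = cnt v) {v r : Fin n} (hr : rep (col v) = r)
    (hne : cnt v ≠ cnt r)
    (hcol' : ∀ w, col' w = if col w = col v ∧ cnt w = cnt v then num else col w) :
    IsOrbitColoring T col' (Function.update rep num v) (num + 1) := by
  refine ⟨fun w => ?_, fun d hd => ?_, fun φ w => ?_⟩
  · rw [hcol']
    have := h.lt w
    split_ifs <;> omega
  · rcases Nat.lt_succ_iff_lt_or_eq.1 hd with hd | rfl
    · obtain ⟨x, hx, hxd⟩ := h.rep_spec d hd
      refine ⟨x, by rw [Function.update_of_ne hd.ne, hx], ?_⟩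
      rw [hcol', if_neg, hxd]
      rintro ⟨h1, h2⟩
      -- The representative of the class that is split has another count than `v`, so it keeps its
      -- colour and no class becomes empty.
      have : x = r := by
        rw [← h1, hxd, hx] at hr
        exact Fin.ext hr
      exact hne (this ▸ h2.symm)
    · exact ⟨v, Function.update_self _ _ _, by rw [hcol', if_pos ⟨rfl, rfl⟩]⟩
  · rw [hcol', hcol', h.invariant, hcnt]

end StableColoring


/-! ### Colour refinement as a program -/

section RefinementProgram

variable {n : ℕ} {T : SimpleGraph (Fin n)} {adj : Fin n → List (Fin n)}

theorem IsAdjacencyList.length_filter (hadj : IsAdjacencyList T adj) (v : Fin n)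
    (p : Fin n → Prop) [DecidablePred p] :
    ((adj v).filter p).length = {u | T.Adj v u ∧ p u}.ncard := by
  rw [← List.toFinset_card_of_nodup ((hadj v).1.filter _), ← Set.ncard_coe_finset]
  congr 1
  ext w
  simp [(hadj v).2]

/-- Array 11 holds the colours and array 12 their representatives; register 26 holds the number of
colours and register 27 the colour used for refinement. The counts of neighbours with that colour go
to array 13. -/
def countProg : Program :=
  .forTo 28 0 (.seq (.set 31 (.lit 0)) (.seq (.forList 0 1 28 29 30
    (.cond (.eq (.get 11 (.reg 30)) (.reg 27)) (.set 31 (.succ (.reg 31))) .skip))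
    (.store 13 (.reg 28) (.reg 31))))

theorem wp_countProg (hadj : IsAdjacencyList T adj) {s : State} (h : HoldsInput adj s) {c : ℕ}
    (hc : s.reg 27 = c) :
    WP countProg s fun t s' => t ≤ 200 * (n + 1) ∧
      ∀ v : Fin n, s'.arr 13 v = {u : Fin n | T.Adj v u ∧ s.arr 11 u = c}.ncard := by
  refine wp_forTo_sum h
    (fun i s1 => ∀ v : Fin n, v.val < i →
      s1.arr 13 v = ((adj v).filter fun u : Fin n => s.arr 11 u = c).length)
    50 h.size rfl rfl (by simp) ?_ ?_
  · intro v s1 hF hv hI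
    have hin := h.frame hF rfl rfl rfl
    have e11 : s1.arr 11 = s.arr 11 := hF.arr 11 rfl
    have e27 : s1.reg 27 = c := (hF.reg 27 rfl).trans hc
    refine wp_seq (wp_set (wp_seq ?_))
    refine wp_forList (f := Fin.val) (L := adj v)
      (fun done s2 => s2.reg 31 = (done.filter fun u : Fin n => s.arr 11 u = c).length) 30 ?_ rfl
      (by decide) rfl rfl rfl ?_ ?_ ?_
    · simpa [hv] using hin.stores v
    · simp
    · intro done x rest s2 hL hF2 hI2
      have e11' : s2.arr 11 = s.arr 11 := (hF2.arr 11 rfl).trans e11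
      have e27' : s2.reg 27 = c := (hF2.reg 27 rfl).trans (by simpa using e27)
      refine wp_cond (fun he => wp_set ?_) (fun he => wp_skip ?_)
      · simp [e11', e27'] at he
        simp [he, hI2]
      · simp [e11', e27'] at he
        simp [he, hI2]
    · intro t s2 hF2 hI2 ht
      have h13 : s2.arr 13 = s1.arr 13 := hF2.arr 13 rfl
      have hv2 : s2.reg 28 = v := (hF2.reg 28 rfl).trans (by simpa using hv)
      refine wp_store ⟨?_, fun w hw => ?_⟩
      · simp
        omega
      · by_cases hwv : w = v
        · subst hwv
          simp [hv2, hI2]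
        · simpa [hv2, hI2, h13, Function.update_apply, Fin.val_inj, hwv] using hI w
            (by have := Fin.val_ne_of_ne hwv; omega)
  · intro t s1 hF hI ht
    refine ⟨by omega, fun v => ?_⟩
    rw [hI v v.2, hadj.length_filter]

def relabelProg : Program :=
  .forTo 33 0 (.cond (.eq (.get 11 (.reg 33)) (.reg 34)) (.cond (.eq (.get 13 (.reg 33)) (.reg 35))
    (.store 11 (.reg 33) (.reg 26)) .skip) .skip)

theorem wp_relabelProg {s : State} (h : s.reg 0 = n) :
    WP relabelProg s fun t s' => t ≤ 40 * (n + 1) ∧ ∀ w : Fin n, s'.arr 11 w =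
      if s.arr 11 w = s.reg 34 ∧ s.arr 13 w = s.reg 35 then s.reg 26 else s.arr 11 w := by
  refine wp_forTo (m := n) (fun i s1 => ∀ w : Fin n, s1.arr 11 w =
    if w.val < i ∧ s.arr 11 w = s.reg 34 ∧ s.arr 13 w = s.reg 35 then s.reg 26 else s.arr 11 w) 30
    h rfl rfl (by simp) ?_ ?_
  · intro i s1 hi hF hi' hI
    have e13 : s1.arr 13 = s.arr 13 := hF.arr 13 rfl
    have e34 : s1.reg 34 = s.reg 34 := hF.reg 34 rfl
    have e35 : s1.reg 35 = s.reg 35 := hF.reg 35 rfl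
    have e26 : s1.reg 26 = s.reg 26 := hF.reg 26 rfl
    have hIi := hI ⟨i, hi⟩
    simp only [lt_irrefl, false_and, if_false] at hIi
    have hkeep : ∀ w : Fin n, ¬ (w.val = i ∧ s.arr 11 w = s.reg 34 ∧ s.arr 13 w = s.reg 35) →
        s1.arr 11 w = if w.val < i + 1 ∧ s.arr 11 w = s.reg 34 ∧ s.arr 13 w = s.reg 35 then
          s.reg 26 else s.arr 11 w := by
      intro w hw
      rw [hI]
      congr 1
      rw [eq_iff_iff]
      constructor
      · rintro ⟨h1, h2⟩
        exact ⟨by omega, h2⟩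
      · rintro ⟨h1, h2⟩
        refine ⟨?_, h2⟩
        by_contra hc
        exact hw ⟨by omega, h2⟩
    refine wp_cond (fun h1 => wp_cond (fun h2 => wp_store ⟨by simp, fun w => ?_⟩) fun h2 => wp_skip
      ⟨by simp, fun w => hkeep w ?_⟩) fun h1 => wp_skip ⟨by simp, fun w => hkeep w ?_⟩
    · simp [hi', e34, e35, e13, hIi] at h1 h2
      by_cases hwi : w.val = i
      · simp [hi', hwi, h1, h2, e26]
      · simpa [hi', hwi, Function.update_apply] using hkeep w fun hc => hwi hc.1
    · simp [hi', e35, e13] at h2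
      rintro ⟨rfl, -, h3⟩
      exact h2 h3
    · simp [hi', e34, hIi] at h1
      rintro ⟨rfl, h3, -⟩
      exact h1 h3
  · intro t s1 hF hI ht
    exact ⟨by omega, fun w => by simpa using hI w⟩

/-- A vertex whose count differs from that of the representative of its colour opens a new colour,
becomes its representative, and takes along all vertices with the same colour and count. Thus counts
are only ever compared with those of representatives, and no sorting is needed. -/
def splitProg : Program :=
  .cond (.eq (.get 13 (.reg 32)) (.get 13 (.get 12 (.get 11 (.reg 32))))) .skip
    (.seq (.set 34 (.get 11 (.reg 32))) (.seq (.set 35 (.get 13 (.reg 32)))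
      (.seq (.store 12 (.reg 26) (.reg 32)) (.seq relabelProg (.set 26 (.succ (.reg 26)))))))

/-- What the splitting of colour classes by the numbers in array 13 has achieved for the vertices
below `i`. -/
structure SplitInv (T : SimpleGraph (Fin n)) (s : State) (i : ℕ) (s' : State) : Prop where
  coloring : IsOrbitColoring T (fun v => s'.arr 11 v) (s'.arr 12) (s'.reg 26)
  refines : ∀ v w : Fin n, s'.arr 11 v = s'.arr 11 w → s.arr 11 v = s.arr 11 w
  fresh : ∀ v : Fin n, s'.arr 11 v ≠ s.arr 11 v → s.reg 26 ≤ s'.arr 11 v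
  count : ∀ v : Fin n, v.val < i → s.arr 13 v = s.arr 13 (s'.arr 12 (s'.arr 11 v))
  le : s.reg 26 ≤ s'.reg 26

/-- A relabelling is paid for by the colour that it creates. As there are never more than `n`
colours, all relabellings in all refinement steps together take quadratic time. -/
theorem wp_splitScan {s : State} (h : s.reg 0 = n)
    (hcol : IsOrbitColoring T (fun v => s.arr 11 v) (s.arr 12) (s.reg 26))
    (hcnt : ∀ (φ : T ≃g T) (v : Fin n), s.arr 13 (φ v) = s.arr 13 v) :
    WP (.forTo 32 0 splitProg) s fun t s' => SplitInv T s n s' ∧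
      t + 100 * (n + 1) * s.reg 26 ≤ 100 * (n + 1) * s'.reg 26 + 40 * (n + 1) := by
  refine wp_forTo_time (m := n) (fun i t s1 => SplitInv T s i s1 ∧
      t + 100 * (n + 1) * s.reg 26 ≤ 100 * (n + 1) * s1.reg 26 + 40 * i) h rfl rfl ?_ ?_ ?_
  · refine ⟨⟨by simpa using hcol, by simp, by simp, by simp, by simp⟩, by simp⟩
  · rintro i t s1 hi hF hi' ⟨⟨h1, h2, h3, h4, h5⟩, ht⟩
    have e13 : s1.arr 13 = s.arr 13 := hF.arr 13 rfl
    have e0 : s1.reg 0 = n := (hF.reg 0 rfl).trans h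
    obtain ⟨v, rfl⟩ : ∃ v : Fin n, v.val = i := ⟨⟨i, hi⟩, rfl⟩
    refine wp_cond (fun he => wp_skip ⟨⟨h1, h2, h3, fun w hw => ?_, h5⟩, ?_⟩) fun he => ?_
    · rcases Nat.lt_succ_iff_lt_or_eq.1 hw with hw | hw
      · exact h4 w hw
      · simp [hi', e13] at he
        rw [hw]
        exact he
    · simp
      omega
    simp [hi', e13] at he
    refine wp_seq (wp_set (wp_seq (wp_set (wp_seq (wp_store (wp_seq ?_))))))
    refine (wp_relabelProg (n := n) (by simpa using e0)).mono fun t' s2 hF2 ⟨ht', hs⟩ => wp_set ?_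
    have e26 : s2.reg 26 = s1.reg 26 := (hF2.reg 26 rfl).trans (by simp)
    have e12 : s2.arr 12 = Function.update (s1.arr 12) (s1.reg 26) v :=
      (hF2.arr 12 rfl).trans (by simp [hi'])
    have hs' : ∀ w : Fin n, s2.arr 11 w =
        if s1.arr 11 w = s1.arr 11 v ∧ s.arr 13 w = s.arr 13 v then s1.reg 26 else s1.arr 11 w := by
      intro w
      simpa [hi', e13] using hs w
    obtain ⟨r, hr, -⟩ := h1.rep_spec (s1.arr 11 v) (h1.lt v)
    rw [hr] at he
    have hlt : ∀ w : Fin n, s1.arr 11 w < s1.reg 26 := h1.lt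
    refine ⟨⟨?_, fun a b hab => ?_, fun a ha => ?_, fun w hw => ?_, ?_⟩, ?_⟩
    · simp only [State.setReg_arr, State.setReg_reg, if_true, RamExpr.eval, e26, e12]
      exact h1.split hcnt hr he hs'
    · simp only [State.setReg_arr] at hab
      rw [hs', hs'] at hab
      have ha := hlt a
      have hb := hlt b
      split_ifs at hab with hc1 hc2 hc2
      · exact h2 a b (hc1.1.trans hc2.1.symm)
      · omega
      · omega
      · exact h2 a b hab
    · simp only [State.setReg_arr] at ha ⊢
      rw [hs'] at ha ⊢
      split_ifs at ha ⊢ with hc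
      · exact h5
      · exact h3 a ha
    · simp only [State.setReg_arr]
      rw [hs', e12]
      split_ifs with hc
      · rw [Function.update_self]
        exact hc.2
      · rw [Function.update_of_ne (hlt w).ne]
        rcases Nat.lt_succ_iff_lt_or_eq.1 hw with hw | hw
        · exact h4 w hw
        · exact absurd ⟨by rw [hw], by rw [hw]⟩ hc
    · simp [e26]
      omega
    · simp only [RamExpr.cost, RamExpr.eval, State.setReg_reg, e26, if_true,
        show (26 : ℕ) ≠ 32 by decide, if_false]
      rw [Nat.mul_add (100 * (n + 1))]
      omega
  · rintro t s1 hF ⟨hI, ht⟩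
    exact ⟨hI, by omega⟩

theorem SplitInv.count_eq {s s' : State} (h : SplitInv T s n s') {v w : Fin n}
    (hvw : s'.arr 11 v = s'.arr 11 w) : s.arr 13 v = s.arr 13 w := by
  rw [h.count v v.2, h.count w w.2, hvw]

theorem ncard_neighbors_map (φ : T ≃g T) {f : Fin n → ℕ} (hf : ∀ v, f (φ v) = f v) (v : Fin n)
    (c : ℕ) : {u | T.Adj (φ v) u ∧ f u = c}.ncard = {u | T.Adj v u ∧ f u = c}.ncard := by
  rw [← Set.ncard_image_of_injective {u | T.Adj v u ∧ f u = c} φ.injective]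
  congr 1
  ext u
  constructor
  · rintro ⟨h1, h2⟩
    refine ⟨φ.symm u, ⟨?_, ?_⟩, φ.apply_symm_apply u⟩
    · rw [← φ.map_adj_iff, φ.apply_symm_apply]
      exact h1
    · rw [← hf, φ.apply_symm_apply, h2]
  · rintro ⟨w, ⟨h1, h2⟩, rfl⟩
    exact ⟨φ.map_adj_iff.2 h1, (hf w).trans h2⟩

/-- The comparison makes the initial number of colours 1, or 0 if there are no vertices. One pass
through the candidates below `n` suffices, since new colours are larger than the current one and
there are at most `n`. -/
def refineProg : Program :=
  .seq (.set 26 (.lt (.lit 0) (.reg 0))) (.forTo 27 0 (.cond (.lt (.reg 27) (.reg 26))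
    (.seq countProg (.forTo 32 0 splitProg)) .skip))

theorem wp_refineProg (hadj : IsAdjacencyList T adj) {s : State} (h : HoldsInput adj s)
    (h11 : ∀ v : Fin n, s.arr 11 v = 0) (h12 : s.arr 12 0 = 0) :
    WP refineProg s fun t s' => t ≤ 500 * (n + 1) ^ 2 ∧
      IsEquitable T (fun v : Fin n => s'.arr 11 v) ∧
      ∀ (φ : T ≃g T) (v : Fin n), s'.arr 11 (φ v) = s'.arr 11 v := by
  refine wp_seq (wp_set ?_)
  refine wp_forTo_time (m := n) (fun i t s1 =>
    IsOrbitColoring T (fun v => s1.arr 11 v) (s1.arr 12) (s1.reg 26) ∧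
    IsStableBelow T (fun v : Fin n => s1.arr 11 v) (min i (s1.reg 26)) ∧
    t ≤ 300 * (n + 1) * i + 100 * (n + 1) * s1.reg 26) (by simpa using h.size) rfl rfl ?_ ?_ ?_
  · simp only [State.setReg_arr, State.setReg_reg, RamExpr.eval, h.size]
    refine ⟨⟨fun v => ?_, fun d hd => ?_, fun φ v => ?_⟩, ?_, by simp⟩
    · have : 0 < n := v.pos
      simp [h11, this]
    · have hn : 0 < n := by
        by_contra hn
        simp [hn] at hd
      have hd0 : d = 0 := by simpa [hn] using hd
      exact ⟨⟨0, hn⟩, by simp [hd0, h12], by simpa [hd0] using h11 ⟨0, hn⟩⟩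
    · simp [h11]
    · intro d hd
      omega
  · rintro i t s1 hi hF hi' ⟨h1, h2, h3⟩
    have hin := (h.setReg _ (by decide)).frame hF rfl rfl rfl
    refine wp_cond (fun he => wp_seq ?_) fun he => wp_skip ⟨h1, ?_, ?_⟩
    · simp [hi'] at he
      refine (wp_countProg hadj hin hi').mono fun t' s2 hF2 ⟨ht', hs⟩ => ?_
      have e11 : s2.arr 11 = s1.arr 11 := hF2.arr 11 rfl
      have e12 : s2.arr 12 = s1.arr 12 := hF2.arr 12 rfl
      have e26 : s2.reg 26 = s1.reg 26 := hF2.reg 26 rfl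
      refine (wp_splitScan (n := n) (T := T) ((hF2.reg 0 rfl).trans hin.size) ?_ ?_).mono
        fun t'' s3 hF3 ⟨hI, ht''⟩ => ⟨hI.coloring, ?_, ?_⟩
      · simpa [e11, e12, e26] using h1
      · intro φ v
        rw [hs, hs]
        exact ncard_neighbors_map φ (f := fun u => s1.arr 11 u) (h1.invariant φ) v i
      · have hle := hI.le
        rw [e26] at hle
        rw [min_eq_left he.le] at h2
        simp only [State.setReg_arr, State.setReg_reg, show (26 : ℕ) ≠ 27 by decide, if_false]
        rw [min_eq_left (by omega)]
        refine h2.step (fun v w hvw => ?_) (fun v hv => ?_) fun v w hvw => ?_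
        · have := hI.refines v w hvw
          rwa [e11] at this
        · have := hI.fresh v (by rwa [e11])
          omega
        · have := hI.count_eq hvw
          rwa [hs, hs] at this
      · rw [e26] at ht''
        simp
        rw [Nat.mul_add]
        omega
    · simp [hi'] at he
      simp only [State.setReg_arr, State.setReg_reg, show (26 : ℕ) ≠ 27 by decide, if_false]
      rw [min_eq_right (by omega)] at h2 ⊢
      exact h2
    · simp
      rw [Nat.mul_add]
      omega
  · rintro t s1 hF ⟨h1, h2, h3⟩
    have hnum := h1.num_le
    rw [min_eq_right hnum] at h2
    refine ⟨?_, h2.isEquitable h1.lt, h1.invariant⟩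
    have := Nat.mul_le_mul_left (100 * (n + 1)) hnum
    simp only [RamExpr.cost]
    nlinarith

end RefinementProgram


/-! ### The interiority test and the parts of the output -/

section OutputProgram

variable {n : ℕ} {T : SimpleGraph (Fin n)} {adj : Fin n → List (Fin n)}

theorem take_finRange_succ (v : Fin n) :
    (List.finRange n).take (v + 1) = (List.finRange n).take v ++ [v] := by
  rw [List.take_succ_eq_append_getElem (by simp)]
  simp

def interiorProg : Program :=
  .seq (.set 24 (.lit 1)) (.forTo 25 0 (.cond (.get 2 (.reg 25)) .skip
    (.cond (.lt (.get 7 (.reg 25)) (.lit 2)) (.cond (.eq (.get 7 (.reg 25)) (.get 3 (.reg 25)))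
      .skip (.set 24 (.lit 0))) .skip)))

theorem wp_interiorProg {s : State} (h : s.reg 0 = n) :
    WP interiorProg s fun t s' => t ≤ 100 * (n + 1) ∧ ∃ b : Bool, s'.reg 24 = b.toNat ∧
      (b = true ↔ ∀ v : Fin n, s.arr 2 v = 0 → s.arr 7 v < 2 → s.arr 7 v = s.arr 3 v) := by
  refine wp_seq (wp_set ?_)
  refine wp_forTo (m := n) (fun i s1 => ∃ b : Bool, s1.reg 24 = b.toNat ∧
    (b = true ↔ ∀ v : Fin n, v.val < i → s.arr 2 v = 0 → s.arr 7 v < 2 → s.arr 7 v = s.arr 3 v)) 50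
    (by simpa using h) rfl rfl ?_ ?_ ?_
  · exact ⟨true, by simp, by simp⟩
  · rintro i s1 hi hF hi' ⟨b, hb, hb'⟩
    have e2 : s1.arr 2 = s.arr 2 := hF.arr 2 rfl
    have e7 : s1.arr 7 = s.arr 7 := hF.arr 7 rfl
    have e3 : s1.arr 3 = s.arr 3 := hF.arr 3 rfl
    obtain ⟨v, rfl⟩ : ∃ v : Fin n, v.val = i := ⟨⟨i, hi⟩, rfl⟩
    have hkeep : (s.arr 2 v = 0 → s.arr 7 v < 2 → s.arr 7 v = s.arr 3 v) →
        ∃ b : Bool, (s1.setReg 25 (v + 1)).reg 24 = b.toNat ∧ (b = true ↔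
          ∀ w : Fin n, w.val < v.val + 1 → s.arr 2 w = 0 → s.arr 7 w < 2 →
            s.arr 7 w = s.arr 3 w) := by
      refine fun hv => ⟨b, by simpa using hb, hb'.trans ⟨fun hall w hw => ?_, fun hall w hw =>
        hall w (by omega)⟩⟩
      rcases Nat.lt_succ_iff_lt_or_eq.1 hw with hw | hw
      · exact hall w hw
      · rw [hw]
        exact hv
    refine wp_cond (fun h1 => wp_skip ⟨by simp, hkeep fun h => ?_⟩) fun h1 => wp_cond (fun h2 =>
      wp_cond (fun h3 => wp_skip ⟨by simp, hkeep fun _ _ => ?_⟩) fun h3 => wp_set ⟨by simp, false,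
      by simp, ?_⟩) fun h2 => wp_skip ⟨by simp, hkeep fun _ h => ?_⟩
    · simp [hi', e2] at h1
      exact absurd h h1
    · simpa [hi', e7, e3] using h3
    · simp [hi', e2, e7, e3] at h1 h2 h3
      simp only [Bool.false_eq_true, false_iff]
      exact fun hall => h3 (hall v (by omega) h1 (by omega))
    · simp [hi', e7] at h2
      omega
  · rintro t s1 hF ⟨b, hb, hb'⟩ ht
    exact ⟨by simp; omega, b, hb, by simpa using hb'⟩

def writeDead (x : ℕ) (e : RamExpr) : Program :=
  .forTo x 0 (.cond (.get 2 (.reg x)) (.write e) .skip)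

theorem wp_writeDead {x : ℕ} {e : RamExpr} {s : State} {f : Fin n → ℕ} (h : s.reg 0 = n)
    (hx : x ≠ 0) (hdead : ∀ v : Fin n, s.arr 2 v ≠ 0 ↔ Dead adj v) (hcost : e.cost ≤ 3)
    (he : ∀ (s : State) (v : Fin n), s.reg x = v.val → e.eval s = f v) :
    WP (writeDead x e) s fun t s' => t ≤ 40 * (n + 1) ∧ s'.out = s.out ++ (deadList adj).map f := by
  classical
  refine wp_forTo (m := n) (fun i s1 => s1.out = s.out ++
    (((List.finRange n).take i).filter fun u => Dead adj u).map f) 20 h rfl ?_ (by simp) ?_ ?_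
  · simp [Program.writesReg, Program.forTo, hx]
  · intro i s1 hi hF hi' hI
    have e2 : s1.arr 2 = s.arr 2 := hF.arr 2 rfl
    obtain ⟨v, rfl⟩ : ∃ v : Fin n, v.val = i := ⟨⟨i, hi⟩, rfl⟩
    rw [take_finRange_succ]
    refine wp_cond (fun h1 => wp_write ⟨by simp; omega, ?_⟩) fun h1 => wp_skip ⟨by simp, ?_⟩
    · simp [hi', e2] at h1
      simp [hI, he s1 v hi', (hdead v).1 h1]
    · simp [hi', e2] at h1
      have : ¬ Dead adj v := fun hd => (hdead v).2 hd h1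
      simp [hI, this]
  · intro t s1 hF hI ht
    refine ⟨by omega, ?_⟩
    rw [hI, List.take_of_length_le (by simp), deadList]

def countDead : Program :=
  .seq (.set 36 (.lit 0)) (.forTo 37 0 (.cond (.get 2 (.reg 37)) (.set 36 (.succ (.reg 36))) .skip))

theorem wp_countDead {s : State} (h : s.reg 0 = n)
    (hdead : ∀ v : Fin n, s.arr 2 v ≠ 0 ↔ Dead adj v) :
    WP countDead s fun t s' => t ≤ 40 * (n + 1) ∧ s'.reg 36 = (deadList adj).length := by
  classical
  refine wp_seq (wp_set ?_)
  refine wp_forTo (m := n) (fun i s1 => s1.reg 36 =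
    (((List.finRange n).take i).filter fun u => Dead adj u).length) 20 (by simpa using h) rfl rfl
    (by simp) ?_ ?_
  · intro i s1 hi hF hi' hI
    have e2 : s1.arr 2 = s.arr 2 := hF.arr 2 rfl
    obtain ⟨v, rfl⟩ : ∃ v : Fin n, v.val = i := ⟨⟨i, hi⟩, rfl⟩
    rw [take_finRange_succ]
    refine wp_cond (fun h1 => wp_set ⟨by simp, ?_⟩) fun h1 => wp_skip ⟨by simp, ?_⟩
    · simp [hi', e2] at h1
      simp [hI, (hdead v).1 h1]
    · simp [hi', e2] at h1
      have : ¬ Dead adj v := fun hd => (hdead v).2 hd h1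
      simp [hI, this]
  · intro t s1 hF hI ht
    refine ⟨by simp; omega, ?_⟩
    rw [hI, List.take_of_length_le (by simp), deadList]

/-- A list of paths stored in memory: register 17 holds the number of paths, arrays 10 and 9 the
paths. -/
structure HoldsPaths (s : State) (P : List (List (Fin n))) : Prop where
  length : s.reg 17 = P.length
  stores : ∀ k (h : k < P.length), Stores Fin.val (s.arr 10) (s.arr 9) k P[k]
  length_le : P.length ≤ n
  path_length_le : ∀ p ∈ P, p.length ≤ n

theorem HoldsPaths.frame {s s' : State} {c : Program} {P : List (List (Fin n))}
    (h : HoldsPaths s P) (hF : Frame c s s') (h1 : c.writesReg 17 = false)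
    (h2 : c.writesArr 10 = false) (h3 : c.writesArr 9 = false) : HoldsPaths s' P :=
  ⟨by rw [hF.reg 17 h1, h.length], by rw [hF.arr 10 h2, hF.arr 9 h3]; exact h.stores, h.length_le,
    h.path_length_le⟩

theorem IsPathSystem.length_le {V : Type*} {T : SimpleGraph V} {P : List (List V)}
    (h : IsPathSystem T P) : P.length ≤ P.flatten.length := by
  have := h.ncard_systemEdges.2
  omega

def writeCover : Program :=
  .forTo 39 17 (.seq (.write (.sub (.get 10 (.succ (.reg 39))) (.get 10 (.reg 39))))
    (.forList 10 9 39 40 41 (.write (.reg 41))))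

theorem wp_writeCover {s : State} {P : List (List (Fin n))} (h : HoldsPaths s P) :
    WP writeCover s fun t s' => t ≤ 100 * (n + 1) ^ 2 ∧
      s'.out = s.out ++ P.flatMap fun p => p.length :: p.map Fin.val := by
  refine wp_forTo (m := P.length) (fun i s1 => s1.out = s.out ++
    (P.take i).flatMap fun p => p.length :: p.map Fin.val) (50 * (n + 1)) h.length rfl rfl
    (by simp) ?_ ?_
  · intro i s1 hi hF hi' hI
    have hP := h.frame hF rfl rfl rfl
    have hst := hP.stores i hi
    have hle := h.path_length_le P[i] (List.getElem_mem hi)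
    refine wp_seq (wp_write ?_)
    refine wp_forList (f := Fin.val) (L := P[i]) (fun done s2 => s2.out = s.out ++
      ((P.take i).flatMap fun p => p.length :: p.map Fin.val) ++ P[i].length :: done.map Fin.val) 10
      (by simpa [hi'] using hst) rfl (by decide) rfl rfl rfl ?_ ?_ ?_
    · intro y
      simp [hI, hi', hst.length]
    · intro done x rest s2 hL hF2 hI2
      exact wp_write ⟨by simp, by simp [hI2]⟩
    · intro t s2 hF2 hI2 ht
      refine ⟨by simp; omega, ?_⟩
      rw [List.take_succ_eq_append_getElem hi]
      generalize P.take i = A at hI2 ⊢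
      simp [hI2]
  · intro t s1 hF hI ht
    refine ⟨?_, by simpa using hI⟩
    have := Nat.mul_le_mul_right (50 * (n + 1) + 7) h.length_le
    nlinarith

/-- Whether the two ends of the path `p` have the same colour. -/
def sameEnds (col : Fin n → ℕ) (p : List (Fin n)) : Bool :=
  decide (p.head?.map col = p.getLast?.map col)

/-- Register 24 enters with the outcome 1 of the interiority test and is set to 0 by any failing
check, so it ends up holding the answer. -/
def checkCover : Program :=
  .forTo 42 17 (.seq (.set 43 (.eq (.get 11 (.get 9 (.get 10 (.reg 42))))
    (.get 11 (.get 9 (.sub (.get 10 (.succ (.reg 42))) (.lit 1)))))) (.seq (.write (.reg 43))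
      (.cond (.reg 43) .skip (.set 24 (.lit 0)))))

theorem wp_checkCover {s : State} {P : List (List (Fin n))} (h : HoldsPaths s P)
    (hne : ∀ p ∈ P, p ≠ []) (h24 : s.reg 24 = 1) :
    WP checkCover s fun t s' => t ≤ 100 * (n + 1) ∧
      s'.out = s.out ++ (P.map (sameEnds fun v => s.arr 11 v)).map Bool.toNat ∧
      s'.reg 24 = ((P.map (sameEnds fun v => s.arr 11 v)).all id).toNat := by
  refine wp_forTo (m := P.length) (fun i s1 =>
    s1.out = s.out ++ ((P.take i).map (sameEnds fun v => s.arr 11 v)).map Bool.toNat ∧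
    s1.reg 24 = (((P.take i).map (sameEnds fun v => s.arr 11 v)).all id).toNat) 50 h.length rfl rfl
    (by simp [h24]) ?_ ?_
  · rintro i s1 hi hF hi' ⟨hI1, hI2⟩
    have hP := h.frame hF rfl rfl rfl
    have hst := hP.stores i hi
    have e11 : s1.arr 11 = s.arr 11 := hF.arr 11 rfl
    have hpos : 0 < P[i].length := List.length_pos_iff.2 (hne _ (List.getElem_mem hi))
    have hfirst := hst.get 0 hpos
    have hlast := hst.get (P[i].length - 1) (by omega)
    have hidx : s1.arr 10 (i + 1) - 1 = s1.arr 10 i + (P[i].length - 1) := by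
      rw [hst.length]
      omega
    have hval : ((RamExpr.get 11 (.get 9 (.get 10 (.reg 42)))).eq
        (.get 11 (.get 9 (.sub (.get 10 (.succ (.reg 42))) (.lit 1))))).eval s1 =
        (sameEnds (fun v => s.arr 11 v) P[i]).toNat := by
      rw [Nat.add_zero] at hfirst
      have h1 : P[i].head? = some (P[i][0]) := by
        rw [List.head?_eq_getElem?, List.getElem?_eq_getElem hpos]
      have h2 : P[i].getLast? = some (P[i][P[i].length - 1]) := by
        rw [List.getLast?_eq_getElem?, List.getElem?_eq_getElem (by omega)]
      simp only [RamExpr.eval, hi', hidx, hfirst, hlast, e11, sameEnds, h1, h2, Option.map_some,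
        Option.some.injEq]
      split_ifs with hc <;> simp [hc]
    rw [List.take_succ_eq_append_getElem hi]
    refine wp_seq (wp_set (wp_seq (wp_write ?_)))
    rw [hval]
    generalize P.take i = A at hI1 hI2 ⊢
    cases hb : sameEnds (fun v => s.arr 11 v) P[i]
    · refine wp_cond (fun he => absurd he (by simp)) fun he => wp_set ⟨by simp, ?_, ?_⟩
      · simp [hI1, hb]
      · simp [hb]
    · refine wp_cond (fun he => wp_skip ⟨by simp, ?_, ?_⟩) fun he => absurd he (by simp)
      · simp [hI1, hb]
      · simp [hI2, hb]
  · rintro t s1 hF ⟨hI1, hI2⟩ ht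
    rw [List.take_length] at hI1 hI2
    refine ⟨?_, hI1, hI2⟩
    have := h.length_le
    omega

end OutputProgram


/-! ### The whole program -/

section MainProgram

variable {n : ℕ} {T : SimpleGraph (Fin n)} {adj : Fin n → List (Fin n)}

/-- The checks of removed leaves are written as 1 without any test: the two ends of a one-vertex
path coincide. -/
def outputProg : Program :=
  .seq countDead (.seq (.write (.reg 36)) (.seq (writeDead 38 (.reg 38)) (.seq (.write (.reg 17))
    (.seq writeCover (.seq (.write (.reg 24)) (.seq (.cond (.reg 24)
      (.seq checkCover (writeDead 44 (.lit 1))) .skip) (.write (.reg 24))))))))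

/-- The outcomes of the checks of the paths of `P` and of the removed leaves. -/
noncomputable def checkList (adj : Fin n → List (Fin n)) (col : Fin n → ℕ) (b : Bool)
    (P : List (List (Fin n))) : List Bool :=
  if b then P.map (sameEnds col) ++ (deadList adj).map fun _ => true else []

theorem wp_outputProg {s : State} {P : List (List (Fin n))} {b : Bool} (h : s.reg 0 = n)
    (hdead : ∀ v : Fin n, s.arr 2 v ≠ 0 ↔ Dead adj v) (hP : HoldsPaths s P)
    (hne : ∀ p ∈ P, p ≠ []) (h24 : s.reg 24 = b.toNat) :
    WP outputProg s fun t s' => t ≤ 500 * (n + 1) ^ 2 ∧ s'.out = s.out ++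
      ((deadList adj).length :: (deadList adj).map Fin.val ++
        P.length :: (P.flatMap fun p => p.length :: p.map Fin.val) ++
        b.toNat :: (checkList adj (fun v => s.arr 11 v) b P).map Bool.toNat ++
        [(b && (checkList adj (fun v => s.arr 11 v) b P).all id).toNat]) := by
  have hlin : n + 1 ≤ (n + 1) ^ 2 := Nat.le_self_pow (by omega) _
  refine wp_seq ((wp_countDead h hdead).mono fun t1 s1 hF1 ⟨ht1, h36⟩ => wp_seq (wp_write
    (wp_seq ?_)))
  have hout1 : s1.out = s.out := hF1.out rfl
  refine (wp_writeDead (adj := adj) (s := s1.put _) (x := 38) (e := .reg 38) (f := Fin.val) ((hF1.reg 0 rfl).trans h) (by decide) ?_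
    (by simp) (by simp)).mono fun t2 s2 hF2 ⟨ht2, hout2⟩ => ?_
  · rw [State.put_arr, hF1.arr 2 rfl]
    exact hdead
  have hP2 : HoldsPaths s2 P := by
    have h1 := hP.frame hF1 rfl rfl rfl
    exact (⟨h1.length, h1.stores, h1.length_le, h1.path_length_le⟩ :
      HoldsPaths (s1.put _) P).frame hF2 rfl rfl rfl
  refine wp_seq (wp_write (wp_seq ?_))
  have hP3 : HoldsPaths (s2.put ((RamExpr.reg 17).eval s2)) P :=
    ⟨hP2.length, hP2.stores, hP2.length_le, hP2.path_length_le⟩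
  refine (wp_writeCover hP3).mono fun t3 s3 hF3 ⟨ht3, hout3⟩ => wp_seq (wp_write (wp_seq ?_))
  have h24' : s3.reg 24 = b.toNat := by
    rw [hF3.reg 24 rfl, State.put_reg, hF2.reg 24 rfl, State.put_reg, hF1.reg 24 rfl, h24]
  have h11 : s3.arr 11 = s.arr 11 := by
    rw [hF3.arr 11 rfl, State.put_arr, hF2.arr 11 rfl, State.put_arr, hF1.arr 11 rfl]
  have h2 : s3.arr 2 = s.arr 2 := by
    rw [hF3.arr 2 rfl, State.put_arr, hF2.arr 2 rfl, State.put_arr, hF1.arr 2 rfl]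
  have h0 : s3.reg 0 = n := by
    rw [hF3.reg 0 rfl, State.put_reg, hF2.reg 0 rfl, State.put_reg, hF1.reg 0 rfl, h]
  have hout : s3.out = s.out ++ ((deadList adj).length :: (deadList adj).map Fin.val ++
      P.length :: (P.flatMap fun p => p.length :: p.map Fin.val)) := by
    rw [hout3, State.put_out, hout2, State.put_out, hout1]
    simp [h36, hP2.length]
  cases b
  · refine wp_cond (fun he => absurd he (by simp [h24'])) fun _ => wp_skip (wp_write ⟨?_, ?_⟩)
    · simp
      omega
    · simp [hout, h24', checkList]
  · refine wp_cond (fun _ => wp_seq ?_) fun he => absurd he (by simp [h24'])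
    have hP4 : HoldsPaths s3 P := hP3.frame hF3 rfl rfl rfl
    refine (wp_checkCover (s := s3.put _) (P := P)
      ⟨hP4.length, hP4.stores, hP4.length_le, hP4.path_length_le⟩ hne h24').mono
      fun t4 s4 hF4 ⟨ht4, hout4, h24''⟩ => ?_
    refine (wp_writeDead (adj := adj) (x := 44) (e := .lit 1) (f := fun _ => 1) ((hF4.reg 0 rfl).trans h0) (by decide) ?_
      (by simp) (by simp)).mono fun t5 s5 hF5 ⟨ht5, hout5⟩ => wp_write ⟨?_, ?_⟩
    · rw [hF4.arr 2 rfl, State.put_arr, h2]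
      exact hdead
    · simp only [RamExpr.cost]
      omega
    · have h24e : s5.reg 24 = _ := (hF5.reg 24 rfl).trans h24''
      rw [State.put_arr, h11] at h24e hout4
      simp [hout5, hout4, hout, h24e, h24', checkList, Function.comp_def]

/-- The phases communicate through array 2 (removed vertices), array 3 (degrees in the pruned
forest), arrays 6 and 7 (chosen edges and their degrees), arrays 9 and 10 (paths), array 11
(colours), and register 24 (interiority); arrays 5 and 8 prepare the stripping and the traversal. -/
def mainProg : Program :=
  .seq pruneProg (.seq setupProg (.seq stripProg (.seq traverseProg (.seq interiorProg
    (.seq refineProg outputProg)))))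

theorem sameEnds_iff (hT : T.IsAcyclic) {col : Fin n → ℕ} (hcol : IsEquitable T col)
    (hinv : ∀ (φ : T ≃g T) v, col (φ v) = col v) {p : List (Fin n)} (hp : IsPathList T p) :
    sameEnds col p = true ↔ PathCheck T p := by
  rw [pathCheck_iff_of_isEquitable hT hcol hinv hp, sameEnds, decide_eq_true_eq,
    List.head?_eq_some_head hp.ne_nil, List.getLast?_eq_some_getLast hp.ne_nil]
  simp

theorem isRunOn_of_coloring (hT : T.IsAcyclic) (hadj : IsAdjacencyList T adj)
    {P : List (List {v // v ∉ deadList adj})} (hP : IsMinPathCover (pruned T (deadList adj)) P)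
    {b : Bool} (hb : b = true ↔ IsInteriorCover (pruned T (deadList adj)) P) {col : Fin n → ℕ}
    (hcol : IsEquitable T col) (hinv : ∀ (φ : T ≃g T) v, col (φ v) = col v) :
    Run.IsRunOn ⟨deadList adj, P, b, checkList adj col b (P.map (List.map Subtype.val)),
      b && (checkList adj col b (P.map (List.map Subtype.val))).all id⟩ T := by
  have hsys := isPathSystem_map_val_iff.2
    ((isPathCover_iff (isAcyclic_pruned hT _)).1 hP.1).1
  refine ⟨hadj.isPruning, hP, hb, ?_, ?_⟩
  · rintro rfl
    exact ⟨rfl, rfl⟩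
  · rintro rfl
    refine ⟨?_, by simp⟩
    simp only [checkList, if_true, coverInT]
    refine List.rel_append ?_ ?_
    · rw [List.forall₂_map_right_iff, List.forall₂_same]
      exact fun p hp => sameEnds_iff hT hcol hinv (hsys.isPathList p hp)
    · rw [List.forall₂_map_right_iff, List.forall₂_map_left_iff, List.forall₂_same]
      intro v _
      simp only [true_iff]
      exact (sameEnds_iff hT hcol hinv (isPathList_singleton v)).1 (by simp [sameEnds])

theorem wp_mainProg (hT : T.IsAcyclic) (hadj : IsAdjacencyList T adj) :
    WP mainProg (initialState adj) fun t s => t ≤ 3000 * (n + 1) ^ 2 ∧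
      ∃ r : Run (Fin n), r.IsRunOn T ∧ s.out = r.output := by
  have h := holdsInput_initialState hT hadj
  have hlin : n + 1 ≤ (n + 1) ^ 2 := Nat.le_self_pow (by omega) _
  refine wp_seq ((wp_pruneProg h (by simp [initialState])).mono fun t1 s1 hF1 ⟨ht1, hdead⟩ => ?_)
  have h1 := h.frame hF1 rfl rfl rfl
  refine wp_seq ((wp_setupProg h1).mono fun t2 s2 hF2 ⟨ht2, hset⟩ => ?_)
  have h2 := h1.frame hF2 rfl rfl rfl
  have e2 : s2.arr 2 = s1.arr 2 := hF2.arr 2 rfl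
  refine wp_seq ((wp_stripProg hT hadj h2 (fun v => by rw [(hset v).2.1, e2]) (fun v => ?_)
    (fun v => ?_)).mono fun t3 s3 hF3 ⟨ht3, hlinear, hdeg, hmax⟩ => ?_)
  · rw [hF2.arr 6 rfl, hF1.arr 6 rfl]
    rfl
  · rw [hF2.arr 7 rfl, hF1.arr 7 rfl]
    rfl
  have h3 := h2.frame hF3 rfl rfl rfl
  rw [e2] at hlinear hmax
  refine wp_seq ((wp_traverseProg hT hadj h3 (dead := s1.arr 2) (fun v => ?_) hlinear hdeg).mono
    fun t4 s4 hF4 ⟨ht4, P, hP, hcov, h17, hst⟩ => ?_)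
  · rw [hF3.arr 8 rfl, (hset v).2.2]
  have h4 := h3.frame hF4 rfl rfl rfl
  refine wp_seq ((wp_interiorProg h4.size).mono fun t5 s5 hF5 ⟨ht5, b, h24, hb⟩ => ?_)
  have h5 := h4.frame hF5 rfl rfl rfl
  refine wp_seq ((wp_refineProg hadj h5 (fun v => ?_) ?_).mono
    fun t6 s6 hF6 ⟨ht6, hcol, hinv⟩ => ?_)
  · rw [hF5.arr 11 rfl, hF4.arr 11 rfl, hF3.arr 11 rfl, hF2.arr 11 rfl, hF1.arr 11 rfl]
    rfl
  · rw [hF5.arr 12 rfl, hF4.arr 12 rfl, hF3.arr 12 rfl, hF2.arr 12 rfl, hF1.arr 12 rfl]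
    rfl
  have h6 := h5.frame hF6 rfl rfl rfl
  have e26 : s6.arr 2 = s1.arr 2 := by
    rw [hF6.arr 2 rfl, hF5.arr 2 rfl, hF4.arr 2 rfl, hF3.arr 2 rfl, e2]
  have hP4 : HoldsPaths s4 P := by
    have hlen : P.flatten.length ≤ n := by
      simpa using hP.isPathSystem.nodup_flatten.length_le_card
    refine ⟨h17, hst, hP.isPathSystem.length_le.trans hlen, fun p hp => ?_⟩
    simpa using (hP.isPathSystem.isPathList p hp).nodup.length_le_card
  have hP6 := (hP4.frame hF5 rfl rfl rfl).frame hF6 rfl rfl rfl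
  refine (wp_outputProg (adj := adj) (b := b) h6.size (by rw [e26]; exact hdead) hP6
    (fun p hp => (hP.isPathSystem.isPathList p hp).ne_nil) ((hF6.reg 24 rfl).trans h24)).mono
    fun t7 s7 hF7 ⟨ht7, hout⟩ => ⟨by omega, ?_⟩
  have hD : {v : Fin n | s1.arr 2 v ≠ 0} = {v | v ∈ deadList adj} := by
    ext v
    rw [Set.mem_ofPred_eq, Set.mem_ofPred_eq, mem_deadList, hdead]
  have hzero : ∀ v : Fin n, s1.arr 2 v = 0 ↔ v ∉ deadList adj := by
    intro v
    rw [mem_deadList, ← hdead, not_not]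
  rw [hD] at hlinear hmax hP
  obtain ⟨Q, rfl⟩ := exists_map_val (D := fun v => v ∉ deadList adj) (C := P)
    fun p hp v hv => hP.avoid v (List.mem_flatten.2 ⟨p, hp, hv⟩)
  have hcov' : ∀ v, v ∉ deadList adj → v ∈ (Q.map (List.map Subtype.val)).flatten :=
    fun v hv => hcov v ((hzero v).2 hv)
  have hmin := isMinPathCover_of_isClosedSystem hT hlinear hmax hP hcov'
  refine ⟨_, isRunOn_of_coloring (b := b) hT hadj hmin ?_ hcol hinv, hout.trans ?_⟩
  · rw [hb, isInteriorCover_iff_of_isClosedSystem hT hlinear hmax hP hcov']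
    have e47 : s4.arr 7 = s3.arr 7 := hF4.arr 7 rfl
    have e42 : s4.arr 2 = s1.arr 2 := by rw [hF4.arr 2 rfl, hF3.arr 2 rfl, e2]
    have e43 : s4.arr 3 = s2.arr 3 := by rw [hF4.arr 3 rfl, hF3.arr 3 rfl]
    refine forall_congr' fun v => ?_
    rw [e42, e47, e43, hdeg, (hset v).1, hadj.length_filter, hzero]
    simp only [hzero]
  · have e0 : s6.out = [] := by
      rw [hF6.out rfl, hF5.out rfl, hF4.out rfl, hF3.out rfl, hF2.out rfl, hF1.out rfl]
      rfl
    simp [e0, Run.output, List.flatMap_map]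

end MainProgram

end ZFForest

theorem mainTheorem4 :
    (∀ {V : Type*} [Finite V] (T : SimpleGraph V), T.IsAcyclic →
      ∀ r : Run V, r.IsRunOn T → (r.answer = true ↔ IsIsoUniqueZeroForcing T)) ∧
    ∃ (prog : Program) (C : ℕ), ∀ (n : ℕ) (T : SimpleGraph (Fin n)), T.IsAcyclic →
      ∀ adj : Fin n → List (Fin n), IsAdjacencyList T adj →
        ∃ (r : Run (Fin n)) (t : ℕ) (s : State),
          Exec prog (initialState adj) t s ∧ t ≤ C * n ^ 2 + C ∧
            r.IsRunOn T ∧ s.out = r.output ∧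
            (r.answer = true ↔ IsIsoUniqueZeroForcing T) := by
  refine ⟨fun T hT r hr => hr.answer_iff hT, ?_⟩
  refine ⟨mainProg, 6000, fun n T hT adj hadj => ?_⟩
  obtain ⟨t, s, hexec, ht, r, hr, hout⟩ := wp_mainProg hT hadj
  refine ⟨r, t, s, hexec, ht.trans ?_, hr, hout, hr.answer_iff hT⟩
  -- `(n + 1) ^ 2 ≤ 2 * n ^ 2 + 2` turns the factor 3000 into 6000.
  nlinarith [sq_nonneg ((n : ℤ) - 1), two_mul_le_add_sq n 1]
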